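/- **Setting.** Let $\{V_{t,T}\}_{t=1}^{T}$, $T\ge 1$, be real random variables on a probability space $(\Omega,\mathscr F,\mathbb P)$, and let $0=\lambda_0^0<\lambda_1^0<\dots<\lambda_{m_0+1}^0=1$, $T_j^0=\lfloor T\lambda_j^0\rfloor$. Assume that $\{V_{t,T}\}$ is *segmented locally stationary*: for $T_{j-1}^0<t\le T_j^0$, $j=1,\dots,m_0+1$, $$V_{t,T}=\mu_j(t/T)+\int_{-\pi}^{\pi}e^{i\omega t}A^0_{j,t,T}(\omega)\,d\xi(\omega)\quad\text{a.s.},$$ where (a) $\xi$ is a process on $[-\pi,\pi]$ whose increments have moments of all orders, $\overline{d\xi(\omega)}=d\xi(-\omega)$ and, for all $r\ge1$, $\mathrm{cum}\{d\xi(\omega_1),\dots,d\xi(\omega_r)\}=\zeta(\sum_j\omega_j)\,g_r(\omega_1,\dots,\omega_{r-1})\,d\omega_1\cdots d\omega_r$, with $\zeta$ the $2\pi$-periodic Dirac delta, $g_1=0$, $g_2=1$ and each $g_r$ measurable and bounded; (b) there are $K<\infty$ and $A:[0,1]\times\mathbb R\to\mathbb C$, continuous on each $(\lambda_{j-1}^0,\lambda_j^0]\times\mathbb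 R$, with $A(u,\cdot)$ $2\pi$-periodic, $A(u,-\omega)=\overline{A(u,\omega)}$ for $u\in(0,1]$, and $\sup_{j}\sup_{T_{j-1}^0<t\le T_j^0,\,\omega}|A^0_{j,t,T}(\omega)-A(t/T,\omega)|\le K/T$ for all $T$; (c) each $\mu_j$ is Lipschitz on $(\lambda_{j-1}^0,\lambda_j^0]$. *Smoothness.* On each $(\lambda_{j-1}^0,\lambda_j^0]$ (with left derivatives at $\lambda_j^0$), $u\mapsto A(u,\omega)$ is twice continuously differentiable with first and second derivatives bounded, and second derivative Lipschitz in $u$, uniformly in $\omega$; $A(u,\omega)$ is Lipschitz in $\omega$ uniformly in $u$. Put $c(u,k)=\int_{-\pi}^{\pi}e^{i\omega k}|A(u,\omega)|^2d\omega$, write $g(\lambda+)$ for the limit of $g$ at $\lambda$ from the right, and let $\kappa_{T,t}(k,s,l)$ be the fourth-order cumulant of $(V_{t,T},V_{t+k,T},V_{t+s,T},V_{t+l,T})$ (that is, the centred fourth moment minus that of a Gaussian sequence with the same means and covariances), where $V_{t,T}:=0$ for $t\notin\{1,\dots,T\}$. *Dependence.* $\sum_{k\in\mathbb Z}\sup_{u\in(0,1]}|c(u,k)|<\infty$;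 $\sup_T\sum_{k,s,l\in\mathbb Z}\sup_{u\in[0,1]}|\kappa_{T,\lfloor Tu\rfloor}(k,s,l)|<\infty$; and there are $L<\infty$ and a function $\widetilde\kappa(u,k,s,l)$ with $|\kappa_{T,\lfloor Tu\rfloor}(k,s,l)-\widetilde\kappa(u,k,s,l)|\le L/T$ whenever $u$ lies in regime $j$ and all of the four dates lie in $\{T_{j-1}^0+1,\dots,T_j^0\}$, such that $\widetilde\kappa$ has in $u$ the same smoothness as $A$, uniformly in $k,s,l$. Let $n_T,n_{2,T}\to\infty$, $n_{2,T}$ even, with $n_T/T\to0$, $n_{2,T}/T\to0$, $n_T/n_{2,T}\to0$. For even $k\in\mathbb Z$ let $$\widehat c_T(u,k)=\frac1{n_{2,T}}\sum_{s=0}^{n_{2,T}-1}\bigl(V_{\lfloor Tu\rfloor+|k|/2-n_{2,T}/2+s+1}-\overline V_{u}\bigr)\bigl(V_{\lfloor Tu\rfloor-|k|/2-n_{2,T}/2+s+1}-\overline V_{u}\bigr),\quad \overline V_{u}=\frac1{n_{2,T}}\sum_{s=0}^{n_{2,T}-1}V_{\lfloor Tu\rfloor-n_{2,T}/2+s+1},$$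 $\widehat\Gamma_{\mathrm{DK}}(k)=\frac{n_T}{T}\sum_{r=1}^{\lfloor T/n_T\rfloor}\widehat c_T(rn_T/T,k)$, and let $W_T(u)=\{\ell_T,\dots,h_T\}$ be the local window, with $\ell_T=\lfloor Tu\rfloor+k/2-n_{2,T}/2+1$ and $h_T=\lfloor Tu\rfloor+k/2+n_{2,T}/2$. The point $u=u_T\in(0,1)$ may depend on $T$. All limits are as $T\to\infty$ unless stated otherwise. **Theorem.** Let $k\in\mathbb Z$ be even. (i) If $u_T\in[\delta,1-\delta]$ for some $\delta>0$ (in particular if $u_T=u\in(0,1)$ is fixed) and, for all large $T$, no $T_j^0$, $1\le j\le m_0$, lies in $W_T(u_T)$, then $\widehat c_T(u_T,k)=c(u_T,k)+o_{\mathbb P}(1)$. (ii) Suppose $T_j^0\in W_T(u_T)$ for all large $T$, for some $1\le j\le m_0$. (a) Let $\gamma\in(0,1)$. If $(T_j^0-\ell_T)/n_{2,T}\to\gamma$, then $$\widehat c_T(u_T,k)\ \ge\ \gamma\,c(\lambda_j^0,k)+(1-\gamma)\,c(u_T,k)+\gamma(1-\gamma)\bigl(\mu_j(\lambda_j^0)-\mu_{j+1}(u_T)\bigr)^2+o_{\mathbb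 P}(1),$$ where $c(u_T,k)$ and $\mu_{j+1}(u_T)$ are replaced by $c(\lambda_j^0+,k)$ and $\mu_{j+1}(\lambda_j^0+)$ if $u_T\le\lambda_j^0$. If $(h_T+1-T_j^0)/n_{2,T}\to\gamma$, then $$\widehat c_T(u_T,k)\ \ge\ \gamma\,c(\lambda_j^0+,k)+(1-\gamma)\,c(u_T,k)+\gamma(1-\gamma)\bigl(\mu_j(u_T)-\mu_{j+1}(\lambda_j^0+)\bigr)^2+o_{\mathbb P}(1),$$ where $c(u_T,k)$ and $\mu_j(u_T)$ are replaced by $c(\lambda_j^0,k)$ and $\mu_j(\lambda_j^0)$ if $u_T>\lambda_j^0$. (b) If $(T_j^0-\ell_T)/n_{2,T}\to0$ or $(h_T+1-T_j^0)/n_{2,T}\to0$, then $\widehat c_T(u_T,k)=c(u_T,k)+o_{\mathbb P}(1)$. (iii) Suppose that there are $j$ and blocks $r=r_T\in\{1,\dots,\lfloor T/n_T\rfloor\}$ such that, for some even lag $k$, $T_j^0\in W_T(u_T)$ for all large $T$ and one of the two cases of (ii-a) holds at $u_T=r_Tn_T/T$ with $\gamma\in(0,1)$. Let $d_T^*=(n_T/T)\,\gamma(1-\gamma)(\Delta\mu_T)^2$,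 where $\Delta\mu_T$ is the difference of means that is squared in the corresponding bound of (ii-a). Then $\mathbb P$-almost surely $$\liminf_{k\to\infty,\ k\text{ even}}\ \liminf_{T\to\infty}\bigl(\widehat\Gamma_{\mathrm{DK}}(k)-d_T^*\bigr)\ge0,$$ and $d_T^*\to0$; moreover $d_T^*>0$ for all large $T$ if $\mu_j(\lambda_j^0)\ne\mu_{j+1}(\lambda_j^0+)$. -/

import Mathlib

open Real Set Filter Topology MeasureTheory
open scoped NNReal ENNReal

noncomputable section

namespace SLS

/-! ### Spectral processes and stochastic integrals -/

/-- Joint cumulant of `X 0, …, X (n - 1)`: the sum over the set partitions `p` of the index set of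
`(-1)^(|p|-1) (|p|-1)! ∏_{B ∈ p} E ∏_{i ∈ B} X i`. -/
def jointCumulant {Ω : Type*} [MeasurableSpace Ω] (P : Measure Ω) {n : ℕ} (X : Fin n → Ω → ℂ) : ℂ :=
  ∑ p : Finpartition (Finset.univ : Finset (Fin n)),
    (-1) ^ (p.parts.card - 1) * ((p.parts.card - 1).factorial : ℂ) *
      ∏ B ∈ p.parts, ∫ x, ∏ i ∈ B, X i x ∂P

/-- `ξ` is a process on `[-π, π]` whose increments have moments of all orders, satisfy
`conj (dξ(ω)) = dξ(-ω)`, and have the cumulants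
`cum {dξ(ω₁), …, dξ(ω_{r+1})} = ζ(ω₁ + ⋯ + ω_{r+1}) g_{r+1}(ω₁, …, ω_r) dω₁ ⋯ dω_{r+1}`,
where `ζ` is the `2π`-periodic extension of the Dirac delta. The function `g r` of `r` variables is
the cumulant spectrum of order `r + 1`. The cumulant identity between measures is stated on boxes
`∏ i, (a i, b i]`; integrating out the last frequency against `ζ` sets it equal to
`-(ω₁ + ⋯ + ω_r)` modulo `2π`. -/
structure IsSpectralProcess {Ω : Type*} [MeasurableSpace Ω] (P : Measure Ω)
    (ξ : ℝ → Ω → ℂ) (g : (r : ℕ) → (Fin r → ℝ) → ℂ) : Prop where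
  memLp : ∀ a ∈ Icc (-π) π, ∀ b ∈ Icc (-π) π, ∀ p : ℕ,
    MemLp (fun x => ξ b x - ξ a x) (p : ℝ≥0∞) P
  conj_eq : ∀ a b : ℝ, -π ≤ a → a ≤ b → b ≤ π →
    ∀ᵐ x ∂P, (starRingEnd ℂ) (ξ b x - ξ a x) = ξ (-a) x - ξ (-b) x
  g_measurable : ∀ r, Measurable (g r)
  g_bounded : ∀ r, ∃ M : ℝ, ∀ w, ‖g r w‖ ≤ M
  g_one : ∀ w, g 0 w = 0
  g_two : ∀ w, g 1 w = 1
  cumulant_eq : ∀ (r : ℕ) (a b : Fin (r + 1) → ℝ), (∀ i, -π ≤ a i ∧ a i ≤ b i ∧ b i ≤ π) →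
    jointCumulant P (fun i x => ξ (b i) x - ξ (a i) x) =
      ∫ w in Set.pi univ (fun i : Fin r => Ioc (a i.castSucc) (b i.castSucc)),
        (Ioc (a (Fin.last r)) (b (Fin.last r))).indicator (fun _ => (1 : ℂ))
          (toIocMod Real.two_pi_pos (-π) (-∑ i, w i)) * g r w

/-- `X = ∫_{-π}^{π} φ(ω) dξ(ω)`: `X` is the `L²(P)`-limit of `∑ᵢ cᵢ (ξ(bᵢ) - ξ(aᵢ))` along step
functions `∑ᵢ cᵢ 1_{(aᵢ, bᵢ]}` that converge to `φ` in `L²(-π, π)`. -/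
def IsSpectralIntegral {Ω : Type*} [MeasurableSpace Ω] (P : Measure Ω)
    (ξ : ℝ → Ω → ℂ) (φ : ℝ → ℂ) (X : Ω → ℂ) : Prop :=
  MemLp φ 2 (volume.restrict (Ioc (-π) π)) ∧ MemLp X 2 P ∧
  ∃ (N : ℕ → ℕ) (a b : (m : ℕ) → Fin (N m) → ℝ) (c : (m : ℕ) → Fin (N m) → ℂ),
    (∀ m i, -π ≤ a m i ∧ a m i ≤ b m i ∧ b m i ≤ π) ∧
    Tendsto (fun m => eLpNorm
      (fun w => φ w - ∑ i, (Ioc (a m i) (b m i)).indicator (fun _ => c m i) w) 2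
      (volume.restrict (Ioc (-π) π))) atTop (𝓝 0) ∧
    Tendsto (fun m => eLpNorm
      (fun x => X x - ∑ i, c m i * (ξ (b m i) x - ξ (a m i) x)) 2 P) atTop (𝓝 0)

/-! ### Segmented locally stationary processes

The break fractions are `0 = lam 0 < lam 1 < ⋯ < lam (m + 1) = 1`. Regime `j : Fin (m + 1)` is
`(lam j, lam (j + 1)]` in rescaled time. Break `j : Fin m` separates the regimes `j.castSucc` and
`j.succ`. -/

/-- `0 = λ₀ < λ₁ < ⋯ < λ_{m+1} = 1`. -/
structure IsBreakFractions {m : ℕ} (lam : Fin (m + 2) → ℝ) : Prop where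
  strictMono : StrictMono lam
  first : lam 0 = 0
  last : lam (Fin.last (m + 1)) = 1

/-- Regime `j` in rescaled time, `(λ_j, λ_{j+1}]`. -/
def regime {m : ℕ} (lam : Fin (m + 2) → ℝ) (j : Fin (m + 1)) : Set ℝ :=
  Ioc (lam j.castSucc) (lam j.succ)

/-- Regime `j` in calendar time: the `t` with `⌊T λ_j⌋ < t ≤ ⌊T λ_{j+1}⌋`. -/
def dates {m : ℕ} (lam : Fin (m + 2) → ℝ) (T : ℕ) (j : Fin (m + 1)) : Set ℤ :=
  Ioc ⌊(T : ℝ) * lam j.castSucc⌋ ⌊(T : ℝ) * lam j.succ⌋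

/-- The fraction of the sample at which break `j` occurs. -/
def breakFrac {m : ℕ} (lam : Fin (m + 2) → ℝ) (j : Fin m) : ℝ := lam j.succ.castSucc

/-- The date of break `j` in a sample of size `T`: the last date of the regime before it. -/
def breakDate {m : ℕ} (lam : Fin (m + 2) → ℝ) (T : ℕ) (j : Fin m) : ℤ :=
  ⌊(T : ℝ) * breakFrac lam j⌋

/-- `V T t`, `1 ≤ t ≤ T`, is a segmented locally stationary array with limiting transfer function
`A` and trends `μ j`, one for each regime. -/
structure IsSLS {Ω : Type*} [MeasurableSpace Ω] (P : Measure Ω) {m : ℕ} (lam : Fin (m + 2) → ℝ)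
    (A : ℝ → ℝ → ℂ) (μ : Fin (m + 1) → ℝ → ℝ) (V : ℕ → ℕ → Ω → ℝ) : Prop where
  representation : ∃ (ξ : ℝ → Ω → ℂ) (g : (r : ℕ) → (Fin r → ℝ) → ℂ)
      (A₀ : Fin (m + 1) → ℕ → ℕ → ℝ → ℂ) (K : ℝ),
    IsSpectralProcess P ξ g ∧
    (∀ (T : ℕ) (j : Fin (m + 1)) (t : ℕ), 1 ≤ T → (t : ℤ) ∈ dates lam T j →
      ∃ X : Ω → ℂ,
        IsSpectralIntegral P ξ (fun w => Complex.exp (Complex.I * w * t) * A₀ j t T w) X ∧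
        ∀ᵐ x ∂P, (V T t x : ℂ) = (μ j ((t : ℝ) / T) : ℂ) + X x) ∧
    (∀ (T : ℕ) (j : Fin (m + 1)) (t : ℕ) (w : ℝ), 1 ≤ T → (t : ℤ) ∈ dates lam T j →
      ‖A₀ j t T w - A ((t : ℝ) / T) w‖ ≤ K / T)
  continuousOn : ∀ j, ContinuousOn (fun q : ℝ × ℝ => A q.1 q.2) (regime lam j ×ˢ univ)
  periodic : ∀ u ∈ Ioc (0 : ℝ) 1, Function.Periodic (A u) (2 * π)
  hermitian : ∀ u ∈ Ioc (0 : ℝ) 1, ∀ w, A u (-w) = (starRingEnd ℂ) (A u w)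
  trend_lipschitz : ∀ j, ∃ L : ℝ≥0, LipschitzOnWith L (μ j) (regime lam j)

/-- On every regime `(λ_j, λ_{j+1}]`, `f` is twice continuously differentiable (from the left at
`λ_{j+1}`), with first and second derivatives bounded by `B` and `B`-Lipschitz second derivative. -/
def SmoothOnRegimes {E : Type*} [NormedAddCommGroup E] [NormedSpace ℝ E] {m : ℕ}
    (lam : Fin (m + 2) → ℝ) (B : ℝ≥0) (f : ℝ → E) : Prop :=
  ∀ j, ContDiffOn ℝ 2 f (regime lam j) ∧
    (∀ u ∈ regime lam j, ‖derivWithin f (regime lam j) u‖ ≤ B ∧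
      ‖iteratedDerivWithin 2 f (regime lam j) u‖ ≤ B) ∧
    LipschitzOnWith B (iteratedDerivWithin 2 f (regime lam j)) (regime lam j)

/-- The smoothness assumption on the transfer function. -/
structure SmoothTransfer {m : ℕ} (lam : Fin (m + 2) → ℝ) (A : ℝ → ℝ → ℂ) : Prop where
  smooth_time : ∃ B : ℝ≥0, ∀ w, SmoothOnRegimes lam B (fun u => A u w)
  lipschitz_freq : ∃ L : ℝ≥0, ∀ u ∈ Ioc (0 : ℝ) 1, LipschitzWith L (A u)

/-- The local autocovariance `c(u, k) = ∫_{-π}^{π} e^{iωk} f(u, ω) dω` with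
`f(u, ω) = |A(u, ω)|²`. The integral is real because `f(u, ·)` is even. -/
def localCov (A : ℝ → ℝ → ℂ) (u : ℝ) (k : ℤ) : ℝ :=
  (∫ w in (-π)..π, Complex.exp (Complex.I * w * k) * ((‖A u w‖ ^ 2 : ℝ) : ℂ)).re

/-- The observations, set to `0` at dates outside `1, …, T`. -/
def obs {Ω : Type*} (V : ℕ → ℕ → Ω → ℝ) (T : ℕ) (t : ℤ) (x : Ω) : ℝ :=
  if 1 ≤ t ∧ t ≤ T then V T t.toNat x else 0

/-- `V_t - E V_t`. -/
def centered {Ω : Type*} [MeasurableSpace Ω] (P : Measure Ω) (V : ℕ → ℕ → Ω → ℝ) (T : ℕ) (t : ℤ)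
    (x : Ω) : ℝ :=
  obs V T t x - ∫ y, obs V T t y ∂P

/-- Autocovariance of `V_s` and `V_t`. -/
def autoCov {Ω : Type*} [MeasurableSpace Ω] (P : Measure Ω) (V : ℕ → ℕ → Ω → ℝ) (T : ℕ) (s t : ℤ) :
    ℝ :=
  ∫ x, centered P V T s x * centered P V T t x ∂P

/-- Fourth-order cumulant of `(V_t, V_{t+k}, V_{t+s}, V_{t+l})`: the centred fourth moment minus
that of a Gaussian sequence with the same means and covariances. -/
def fourthCumulant {Ω : Type*} [MeasurableSpace Ω] (P : Measure Ω) (V : ℕ → ℕ → Ω → ℝ) (T : ℕ)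
    (t k s l : ℤ) : ℝ :=
  (∫ x, centered P V T t x * centered P V T (t + k) x * centered P V T (t + s) x *
      centered P V T (t + l) x ∂P) -
    (autoCov P V T t (t + k) * autoCov P V T (t + s) (t + l) +
      autoCov P V T t (t + s) * autoCov P V T (t + k) (t + l) +
      autoCov P V T t (t + l) * autoCov P V T (t + k) (t + s))

/-- The temporal dependence assumption: summability of the local autocovariances and of the
fourth-order cumulants (uniformly in `T`), and approximation of the latter, within each regime, by
a function `κ` that is smooth in rescaled time. -/
structure WeakDependence {Ω : Type*} [MeasurableSpace Ω] (P : Measure Ω) {m : ℕ}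
    (lam : Fin (m + 2) → ℝ) (A : ℝ → ℝ → ℂ) (V : ℕ → ℕ → Ω → ℝ) : Prop where
  cov_summable : ∃ b : ℤ → ℝ, Summable b ∧ ∀ k, ∀ u ∈ Ioc (0 : ℝ) 1, |localCov A u k| ≤ b k
  cum_summable : ∃ C : ℝ, ∀ T : ℕ, ∃ b : ℤ × ℤ × ℤ → ℝ, Summable b ∧ ∑' q, b q ≤ C ∧
    ∀ u ∈ Icc (0 : ℝ) 1, ∀ k s l : ℤ,
      |fourthCumulant P V T ⌊(T : ℝ) * u⌋ k s l| ≤ b (k, s, l)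
  cum_smooth : ∃ (κ : ℝ → ℤ → ℤ → ℤ → ℝ) (L : ℝ) (B : ℝ≥0),
    (∀ (T : ℕ) (j : Fin (m + 1)) (u : ℝ) (k s l : ℤ), 1 ≤ T → u ∈ regime lam j →
      (∀ h ∈ ({0, k, s, l} : Set ℤ), ⌊(T : ℝ) * u⌋ + h ∈ dates lam T j) →
      |fourthCumulant P V T ⌊(T : ℝ) * u⌋ k s l - κ u k s l| ≤ L / T) ∧
    ∀ k s l, SmoothOnRegimes lam B (fun u => κ u k s l)

/-! ### The estimators -/

/-- The mean of the `N` observations at the dates `t - N/2 + 1, …, t + N/2`. -/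
def localMean {Ω : Type*} (V : ℕ → ℕ → Ω → ℝ) (N T : ℕ) (t : ℤ) (x : Ω) : ℝ :=
  (N : ℝ)⁻¹ * ∑ s ∈ Finset.range N, obs V T (t - (N : ℤ) / 2 + s + 1) x

/-- The sample local autocovariance `ĉ_T(u, k)` with window length `N`. -/
def sampleLocalCov {Ω : Type*} (V : ℕ → ℕ → Ω → ℝ) (N T : ℕ) (u : ℝ) (k : ℤ) (x : Ω) : ℝ :=
  (N : ℝ)⁻¹ * ∑ s ∈ Finset.range N,
    (obs V T (⌊(T : ℝ) * u⌋ + |k| / 2 - (N : ℤ) / 2 + s + 1) x -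
        localMean V N T ⌊(T : ℝ) * u⌋ x) *
      (obs V T (⌊(T : ℝ) * u⌋ - |k| / 2 - (N : ℤ) / 2 + s + 1) x -
        localMean V N T ⌊(T : ℝ) * u⌋ x)

/-- `Γ̂_DK(k) = (n/T) ∑_{r=1}^{⌊T/n⌋} ĉ_T(r n/T, k)` with block length `n`, window length `N`. -/
def gammaDK {Ω : Type*} (V : ℕ → ℕ → Ω → ℝ) (n N T : ℕ) (k : ℤ) (x : Ω) : ℝ :=
  (n : ℝ) / T * ∑ r ∈ Finset.Icc 1 (T / n), sampleLocalCov V N T ((r : ℝ) * n / T) k x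

/-- First date `⌊Tu⌋ + k/2 - N/2 + 1` of the local window. -/
def winLo (N T : ℕ) (u : ℝ) (k : ℤ) : ℤ := ⌊(T : ℝ) * u⌋ + k / 2 - (N : ℤ) / 2 + 1

/-- Last date `⌊Tu⌋ + k/2 + N/2` of the local window. -/
def winHi (N T : ℕ) (u : ℝ) (k : ℤ) : ℤ := ⌊(T : ℝ) * u⌋ + k / 2 + (N : ℤ) / 2

/-- Break `j` lies in the local window for all large `T`. -/
def BreakInWindow {m : ℕ} (lam : Fin (m + 2) → ℝ) (N : ℕ → ℕ) (u : ℕ → ℝ) (k : ℤ) (j : Fin m) :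
    Prop :=
  ∀ᶠ T : ℕ in atTop, breakDate lam T j ∈ Icc (winLo (N T) T (u T) k) (winHi (N T) T (u T) k)

/-- The distance of break `j` from the left edge of the window, as a fraction of the window
length, tends to `γ`. -/
def LeftFraction {m : ℕ} (lam : Fin (m + 2) → ℝ) (N : ℕ → ℕ) (u : ℕ → ℝ) (k : ℤ) (j : Fin m)
    (γ : ℝ) : Prop :=
  Tendsto (fun T : ℕ => ((breakDate lam T j : ℝ) - winLo (N T) T (u T) k) / N T) atTop (𝓝 γ)

/-- The distance of break `j` from the right edge of the window, as a fraction of the window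
length, tends to `γ`. -/
def RightFraction {m : ℕ} (lam : Fin (m + 2) → ℝ) (N : ℕ → ℕ) (u : ℕ → ℝ) (k : ℤ) (j : Fin m)
    (γ : ℝ) : Prop :=
  Tendsto (fun T : ℕ => (((winHi (N T) T (u T) k : ℝ) + 1) - breakDate lam T j) / N T) atTop (𝓝 γ)

/-- The value after a break at `l`: `f u` if `u` lies beyond `l`, and the right-hand limit `f(l+)`
otherwise. -/
def postBreak (f : ℝ → ℝ) (l u : ℝ) : ℝ := if l < u then f u else Function.rightLim f l

/-- The value up to a break at `l`: `f u` if `u` does not lie beyond `l`, and `f l` otherwise. -/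
def preBreak (f : ℝ → ℝ) (l u : ℝ) : ℝ := if u ≤ l then f u else f l

/-- The difference of the trends across break `j`, when a fraction measured from the left edge is
used: `μ_j(λ_j) - μ_{j+1}(u)`. -/
def meanGapLeft {m : ℕ} (lam : Fin (m + 2) → ℝ) (μ : Fin (m + 1) → ℝ → ℝ) (j : Fin m) (u : ℝ) : ℝ :=
  μ j.castSucc (breakFrac lam j) - postBreak (μ j.succ) (breakFrac lam j) u

/-- The mirror image, when the fraction is measured from the right edge:
`μ_j(u) - μ_{j+1}(λ_j+)`. -/
def meanGapRight {m : ℕ} (lam : Fin (m + 2) → ℝ) (μ : Fin (m + 1) → ℝ → ℝ) (j : Fin m) (u : ℝ) :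
    ℝ :=
  preBreak (μ j.castSucc) (breakFrac lam j) u - Function.rightLim (μ j.succ) (breakFrac lam j)

/-- `X_T ≥ b_T + o_P(1)`. -/
def GeInProbability {Ω : Type*} [MeasurableSpace Ω] (P : Measure Ω) (X : ℕ → Ω → ℝ) (b : ℕ → ℝ) :
    Prop :=
  ∀ ε > 0, Tendsto (fun T => P {x | X T x < b T - ε}) atTop (𝓝 0)

/-- `X_T = b_T + o_P(1)`. -/
def EqInProbability {Ω : Type*} [MeasurableSpace Ω] (P : Measure Ω) (X : ℕ → Ω → ℝ) (b : ℕ → ℝ) :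
    Prop :=
  TendstoInMeasure P (fun T x => X T x - b T) atTop (fun _ => 0)

/-- `Γ̂_DK(k) ≥ d_T` almost surely, asymptotically as `T → ∞` and then `k → ∞` along even lags:
almost surely, `liminf_{k → ∞} liminf_{T → ∞} (Γ̂_DK(k) - d_T) ≥ 0`. -/
def GammaDKGeAlmostSurely {Ω : Type*} [MeasurableSpace Ω] (P : Measure Ω) (V : ℕ → ℕ → Ω → ℝ)
    (n N : ℕ → ℕ) (d : ℕ → ℝ) : Prop :=
  ∀ᵐ x ∂P, ∀ ε > 0, ∀ᶠ h : ℕ in atTop, ∀ᶠ T : ℕ in atTop,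
    d T - ε ≤ gammaDK V (n T) (N T) T (2 * (h : ℤ)) x

end SLS

end

/-! All moments come from the spectral representation. For step functions the cumulant formula gives
an isometry from `L²(-π, π)` into `L²(P)`, and boundedness of the fourth-order cumulant spectrum
bounds fourth moments by squared second moments. Both pass to general integrals
(`IsSpectralIntegral.integral_norm_sq`, `IsSpectralProcess.fourth_moment`). Covariances are thus, up
to `O(1/T)`, Fourier coefficients of products of transfer functions. They decay like `1/(1 + |s -
t|)` because `A` is Lipschitz in frequency, and they are close to `c(u, s - t)` near `u` because `A`
is Lipschitz in time (`IsSLS.exists_momentBounds`). With summable fourth cumulants, sums of centred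
lagged products over `J` have variance `O(|J|)` (`MomentBounds.exists_varianceBounds`).

For a single window, the sample autocovariance is therefore close in `L¹`, uniformly over windows,
to a deterministic centring: the average covariance plus the sample autocovariance of the means
(`MomentBounds.exists_winCov_concentration`). In a window that shrinks in rescaled time, covariances
and means are nearly constant on either side of a break. Two levels `a₁`, `a₂` with weights `γ`, `1
- γ` have variance `γ(1 - γ)(a₁ - a₂)²`, and that is the mean-gap term
(`abs_winAvg_add_winCov_sub_le`). The bounds at an interior fraction are in fact equalities up to
`o_P(1)`; the edge case is `γ = 0` or `γ = 1`.

For the double-kernel estimator, `d_T → 0` since `n_T / T → 0` and the gap converges, so it remains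
to show that the estimator is almost surely asymptotically nonnegative at large lags. Overlapping
windows cover each bulk date about `N / n` times, so the block average of lagged products is close
to `T⁻¹ ∑ y_t y_{t+2h}`, where `y` denotes the centred observations. Means vary slowly except near
finitely many breaks, and those dates have vanishing weight. Squared window means are handled by a
van der Corput inequality, which compares them with averages over a fixed number `M` of dates and so
with finitely many fixed lags (`blockAvg_winCov_ge`).

What is left is a strong law for each of countably many fixed lags
(`MomentBounds.ae_tendsto_quadratic`). The observations form an array, so the law needs control of
the change in the sample size: partial sums have variance `O(T)` and squared increments `O((T - S +
1)²)`, which suffices along the grid `⌊i^{3/2}⌋` and between its points. The limiting bound `C/(1 +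
2h)` on the lagged average vanishes as `h → ∞`. -/

noncomputable section

namespace SLS

/-! ### Joint cumulants as multilinear forms, and moments of order up to four -/

section Cumulants

variable {Ω : Type*} [MeasurableSpace Ω]

/-- The random variables with moments of all orders. -/
def allMoments (P : Measure Ω) : Submodule ℂ (Ω → ℂ) where
  carrier := {X | ∀ p : ℕ, MemLp X (p : ℝ≥0∞) P}
  add_mem' hX hY p := (hX p).add (hY p)
  zero_mem' _ := MemLp.zero
  smul_mem' c _ hX p := (hX p).const_smul c

variable {P : Measure Ω}

/-- Hölder with exponents `2p`, `2p`. This closure is why all orders are carried along: products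
over the blocks of a partition stay integrable. -/
lemma allMoments_mul {X Y : Ω → ℂ} (hX : X ∈ allMoments P) (hY : Y ∈ allMoments P) :
    X * Y ∈ allMoments P := by
  intro p
  have : ENNReal.HolderTriple ((2 * p : ℕ) : ℝ≥0∞) ((2 * p : ℕ) : ℝ≥0∞) (p : ℝ≥0∞) := by
    constructor
    push_cast
    rw [ENNReal.mul_inv (by simp) (by simp), ← add_mul, ENNReal.inv_two_add_inv_two, one_mul]
  exact (hY (2 * p)).mul (hX (2 * p))

lemma allMoments_prod [IsFiniteMeasure P] {ι : Type*} (s : Finset ι) {X : ι → Ω → ℂ}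
    (hX : ∀ i ∈ s, X i ∈ allMoments P) : ∏ i ∈ s, X i ∈ allMoments P := by
  classical
  induction s using Finset.induction_on with
  | empty => exact fun p => memLp_const 1
  | insert a s ha ih =>
    rw [Finset.prod_insert ha]
    exact allMoments_mul (hX a (by simp)) (ih fun i hi => hX i (by simp [hi]))

lemma allMoments_integrable {X : Ω → ℂ} (hX : X ∈ allMoments P) : Integrable X P :=
  memLp_one_iff_integrable.1 (by simpa using hX 1)

/-- An index lies in exactly one block, so changing one argument affects a single factor.
Multilinearity of the block products thus reduces to linearity of one integral. -/
lemma prod_parts_update [IsFiniteMeasure P] {n : ℕ}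
    (p : Finpartition (Finset.univ : Finset (Fin n)))
    (X : Fin n → allMoments P) (i : Fin n) (v : allMoments P) :
    ∏ B ∈ p.parts, ∫ x, ∏ j ∈ B, (Function.update X i v j : Ω → ℂ) x ∂P =
      (∫ x, (v : Ω → ℂ) x * (∏ j ∈ (p.part i).erase i, (X j : Ω → ℂ)) x ∂P) *
        ∏ B ∈ p.parts.erase (p.part i), ∫ x, ∏ j ∈ B, (X j : Ω → ℂ) x ∂P := by
  rw [← Finset.mul_prod_erase _ _ (p.part_mem.2 (Finset.mem_univ i))]
  congr 1
  · congr 1 with x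
    rw [← Finset.mul_prod_erase _ _ (p.mem_part (Finset.mem_univ i)), Function.update_self,
      Finset.prod_apply]
    congr 1
    refine Finset.prod_congr rfl fun j hj => ?_
    rw [Function.update_of_ne (Finset.ne_of_mem_erase hj)]
  · refine Finset.prod_congr rfl fun B hB => ?_
    congr 1 with x
    refine Finset.prod_congr rfl fun j hj => ?_
    rw [Function.update_of_ne]
    rintro rfl
    exact Finset.ne_of_mem_erase hB
      (p.part_eq_of_mem (Finset.mem_of_mem_erase hB) hj).symm

/-- The product of the moments over the blocks of a partition, as a multilinear form. -/
def partitionMoment [IsFiniteMeasure P] {n : ℕ}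
    (p : Finpartition (Finset.univ : Finset (Fin n))) :
    MultilinearMap ℂ (fun _ : Fin n => allMoments P) ℂ where
  toFun X := ∏ B ∈ p.parts, ∫ x, ∏ i ∈ B, (X i : Ω → ℂ) x ∂P
  map_update_add' {inst} X i v w := by
    obtain rfl : inst = instDecidableEqFin n := Subsingleton.elim _ _
    have hR : ∏ j ∈ (p.part i).erase i, (X j : Ω → ℂ) ∈ allMoments P :=
      allMoments_prod _ fun j _ => (X j).2
    simp only [prod_parts_update, Submodule.coe_add, Pi.add_apply, add_mul]
    rw [integral_add, add_mul]
    · exact allMoments_integrable (allMoments_mul v.2 hR)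
    · exact allMoments_integrable (allMoments_mul w.2 hR)
  map_update_smul' {inst} X i c v := by
    obtain rfl : inst = instDecidableEqFin n := Subsingleton.elim _ _
    simp only [prod_parts_update, Submodule.coe_smul, Pi.smul_apply, smul_eq_mul, mul_assoc]
    rw [integral_const_mul, mul_assoc]

/-- The joint cumulant as a multilinear form. -/
def cumulantForm (P : Measure Ω) [IsFiniteMeasure P] (n : ℕ) :
    MultilinearMap ℂ (fun _ : Fin n => allMoments P) ℂ :=
  ∑ p : Finpartition (Finset.univ : Finset (Fin n)),
    ((-1) ^ (p.parts.card - 1) * ((p.parts.card - 1).factorial : ℂ)) • partitionMoment p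

lemma cumulantForm_apply [IsFiniteMeasure P] {n : ℕ} (X : Fin n → allMoments P) :
    cumulantForm P n X = jointCumulant P (fun i => (X i : Ω → ℂ)) := by
  simp [cumulantForm, jointCumulant, partitionMoment]

/-- The joint cumulant is the moment plus the contribution of the partitions into at least two
blocks. -/
lemma jointCumulant_eq_moment_add {n : ℕ} [NeZero n] (X : Fin n → Ω → ℂ) :
    jointCumulant P X = (∫ x, ∏ i, X i x ∂P) +
      ∑ p : Finpartition (Finset.univ : Finset (Fin n)) with p.parts.card ≠ 1,
        (-1) ^ (p.parts.card - 1) * ((p.parts.card - 1).factorial : ℂ) *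
          ∏ B ∈ p.parts, ∫ x, ∏ i ∈ B, X i x ∂P := by
  have hne : (Finset.univ : Finset (Fin n)) ≠ ⊥ := Finset.univ_nonempty.ne_empty
  rw [jointCumulant, ← Finset.sum_filter_add_sum_filter_not _
    (fun p : Finpartition (Finset.univ : Finset (Fin n)) => p.parts.card = 1)]
  congr 1
  rw [Finset.sum_eq_single (Finpartition.indiscrete hne)]
  · simp
  · intro p hp hp'
    exfalso
    apply hp'
    obtain ⟨B, hB⟩ := Finset.card_eq_one.1 (Finset.mem_filter.1 hp).2
    have hs := p.sup_parts
    rw [hB, Finset.sup_singleton, id] at hs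
    ext1
    rw [hB, hs]
    rfl
  · intro h
    simp at h

lemma prod_parts_eq_zero {n : ℕ} {X : Fin n → Ω → ℂ} (hX : ∀ i, ∫ x, X i x ∂P = 0)
    {p : Finpartition (Finset.univ : Finset (Fin n))} {B : Finset (Fin n)} (hB : B ∈ p.parts)
    (hB1 : B.card = 1) : ∏ B ∈ p.parts, ∫ x, ∏ i ∈ B, X i x ∂P = 0 := by
  obtain ⟨i, rfl⟩ := Finset.card_eq_one.1 hB1
  exact Finset.prod_eq_zero hB (by simp [hX])

lemma card_parts_sum {n : ℕ} (p : Finpartition (Finset.univ : Finset (Fin n))) :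
    ∑ B ∈ p.parts, B.card = n := by
  simpa using p.sum_card_parts

lemma one_le_card_of_mem_parts {n : ℕ} {p : Finpartition (Finset.univ : Finset (Fin n))}
    {B : Finset (Fin n)} (hB : B ∈ p.parts) : 1 ≤ B.card :=
  Finset.card_pos.2 (p.nonempty_of_mem_parts hB)

/-- Serves the counting for small `n`: two distinct blocks share `n` elements, so `n = 2` forces
singletons, and `n = 4` without singletons forces two pairs. -/
lemma exists_ne_part {n : ℕ} {p : Finpartition (Finset.univ : Finset (Fin n))}
    (hp : p.parts.card ≠ 1) {B : Finset (Fin n)} (hB : B ∈ p.parts) :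
    ∃ B' ∈ p.parts, B' ≠ B ∧ B.card + B'.card ≤ n := by
  have h1 : 1 < p.parts.card := by
    have := Finset.card_pos.2 ⟨B, hB⟩
    omega
  obtain ⟨B', hB', hne⟩ := Finset.exists_mem_ne h1 B
  refine ⟨B', hB', hne, ?_⟩
  refine le_of_le_of_eq ?_ (card_parts_sum p)
  rw [← Finset.sum_pair (f := Finset.card) hne.symm]
  refine Finset.sum_le_sum_of_subset ?_
  intro b hb
  simp only [Finset.mem_insert, Finset.mem_singleton] at hb
  rcases hb with rfl | rfl <;> assumption

/-- Second cumulants of centred variables are second moments. -/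
lemma jointCumulant_two {X : Fin 2 → Ω → ℂ} (hX : ∀ i, ∫ x, X i x ∂P = 0) :
    jointCumulant P X = ∫ x, X 0 x * X 1 x ∂P := by
  rw [jointCumulant_eq_moment_add, Finset.sum_eq_zero, add_zero]
  · simp
  · intro p hp
    have hp1 := (Finset.mem_filter.1 hp).2
    obtain ⟨B, hB⟩ : p.parts.Nonempty := by
      exact p.parts_nonempty Finset.univ_nonempty.ne_empty
    obtain ⟨B', hB', -, hc⟩ := exists_ne_part hp1 hB
    have := one_le_card_of_mem_parts hB
    have := one_le_card_of_mem_parts hB'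
    rw [prod_parts_eq_zero hX hB (by omega), mul_zero]

lemma jointCumulant_one {X : Fin 1 → Ω → ℂ} : jointCumulant P X = ∫ x, X 0 x ∂P := by
  rw [jointCumulant_eq_moment_add, Finset.sum_eq_zero, add_zero]
  · simp
  · intro p hp
    exfalso
    have hp1 := (Finset.mem_filter.1 hp).2
    obtain ⟨B, hB⟩ : p.parts.Nonempty := by
      exact p.parts_nonempty Finset.univ_nonempty.ne_empty
    obtain ⟨B', hB', -, hc⟩ := exists_ne_part hp1 hB
    have := one_le_card_of_mem_parts hB
    have := one_le_card_of_mem_parts hB'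
    omega

/-- Number of ways in which lower order moments enter a cumulant of order `n`, with weights. -/
def pairingConstant (n : ℕ) : ℝ :=
  ∑ p : Finpartition (Finset.univ : Finset (Fin n)), ((p.parts.card - 1).factorial : ℝ)

lemma pairingConstant_nonneg (n : ℕ) : 0 ≤ pairingConstant n :=
  Finset.sum_nonneg fun _ _ => Nat.cast_nonneg _

/-- A mixed fourth moment of centred variables is bounded by the fourth cumulant and the second
moments. -/
lemma norm_moment_four_le {n : ℕ} [NeZero n] (hn : n = 4) {X : Fin n → Ω → ℂ}
    (hX : ∀ i, ∫ x, X i x ∂P = 0) {D : ℝ}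
    (h2 : ∀ i j, i ≠ j → ‖∫ x, X i x * X j x ∂P‖ ≤ D) :
    ‖∫ x, ∏ i, X i x ∂P‖ ≤ ‖jointCumulant P X‖ + pairingConstant n * D ^ 2 := by
  have key : ∀ a b c : ℂ, a = b + c → ‖c‖ ≤ pairingConstant n * D ^ 2 →
      ‖b‖ ≤ ‖a‖ + pairingConstant n * D ^ 2 := by
    intro a b c h hc
    rw [eq_sub_of_add_eq h.symm]
    exact (norm_sub_le _ _).trans (add_le_add le_rfl hc)
  refine key _ _ _ (jointCumulant_eq_moment_add X) ((norm_sum_le _ _).trans ?_)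
  rw [pairingConstant, Finset.sum_mul]
  refine (Finset.sum_le_sum (g := fun p => ((p.parts.card - 1).factorial : ℝ) * D ^ 2) ?_).trans
    (Finset.sum_le_sum_of_subset_of_nonneg (Finset.filter_subset _ _)
      fun p _ _ => by positivity)
  intro p hp
  have hp1 := (Finset.mem_filter.1 hp).2
  rw [norm_mul, norm_mul, norm_pow, norm_neg, norm_one, one_pow, one_mul, Complex.norm_natCast]
  refine mul_le_mul_of_nonneg_left ?_ (Nat.cast_nonneg _)
  -- A singleton block contributes a zero mean. Otherwise at least two blocks of size at least two
  -- partition four elements, so the partition is a pairing and each factor is a second moment.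
  by_cases hs : ∃ B ∈ p.parts, B.card = 1
  · obtain ⟨B, hB, hB1⟩ := hs
    rw [prod_parts_eq_zero hX hB hB1, norm_zero]
    positivity
  · push Not at hs
    have h2' : ∀ B ∈ p.parts, B.card = 2 := by
      intro B hB
      obtain ⟨B', hB', -, hc⟩ := exists_ne_part hp1 hB
      have := one_le_card_of_mem_parts hB
      have := one_le_card_of_mem_parts hB'
      have := hs B hB
      have := hs B' hB'
      omega
    have hcard : p.parts.card = 2 := by
      have := card_parts_sum p
      rw [Finset.sum_congr rfl h2'] at this
      simp at this
      omega
    rw [norm_prod, ← hcard, ← Finset.prod_const]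
    refine Finset.prod_le_prod (fun _ _ => norm_nonneg _) fun B hB => ?_
    obtain ⟨i, j, hij, rfl⟩ := Finset.card_eq_two.1 (h2' B hB)
    simpa [Finset.prod_pair hij] using h2 i j hij

end Cumulants

/-! ### Stochastic integrals of step functions: isometry and cumulants -/

section StepFunctions

variable {Ω : Type*} [MeasurableSpace Ω] {P : Measure Ω}
  {ξ : ℝ → Ω → ℂ} {g : (r : ℕ) → (Fin r → ℝ) → ℂ}

/-- The step function `∑ᵢ cᵢ 1_{(aᵢ, bᵢ]}`. -/
def stepFun {N : ℕ} (a b : Fin N → ℝ) (c : Fin N → ℂ) (w : ℝ) : ℂ :=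
  ∑ i, (Ioc (a i) (b i)).indicator (fun _ => c i) w

/-- The stochastic integral of a step function. -/
def stepSum (ξ : ℝ → Ω → ℂ) {N : ℕ} (a b : Fin N → ℝ) (c : Fin N → ℂ) (x : Ω) : ℂ :=
  ∑ i, c i * (ξ (b i) x - ξ (a i) x)

lemma measurable_stepFun {N : ℕ} (a b : Fin N → ℝ) (c : Fin N → ℂ) :
    Measurable (stepFun a b c) :=
  Finset.measurable_sum _ fun _ _ => measurable_const.indicator measurableSet_Ioc

lemma norm_stepFun_le {N : ℕ} (a b : Fin N → ℝ) (c : Fin N → ℂ) (w : ℝ) :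
    ‖stepFun a b c w‖ ≤ ∑ i, ‖c i‖ :=
  (norm_sum_le _ _).trans (Finset.sum_le_sum fun _ _ => norm_indicator_le_norm_self _ _)

/-- Frequencies reduced modulo `2π` to `(-π, π]`. -/
abbrev wrap (w : ℝ) : ℝ := toIocMod Real.two_pi_pos (-π) w

lemma wrap_eq_self {w : ℝ} (hw : w ∈ Ioc (-π) π) : wrap w = w := by
  rw [wrap, toIocMod_eq_self]
  constructor
  · exact hw.1
  · linarith [hw.2]

lemma measurable_wrap : Measurable wrap := by
  have : wrap = fun w => w - toIocDiv Real.two_pi_pos (-π) w • (2 * π) := rfl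
  have h2 : ∀ w, toIocDiv Real.two_pi_pos (-π) w = -⌊(-π + 2 * π - w) / (2 * π)⌋ := fun w =>
    toIocDiv_eq_neg_floor _ _ _
  rw [this]
  simp_rw [h2, zsmul_eq_mul]
  fun_prop

lemma IsSpectralProcess.incr_mem (hξ : IsSpectralProcess P ξ g) {a b : ℝ} (ha : -π ≤ a)
    (hab : a ≤ b) (hb : b ≤ π) : (fun x => ξ b x - ξ a x) ∈ allMoments P :=
  fun p => hξ.memLp a ⟨ha, hab.trans hb⟩ b ⟨ha.trans hab, hb⟩ p

lemma IsSpectralProcess.integral_incr (hξ : IsSpectralProcess P ξ g) {a b : ℝ} (ha : -π ≤ a)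
    (hab : a ≤ b) (hb : b ≤ π) : ∫ x, (ξ b x - ξ a x) ∂P = 0 := by
  have h := hξ.cumulant_eq 0 (fun _ => a) (fun _ => b) (fun _ => ⟨ha, hab, hb⟩)
  rw [jointCumulant_one] at h
  rw [h]
  simp [hξ.g_one]

lemma IsSpectralProcess.integral_incr_mul (hξ : IsSpectralProcess P ξ g) {a b a' b' : ℝ}
    (ha : -π ≤ a) (hab : a ≤ b) (hb : b ≤ π) (ha' : -π ≤ a') (hab' : a' ≤ b') (hb' : b' ≤ π) :
    ∫ x, (ξ b x - ξ a x) * (ξ b' x - ξ a' x) ∂P =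
      ∫ w in Ioc a b, (Ioc a' b').indicator (fun _ => (1 : ℂ)) (wrap (-w)) := by
  have hcum := hξ.cumulant_eq 1 ![a, a'] ![b, b'] (by
    intro i
    fin_cases i
    · exact ⟨ha, hab, hb⟩
    · exact ⟨ha', hab', hb'⟩)
  rw [jointCumulant_two] at hcum
  · have h1 : ∫ x, (ξ b x - ξ a x) * (ξ b' x - ξ a' x) ∂P =
        ∫ x, (ξ (![b, b'] 0) x - ξ (![a, a'] 0) x) *
          (ξ (![b, b'] 1) x - ξ (![a, a'] 1) x) ∂P := by simp
    rw [h1, hcum]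
    have hpre : Set.pi univ (fun i : Fin 1 => Ioc (![a, a'] i.castSucc) (![b, b'] i.castSucc)) =
        (MeasurableEquiv.funUnique (Fin 1) ℝ) ⁻¹' Ioc a b := by
      ext w
      simp
    rw [hpre, ← (volume_preserving_funUnique (Fin 1) ℝ).setIntegral_preimage_emb
      (MeasurableEquiv.measurableEmbedding _)]
    simp [hξ.g_two, wrap]
    rfl
  · intro i
    fin_cases i
    · exact hξ.integral_incr ha hab hb
    · exact hξ.integral_incr ha' hab' hb'

/-- Conjugation reflects the interval and the constraint `ω₁ + ω₂ = 0` reflects it back, so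
increments over disjoint intervals are uncorrelated. -/
lemma IsSpectralProcess.integral_incr_mul_conj (hξ : IsSpectralProcess P ξ g) {a b a' b' : ℝ}
    (ha : -π ≤ a) (hab : a ≤ b) (hb : b ≤ π) (ha' : -π ≤ a') (hab' : a' ≤ b') (hb' : b' ≤ π) :
    ∫ x, (ξ b x - ξ a x) * (starRingEnd ℂ) (ξ b' x - ξ a' x) ∂P =
      ∫ w in Ioc (-π) π, (Ioc a b).indicator (fun _ => (1 : ℂ)) w *
        (Ioc a' b').indicator (fun _ => (1 : ℂ)) w := by
  have h1 : ∫ x, (ξ b x - ξ a x) * (starRingEnd ℂ) (ξ b' x - ξ a' x) ∂P =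
      ∫ x, (ξ b x - ξ a x) * (ξ (-a') x - ξ (-b') x) ∂P := by
    refine integral_congr_ae ?_
    filter_upwards [hξ.conj_eq a' b' ha' hab' hb'] with x hx
    rw [hx]
  rw [h1, hξ.integral_incr_mul ha hab hb (by linarith) (by linarith) (by linarith),
    ← integral_indicator measurableSet_Ioc, ← integral_indicator measurableSet_Ioc]
  refine integral_congr_ae ?_
  -- The reflected half-open interval is closed at the other end, and `-π` wraps to `π`. The two
  -- integrands may differ only at these three points.
  have hne : ∀ c : ℝ, ∀ᵐ w : ℝ, w ≠ c := fun c => by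
    simp [ae_iff, measure_singleton]
  filter_upwards [hne π, hne a', hne b'] with w h1 h2 h3
  by_cases hw : w ∈ Ioc a b
  · have hw' : w ∈ Ioc (-π) π := ⟨ha.trans_lt hw.1, hw.2.trans hb⟩
    rw [indicator_of_mem hw, indicator_of_mem hw', indicator_of_mem hw, one_mul,
      wrap_eq_self ⟨by linarith [lt_of_le_of_ne hw'.2 h1], by linarith [hw'.1]⟩]
    by_cases h : w ∈ Ioc a' b'
    · rw [indicator_of_mem h, indicator_of_mem]
      exact ⟨by linarith [lt_of_le_of_ne h.2 h3], by linarith [h.1]⟩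
    · rw [indicator_of_notMem h, indicator_of_notMem]
      rintro ⟨h4, h5⟩
      exact h ⟨lt_of_le_of_ne (by linarith) h2.symm, by linarith⟩
  · rw [indicator_of_notMem hw]
    by_cases hw' : w ∈ Ioc (-π) π
    · rw [indicator_of_mem hw', indicator_of_notMem hw, zero_mul]
    · rw [indicator_of_notMem hw']

/-- Endpoints of intervals in `[-π, π]`. -/
def Admissible {N : ℕ} (a b : Fin N → ℝ) : Prop := ∀ i, -π ≤ a i ∧ a i ≤ b i ∧ b i ≤ π

variable {N : ℕ} {a b : Fin N → ℝ} {c : Fin N → ℂ}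

lemma IsSpectralProcess.stepSum_mem (hξ : IsSpectralProcess P ξ g) (h : Admissible a b) :
    stepSum ξ a b c ∈ allMoments P := by
  have : stepSum ξ a b c = ∑ i, c i • (fun x => ξ (b i) x - ξ (a i) x) := by
    ext x
    simp [stepSum]
  rw [this]
  exact Submodule.sum_mem _ fun i _ => Submodule.smul_mem _ _
    (hξ.incr_mem (h i).1 (h i).2.1 (h i).2.2)

lemma IsSpectralProcess.integral_stepSum (hξ : IsSpectralProcess P ξ g)
    (h : Admissible a b) : ∫ x, stepSum ξ a b c x ∂P = 0 := by
  simp only [stepSum]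
  rw [integral_finsetSum]
  · refine Finset.sum_eq_zero fun i _ => ?_
    rw [integral_const_mul, hξ.integral_incr (h i).1 (h i).2.1 (h i).2.2, mul_zero]
  · intro i _
    exact (allMoments_integrable (hξ.incr_mem (h i).1 (h i).2.1 (h i).2.2)).const_mul _

lemma allMoments_conj {X : Ω → ℂ} (hX : X ∈ allMoments P) :
    (fun x => (starRingEnd ℂ) (X x)) ∈ allMoments P := fun p => (hX p).star

/-- The isometry property for step functions. -/
lemma IsSpectralProcess.integral_norm_sq_stepSum [IsProbabilityMeasure P]
    (hξ : IsSpectralProcess P ξ g) (h : Admissible a b) :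
    ∫ x, ‖stepSum ξ a b c x‖ ^ 2 ∂P = ∫ w in Ioc (-π) π, ‖stepFun a b c w‖ ^ 2 := by
  have e1 : ∀ x, (‖stepSum ξ a b c x‖ ^ 2 : ℂ) = ∑ i, ∑ j, (c i * (starRingEnd ℂ) (c j)) *
      ((ξ (b i) x - ξ (a i) x) * (starRingEnd ℂ) (ξ (b j) x - ξ (a j) x)) := by
    intro x
    rw [← Complex.mul_conj', stepSum, map_sum, Finset.sum_mul_sum]
    refine Finset.sum_congr rfl fun i _ => Finset.sum_congr rfl fun j _ => ?_
    rw [map_mul]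
    ring
  have e2 : ∀ w, (‖stepFun a b c w‖ ^ 2 : ℂ) = ∑ i, ∑ j, (c i * (starRingEnd ℂ) (c j)) *
      ((Ioc (a i) (b i)).indicator (fun _ => (1 : ℂ)) w *
        (Ioc (a j) (b j)).indicator (fun _ => (1 : ℂ)) w) := by
    intro w
    rw [← Complex.mul_conj', stepFun, map_sum, Finset.sum_mul_sum]
    refine Finset.sum_congr rfl fun i _ => Finset.sum_congr rfl fun j _ => ?_
    by_cases hi : w ∈ Ioc (a i) (b i) <;> by_cases hj : w ∈ Ioc (a j) (b j) <;>
      simp [hi, hj]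
  have i1 : ∀ i j, Integrable (fun x => (c i * (starRingEnd ℂ) (c j)) *
      ((ξ (b i) x - ξ (a i) x) * (starRingEnd ℂ) (ξ (b j) x - ξ (a j) x))) P := fun i j =>
    (allMoments_integrable (allMoments_mul (hξ.incr_mem (h i).1 (h i).2.1 (h i).2.2)
      (allMoments_conj (hξ.incr_mem (h j).1 (h j).2.1 (h j).2.2)))).const_mul _
  have i2 : ∀ i j, Integrable (fun w => (c i * (starRingEnd ℂ) (c j)) *
      ((Ioc (a i) (b i)).indicator (fun _ => (1 : ℂ)) w *
        (Ioc (a j) (b j)).indicator (fun _ => (1 : ℂ)) w)) (volume.restrict (Ioc (-π) π)) := by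
    intro i j
    refine Integrable.const_mul ?_ _
    refine Integrable.of_bound (C := 1) ?_ ?_
    · exact ((measurable_const.indicator measurableSet_Ioc).mul
        (measurable_const.indicator measurableSet_Ioc)).aestronglyMeasurable
    · refine ae_of_all _ fun w => ?_
      by_cases hi : w ∈ Ioc (a i) (b i) <;> by_cases hj : w ∈ Ioc (a j) (b j) <;>
        simp [hi, hj]
  apply Complex.ofReal_injective
  rw [← integral_complex_ofReal, ← integral_complex_ofReal]
  push_cast
  simp_rw [e1, e2]
  rw [integral_finsetSum _ fun i _ => integrable_finsetSum _ fun j _ => i1 i j,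
    integral_finsetSum _ fun i _ => integrable_finsetSum _ fun j _ => i2 i j]
  refine Finset.sum_congr rfl fun i _ => ?_
  rw [integral_finsetSum _ fun j _ => i1 i j, integral_finsetSum _ fun j _ => i2 i j]
  refine Finset.sum_congr rfl fun j _ => ?_
  rw [integral_const_mul, integral_const_mul, hξ.integral_incr_mul_conj (h i).1 (h i).2.1
    (h i).2.2 (h j).1 (h j).2.1 (h j).2.2]

/-- Keeps conjugates within the class of step integrals, so that absolute moments become moments of
products and the cumulant formula applies. -/
lemma IsSpectralProcess.conj_stepSum (hξ : IsSpectralProcess P ξ g) (h : Admissible a b) :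
    (fun x => (starRingEnd ℂ) (stepSum ξ a b c x)) =ᵐ[P]
      stepSum ξ (fun i => -b i) (fun i => -a i) (fun i => (starRingEnd ℂ) (c i)) := by
  have : ∀ᵐ x ∂P, ∀ i, (starRingEnd ℂ) (ξ (b i) x - ξ (a i) x) = ξ (-a i) x - ξ (-b i) x :=
    ae_all_iff.2 fun i => hξ.conj_eq _ _ (h i).1 (h i).2.1 (h i).2.2
  filter_upwards [this] with x hx
  simp only [stepSum, map_sum, map_mul, hx]

lemma Admissible.neg (h : Admissible a b) : Admissible (fun i => -b i) (fun i => -a i) :=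
  fun i => ⟨by linarith [(h i).2.2], by linarith [(h i).2.1], by linarith [(h i).1]⟩

/-- The cumulants of integrals of step functions. -/
lemma IsSpectralProcess.jointCumulant_stepSum [IsProbabilityMeasure P]
    (hξ : IsSpectralProcess P ξ g) {r : ℕ} {a b : Fin (r + 1) → Fin N → ℝ}
    (c : Fin (r + 1) → Fin N → ℂ) (h : ∀ j, Admissible (a j) (b j)) :
    jointCumulant P (fun j => stepSum ξ (a j) (b j) (c j)) =
      ∫ w in Set.pi univ (fun _ : Fin r => Ioc (-π) π),
        (∏ j : Fin r, stepFun (a j.castSucc) (b j.castSucc) (c j.castSucc) (w j)) *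
          stepFun (a (Fin.last r)) (b (Fin.last r)) (c (Fin.last r)) (wrap (-∑ j, w j)) *
          g r w := by
  -- Both sides are expanded over the choices `f` of one interval per argument: the left by
  -- multilinearity of the cumulant, the right by distributing the product of sums. The terms then
  -- agree by the box formula for increments.
  let Δ : Fin (r + 1) → Fin N → allMoments P := fun j i =>
    ⟨fun x => ξ (b j i) x - ξ (a j i) x, hξ.incr_mem (h j i).1 (h j i).2.1 (h j i).2.2⟩
  have e1 : (fun j => stepSum ξ (a j) (b j) (c j)) =
      fun j => ((∑ i, c j i • Δ j i : allMoments P) : Ω → ℂ) := by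
    ext j x
    simp [stepSum, Δ]
  rw [e1, ← cumulantForm_apply, MultilinearMap.map_sum]
  simp_rw [MultilinearMap.map_smul_univ, cumulantForm_apply]
  obtain ⟨M, hM⟩ := hξ.g_bounded r
  have hM0 : 0 ≤ M := (norm_nonneg _).trans (hM 0)
  have hfin : volume (Set.pi univ (fun _ : Fin r => Ioc (-π) π)) ≠ ∞ := by
    rw [volume_pi_pi]
    simp
  have : IsFiniteMeasure (volume.restrict (Set.pi univ (fun _ : Fin r => Ioc (-π) π))) :=
    ⟨by simpa using hfin.lt_top⟩
  have key : ∀ w : Fin r → ℝ,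
      (∏ j : Fin r, stepFun (a j.castSucc) (b j.castSucc) (c j.castSucc) (w j)) *
          stepFun (a (Fin.last r)) (b (Fin.last r)) (c (Fin.last r)) (wrap (-∑ j, w j)) *
          g r w =
      ∑ f : Fin (r + 1) → Fin N, (∏ j, c j (f j)) *
        (Set.pi univ (fun i : Fin r => Ioc (a i.castSucc (f i.castSucc))
            (b i.castSucc (f i.castSucc)))).indicator
          (fun w => (Ioc (a (Fin.last r) (f (Fin.last r)))
            (b (Fin.last r) (f (Fin.last r)))).indicator (fun _ => (1 : ℂ))
              (wrap (-∑ i, w i)) * g r w) w := by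
    intro w
    -- Appending the frequency determined by the others lets the last factor be treated like the
    -- rest.
    let v : Fin (r + 1) → ℝ := Fin.snoc w (wrap (-∑ j, w j))
    have h1 : (∏ j : Fin r, stepFun (a j.castSucc) (b j.castSucc) (c j.castSucc) (w j)) *
          stepFun (a (Fin.last r)) (b (Fin.last r)) (c (Fin.last r)) (wrap (-∑ j, w j)) =
        ∏ j, ∑ i, c j i * (Ioc (a j i) (b j i)).indicator (fun _ => (1 : ℂ)) (v j) := by
      rw [Fin.prod_univ_castSucc]
      simp only [v, Fin.snoc_castSucc, Fin.snoc_last, stepFun, indicator_apply, mul_ite, mul_one,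
        mul_zero]
    rw [h1, Finset.prod_univ_sum, Fintype.piFinset_univ, Finset.sum_mul]
    refine Finset.sum_congr rfl fun f _ => ?_
    rw [Finset.prod_mul_distrib, mul_assoc, Fin.prod_univ_castSucc (fun j =>
      (Ioc (a j (f j)) (b j (f j))).indicator (fun _ => (1 : ℂ)) (v j))]
    congr 1
    simp only [v, Fin.snoc_castSucc, Fin.snoc_last]
    by_cases hw : w ∈ Set.pi univ (fun i : Fin r => Ioc (a i.castSucc (f i.castSucc))
            (b i.castSucc (f i.castSucc)))
    · rw [indicator_of_mem hw, Finset.prod_eq_one, one_mul]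
      intro i _
      rw [indicator_of_mem (hw i (mem_univ i))]
    · rw [indicator_of_notMem hw]
      simp only [mem_univ_pi, not_forall] at hw
      obtain ⟨i, hi⟩ := hw
      rw [Finset.prod_eq_zero (Finset.mem_univ i) (indicator_of_notMem hi _), zero_mul, zero_mul]
  simp_rw [key]
  have hsub : ∀ f : Fin (r + 1) → Fin N, Set.pi univ (fun i : Fin r =>
      Ioc (a i.castSucc (f i.castSucc)) (b i.castSucc (f i.castSucc))) ⊆
      Set.pi univ (fun _ : Fin r => Ioc (-π) π) := fun f =>
    Set.pi_mono fun i _ => Ioc_subset_Ioc (h _ _).1 (h _ _).2.2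
  have hms : ∀ f : Fin (r + 1) → Fin N, MeasurableSet (Set.pi univ (fun i : Fin r =>
      Ioc (a i.castSucc (f i.castSucc)) (b i.castSucc (f i.castSucc)))) := fun f =>
    MeasurableSet.univ_pi fun i => measurableSet_Ioc
  rw [integral_finsetSum]
  · refine Finset.sum_congr rfl fun f _ => ?_
    rw [integral_const_mul, smul_eq_mul]
    congr 1
    rw [integral_indicator (hms f), Measure.restrict_restrict (hms f),
      inter_eq_left.2 (hsub f)]
    exact hξ.cumulant_eq r (fun j => a j (f j)) (fun j => b j (f j)) fun j => h j (f j)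
  · intro f _
    refine Integrable.const_mul ?_ _
    refine Integrable.of_bound (C := M) ?_ (ae_of_all _ fun w => ?_)
    · refine Measurable.aestronglyMeasurable ?_
      refine Measurable.indicator ?_ (hms f)
      refine Measurable.mul ?_ (hξ.g_measurable r)
      refine (measurable_const.indicator measurableSet_Ioc).comp (measurable_wrap.comp ?_)
      fun_prop
    · refine (norm_indicator_le_norm_self _ _).trans ?_
      rw [norm_mul]
      calc _ ≤ 1 * M := by
            refine mul_le_mul ?_ (hM w) (norm_nonneg _) zero_le_one
            exact (norm_indicator_le_norm_self _ _).trans (by simp)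
        _ = M := one_mul M

end StepFunctions

/-! ### Fourth moments of step integrals -/

section FourthMoments

/-- Lebesgue measure on the frequencies `(-π, π]`. -/
abbrev freq : Measure ℝ := volume.restrict (Ioc (-π) π)

/-- Translation and reflection preserve Lebesgue measure on the circle. -/
lemma integral_wrap_neg_add (f : ℝ → ℝ) (c : ℝ) :
    ∫ w, f (wrap (-(w + c))) ∂freq = ∫ w, f w ∂freq := by
  have hle : -π ≤ π := by linarith [Real.pi_pos]
  have hper : Function.Periodic (fun w => f (wrap w)) (2 * π) := fun w => by
    have := toIocMod_periodic Real.two_pi_pos (-π) w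
    simp only [wrap, this]
  rw [← intervalIntegral.integral_of_le hle, ← intervalIntegral.integral_of_le hle]
  have h1 : ∫ w in (-π)..π, f (wrap (-(w + c))) = ∫ w in (-π - c)..(-π - c + 2 * π), f (wrap w) := by
    rw [intervalIntegral.integral_comp_add_right (fun w => f (wrap (-w))),
      intervalIntegral.integral_comp_neg (fun w => f (wrap w))]
    congr 1 <;> ring
  rw [h1, hper.intervalIntegral_add_eq _ (-π)]
  rw [show -π + 2 * π = π by ring, intervalIntegral.integral_of_le hle,
    intervalIntegral.integral_of_le hle]
  exact setIntegral_congr_fun measurableSet_Ioc fun w hw => by simp only [wrap_eq_self hw]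

instance : IsFiniteMeasure freq := ⟨by simp⟩

lemma freq_univ : freq.real univ = 2 * π := by
  rw [measureReal_restrict_apply_univ, Real.volume_real_Ioc_of_le (by linarith [Real.pi_pos])]
  ring

lemma integral_pair (p q : ℝ → ℝ) :
    ∫ w : Fin 3 → ℝ, p (w 0) * q (w 1) ∂(Measure.pi fun _ => freq) =
      2 * π * ((∫ w, p w ∂freq) * ∫ w, q w ∂freq) := by
  have := integral_fintype_prod_eq_prod (𝕜 := ℝ) (fun i : Fin 3 => ![p, q, fun _ => 1] i)
    (μ := fun _ => freq)
  simp only [Fin.prod_univ_three, Matrix.cons_val_zero, Matrix.cons_val_one, Matrix.cons_val,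
    mul_one, integral_const, smul_eq_mul, freq_univ] at this
  rw [this]
  ring

/-- The coordinate `w 0` enters only through the wrapped frequency. Integrating it first turns the
factor `q` into its full integral, whatever the other coordinates are. -/
lemma integral_wrapped_pair {p q : ℝ → ℝ} (hp : Measurable p) (hq : Measurable q) {C : ℝ}
    (hpC : ∀ w, |p w| ≤ C) (hqC : ∀ w, |q w| ≤ C) :
    ∫ w : Fin 3 → ℝ, p (w 2) * q (wrap (-∑ j, w j)) ∂(Measure.pi fun _ => freq) =
      2 * π * ((∫ w, p w ∂freq) * ∫ w, q w ∂freq) := by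
  have hC : 0 ≤ C := (abs_nonneg _).trans (hpC 0)
  have hmp := measurePreserving_piFinSuccAbove (fun _ : Fin 3 => freq) 0
  have h1 : ∀ w : Fin 3 → ℝ, p (w 2) * q (wrap (-∑ j, w j)) =
      (fun z : ℝ × (Fin 2 → ℝ) => p (z.2 1) * q (wrap (-(z.1 + ∑ j, z.2 j))))
        (MeasurableEquiv.piFinSuccAbove (fun _ => ℝ) 0 w) := by
    intro w
    simp [MeasurableEquiv.piFinSuccAbove, Fin.sum_univ_three, Fin.sum_univ_two, Fin.tail,
      add_assoc]
  rw [integral_congr_ae (ae_of_all _ h1)]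
  refine (hmp.integral_comp' (g := fun z : ℝ × (Fin 2 → ℝ) =>
    p (z.2 1) * q (wrap (-(z.1 + ∑ j, z.2 j))))).trans ?_
  rw [integral_prod_symm]
  · simp only
    simp_rw [integral_const_mul, integral_wrap_neg_add q]
    rw [integral_mul_const]
    have := integral_fintype_prod_eq_prod (𝕜 := ℝ) (fun i : Fin 2 => ![fun _ => 1, p] i)
      (μ := fun _ => freq)
    simp only [Fin.prod_univ_two, Matrix.cons_val_zero, Matrix.cons_val_one,
      one_mul, integral_const, smul_eq_mul, freq_univ, mul_one] at this
    rw [this]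
    ring
  · refine Integrable.of_bound (C := C * C) (Measurable.aestronglyMeasurable ?_)
      (ae_of_all _ fun z => ?_)
    · refine (hp.comp (by fun_prop)).mul (hq.comp (measurable_wrap.comp ?_))
      fun_prop
    · rw [norm_mul]
      exact mul_le_mul (hpC _) (hqC _) (norm_nonneg _) hC

/-- The inequality `2xy ≤ x² + y²` separates the factors into two pairs. Each pair involves two
independent frequencies, so its integral factorises into squared `L²` norms and no `L⁴` norm of `ψ`
is needed. -/
lemma norm_integral_cumulant_four_le {ψ : Fin 4 → ℝ → ℂ} (hψ : ∀ j, Measurable (ψ j)) {C : ℝ}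
    (hC : ∀ j w, ‖ψ j w‖ ≤ C) {g : (Fin 3 → ℝ) → ℂ} {M : ℝ} (hM : ∀ w, ‖g w‖ ≤ M) {q : ℝ}
    (hq : ∀ j, ∫ w, ‖ψ j w‖ ^ 2 ∂freq = q) :
    ‖∫ w in Set.pi univ (fun _ : Fin 3 => Ioc (-π) π),
        (∏ j : Fin 3, ψ j.castSucc (w j)) * ψ (Fin.last 3) (wrap (-∑ j, w j)) * g w‖ ≤
      2 * π * M * q ^ 2 := by
  have hC0 : 0 ≤ C := (norm_nonneg _).trans (hC 0 0)
  have hM0 : 0 ≤ M := (norm_nonneg _).trans (hM 0)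
  have hbd : ∀ j w, |‖ψ j w‖ ^ 2| ≤ C ^ 2 := fun j w => by
    rw [abs_of_nonneg (by positivity)]
    exact pow_le_pow_left₀ (norm_nonneg _) (hC j w) 2
  have hms : ∀ j, Measurable fun w => ‖ψ j w‖ ^ 2 := fun j => (hψ j).norm.pow_const 2
  rw [volume_pi, Measure.restrict_pi_pi]
  have i1 : Integrable (fun w : Fin 3 → ℝ => ‖ψ 0 (w 0)‖ ^ 2 * ‖ψ 1 (w 1)‖ ^ 2)
      (Measure.pi fun _ => freq) := by
    refine Integrable.of_bound (C := C ^ 2 * C ^ 2) (Measurable.aestronglyMeasurable ?_)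
      (ae_of_all _ fun w => ?_)
    · exact ((hms 0).comp (measurable_pi_apply 0)).mul ((hms 1).comp (measurable_pi_apply 1))
    · rw [norm_mul]
      exact mul_le_mul (hbd _ _) (hbd _ _) (norm_nonneg _) (by positivity)
  have i2 : Integrable (fun w : Fin 3 → ℝ => ‖ψ 2 (w 2)‖ ^ 2 *
      ‖ψ 3 (wrap (-∑ j, w j))‖ ^ 2) (Measure.pi fun _ => freq) := by
    refine Integrable.of_bound (C := C ^ 2 * C ^ 2) (Measurable.aestronglyMeasurable ?_)
      (ae_of_all _ fun w => ?_)
    · refine ((hms 2).comp (measurable_pi_apply 2)).mul ((hms 3).comp (measurable_wrap.comp ?_))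
      fun_prop
    · rw [norm_mul]
      exact mul_le_mul (hbd _ _) (hbd _ _) (norm_nonneg _) (by positivity)
  refine (norm_integral_le_of_norm_le (((i1.add i2).const_mul (M / 2)))
    (ae_of_all _ fun w => ?_)).trans ?_
  · rw [Fin.prod_univ_three, norm_mul, norm_mul, norm_mul, norm_mul]
    change ‖ψ 0 (w 0)‖ * ‖ψ 1 (w 1)‖ * ‖ψ 2 (w 2)‖ * ‖ψ 3 (wrap (-∑ j, w j))‖ * ‖g w‖ ≤
      M / 2 * (‖ψ 0 (w 0)‖ ^ 2 * ‖ψ 1 (w 1)‖ ^ 2 + ‖ψ 2 (w 2)‖ ^ 2 *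
        ‖ψ 3 (wrap (-∑ j, w j))‖ ^ 2)
    have h1 : ‖ψ 0 (w 0)‖ * ‖ψ 1 (w 1)‖ * ‖ψ 2 (w 2)‖ * ‖ψ 3 (wrap (-∑ j, w j))‖ * ‖g w‖ ≤
        ‖ψ 0 (w 0)‖ * ‖ψ 1 (w 1)‖ * ‖ψ 2 (w 2)‖ * ‖ψ 3 (wrap (-∑ j, w j))‖ * M :=
      mul_le_mul_of_nonneg_left (hM w) (by positivity)
    have h2 := mul_nonneg hM0 (sq_nonneg (‖ψ 0 (w 0)‖ * ‖ψ 1 (w 1)‖ -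
      ‖ψ 2 (w 2)‖ * ‖ψ 3 (wrap (-∑ j, w j))‖))
    nlinarith [h1, h2]
  · simp only [Pi.add_apply]
    rw [integral_const_mul, integral_add i1 i2,
      integral_pair (fun w => ‖ψ 0 w‖ ^ 2) (fun w => ‖ψ 1 w‖ ^ 2),
      integral_wrapped_pair (p := fun w => ‖ψ 2 w‖ ^ 2) (q := fun w => ‖ψ 3 w‖ ^ 2)
        (hms 2) (hms 3) (hbd 2) (hbd 3), hq, hq, hq, hq]
    apply le_of_eq
    ring

variable {Ω : Type*} [MeasurableSpace Ω] {P : Measure Ω}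
  {ξ : ℝ → Ω → ℂ} {g : (r : ℕ) → (Fin r → ℝ) → ℂ}

lemma norm_integral_mul_le_of_sq {X Y : Ω → ℂ} (hX : X ∈ allMoments P) (hY : Y ∈ allMoments P)
    {q : ℝ} (hXq : ∫ x, ‖X x‖ ^ 2 ∂P = q) (hYq : ∫ x, ‖Y x‖ ^ 2 ∂P = q) :
    ‖∫ x, X x * Y x ∂P‖ ≤ q := by
  have iX : Integrable (fun x => ‖X x‖ ^ 2) P := by
    simpa using (hX 2).integrable_norm_pow (p := 2) (by norm_num)
  have iY : Integrable (fun x => ‖Y x‖ ^ 2) P := by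
    simpa using (hY 2).integrable_norm_pow (p := 2) (by norm_num)
  refine (norm_integral_le_of_norm_le ((iX.add iY).const_mul (1 / 2))
    (ae_of_all _ fun x => ?_)).trans ?_
  · rw [norm_mul, Pi.add_apply]
    nlinarith [sq_nonneg (‖X x‖ - ‖Y x‖)]
  · simp only [Pi.add_apply]
    rw [integral_const_mul, integral_add iX iY, hXq, hYq]
    linarith

/-- The existential hides the sum over partitions, and the index type `Fin (3 + 1)` matches the
shape `Fin (r + 1)` of the cumulant formula. -/
lemma exists_norm_moment_four_le (P : Measure Ω) :
    ∃ K : ℝ, 0 ≤ K ∧ ∀ X : Fin (3 + 1) → Ω → ℂ, (∀ i, ∫ x, X i x ∂P = 0) → ∀ D : ℝ,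
      (∀ i j, i ≠ j → ‖∫ x, X i x * X j x ∂P‖ ≤ D) →
      ‖∫ x, ∏ i, X i x ∂P‖ ≤ ‖jointCumulant P X‖ + K * D ^ 2 :=
  ⟨pairingConstant (3 + 1), pairingConstant_nonneg _, fun _ hX _ h2 =>
    norm_moment_four_le rfl hX h2⟩

/-- Writing `|X|⁴ = X X X̄ X̄` gives a fourth moment of step integrals. Its cumulant is controlled
by the bounded spectrum `g 3` and its pairings by the isometry. The constant does not depend on the
step function, so the bound survives `L²` limits. -/
lemma IsSpectralProcess.integral_norm_four_stepSum [IsProbabilityMeasure P]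
    (hξ : IsSpectralProcess P ξ g) :
    ∃ C : ℝ, 0 ≤ C ∧ ∀ {N : ℕ} (a b : Fin N → ℝ) (c : Fin N → ℂ), Admissible a b →
      ∫ x, ‖stepSum ξ a b c x‖ ^ 4 ∂P ≤ C * (∫ w, ‖stepFun a b c w‖ ^ 2 ∂freq) ^ 2 := by
  obtain ⟨M, hM⟩ := hξ.g_bounded 3
  have hM0 : 0 ≤ M := (norm_nonneg _).trans (hM 0)
  obtain ⟨K, hK0, hK⟩ := exists_norm_moment_four_le P
  refine ⟨2 * π * M + K, by have := Real.pi_pos; positivity, ?_⟩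
  intro N a b c h
  set q := ∫ w, ‖stepFun a b c w‖ ^ 2 ∂freq with hq
  -- Two copies of the step function followed by two copies of its reflected conjugate.
  let a4 : Fin (3 + 1) → Fin N → ℝ := ![a, a, fun i => -b i, fun i => -b i]
  let b4 : Fin (3 + 1) → Fin N → ℝ := ![b, b, fun i => -a i, fun i => -a i]
  let c4 : Fin (3 + 1) → Fin N → ℂ :=
    ![c, c, fun i => (starRingEnd ℂ) (c i), fun i => (starRingEnd ℂ) (c i)]
  have hadm : ∀ j, Admissible (a4 j) (b4 j) := by
    intro j
    fin_cases j
    · exact h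
    · exact h
    · exact h.neg
    · exact h.neg
  have hnorm : ∫ x, ‖stepSum ξ a b c x‖ ^ 2 ∂P = q := hξ.integral_norm_sq_stepSum h
  have hnorm' : ∫ x, ‖stepSum ξ (fun i => -b i) (fun i => -a i)
      (fun i => (starRingEnd ℂ) (c i)) x‖ ^ 2 ∂P = q := by
    rw [← hnorm]
    refine integral_congr_ae ?_
    filter_upwards [hξ.conj_stepSum (c := c) h] with x hx
    rw [← hx, RCLike.norm_conj]
  have hq2 : ∀ j, ∫ x, ‖stepSum ξ (a4 j) (b4 j) (c4 j) x‖ ^ 2 ∂P = q := by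
    intro j
    fin_cases j
    · exact hnorm
    · exact hnorm
    · exact hnorm'
    · exact hnorm'
  have hmain := hK (fun j => stepSum ξ (a4 j) (b4 j) (c4 j)) (fun j => hξ.integral_stepSum (hadm j))
    q
    (fun i j _ => norm_integral_mul_le_of_sq (hξ.stepSum_mem (hadm i)) (hξ.stepSum_mem (hadm j))
      (hq2 i) (hq2 j))
  rw [hξ.jointCumulant_stepSum c4 hadm] at hmain
  have hcum := norm_integral_cumulant_four_le (ψ := fun j => stepFun (a4 j) (b4 j) (c4 j))
    (fun j => measurable_stepFun _ _ _) (C := ∑ j, ∑ i, ‖c4 j i‖)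
    (fun j w => (norm_stepFun_le _ _ _ _).trans
      (Finset.single_le_sum (f := fun j => ∑ i, ‖c4 j i‖) (fun _ _ => by positivity)
        (Finset.mem_univ j))) hM
    (fun j => (hξ.integral_norm_sq_stepSum (hadm j)).symm.trans (hq2 j))
  have hlhs : ∫ x, ∏ j, stepSum ξ (a4 j) (b4 j) (c4 j) x ∂P =
      ((∫ x, ‖stepSum ξ a b c x‖ ^ 4 ∂P : ℝ) : ℂ) := by
    rw [← integral_complex_ofReal]
    refine integral_congr_ae ?_
    filter_upwards [hξ.conj_stepSum (c := c) h] with x hx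
    rw [Fin.prod_univ_four]
    change stepSum ξ a b c x * stepSum ξ a b c x * stepSum ξ (fun i => -b i) (fun i => -a i)
      (fun i => (starRingEnd ℂ) (c i)) x * stepSum ξ (fun i => -b i) (fun i => -a i)
      (fun i => (starRingEnd ℂ) (c i)) x = _
    rw [← hx]
    have := Complex.mul_conj' (stepSum ξ a b c x)
    push_cast
    linear_combination (stepSum ξ a b c x * (starRingEnd ℂ) (stepSum ξ a b c x) +
      (‖stepSum ξ a b c x‖ : ℂ) ^ 2) * this
  rw [hlhs, Complex.norm_real, Real.norm_of_nonneg (by positivity)] at hmain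
  linarith

end FourthMoments

/-! ### General stochastic integrals as limits of step integrals -/

section SpectralIntegrals

lemma tendsto_eLpNorm_of_sub {α E : Type*} [MeasurableSpace α] [NormedAddCommGroup E]
    {ν : Measure α} {p : ℝ≥0∞} (hp : 1 ≤ p) {f : α → E} {F : ℕ → α → E} (hf : MemLp f p ν)
    (hF : ∀ m, AEStronglyMeasurable (F m) ν)
    (h : Tendsto (fun m => eLpNorm (f - F m) p ν) atTop (𝓝 0)) :
    Tendsto (fun m => eLpNorm (F m) p ν) atTop (𝓝 (eLpNorm f p ν)) := by
  have h1 : Tendsto (fun m => eLpNorm f p ν - eLpNorm (f - F m) p ν) atTop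
      (𝓝 (eLpNorm f p ν - 0)) :=
    ENNReal.Tendsto.sub tendsto_const_nhds h (Or.inl hf.2.ne)
  have h2 : Tendsto (fun m => eLpNorm f p ν + eLpNorm (f - F m) p ν) atTop
      (𝓝 (eLpNorm f p ν + 0)) := tendsto_const_nhds.add h
  rw [tsub_zero] at h1
  rw [add_zero] at h2
  refine tendsto_of_tendsto_of_tendsto_of_le_of_le h1 h2 (fun m => ?_) (fun m => ?_)
  · simp only
    rw [tsub_le_iff_right]
    calc eLpNorm f p ν = eLpNorm (F m + (f - F m)) p ν := by rw [add_sub_cancel]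
      _ ≤ _ := eLpNorm_add_le (hF m) (hf.1.sub (hF m)) hp
  · calc eLpNorm (F m) p ν = eLpNorm (f - (f - F m)) p ν := by rw [sub_sub_cancel]
      _ ≤ _ := eLpNorm_sub_le hf.1 (hf.1.sub (hF m)) hp

lemma integral_norm_pow_eq {α E : Type*} [MeasurableSpace α] [NormedAddCommGroup E]
    {ν : Measure α} {p : ℕ} (hp : p ≠ 0) {f : α → E} (hf : MemLp f p ν) :
    ∫ x, ‖f x‖ ^ p ∂ν = (eLpNorm f p ν).toReal ^ p := by
  rw [hf.eLpNorm_eq_integral_rpow_norm (by exact_mod_cast hp) (by simp),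
    ENNReal.toReal_ofReal (by positivity), ENNReal.toReal_natCast]
  simp_rw [Real.rpow_natCast]
  rw [Real.rpow_inv_natCast_pow (by positivity) hp]

variable {Ω : Type*} [MeasurableSpace Ω] {P : Measure Ω}
  {ξ : ℝ → Ω → ℂ} {g : (r : ℕ) → (Fin r → ℝ) → ℂ} {φ φ' : ℝ → ℂ} {X X' : Ω → ℂ}

lemma IsSpectralIntegral.const_smul (h : IsSpectralIntegral P ξ φ X) (z : ℂ) :
    IsSpectralIntegral P ξ (z • φ) (z • X) := by
  obtain ⟨hφ, hX, N, a, b, c, hadm, h1, h2⟩ := h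
  refine ⟨hφ.const_smul z, hX.const_smul z, N, a, b, fun m i => z * c m i, hadm, ?_, ?_⟩
  · have : ∀ m, (fun w => (z • φ) w - ∑ i, (Ioc (a m i) (b m i)).indicator
        (fun _ => z * c m i) w) = z • (fun w => φ w - ∑ i, (Ioc (a m i) (b m i)).indicator
        (fun _ => c m i) w) := by
      intro m
      ext w
      simp only [Pi.smul_apply, smul_eq_mul, mul_sub, Finset.mul_sum, indicator_apply, mul_ite,
        mul_zero]
    simp_rw [this, eLpNorm_const_smul]
    have h3 := ENNReal.Tendsto.const_mul (a := ‖z‖ₑ) h1 (Or.inr enorm_ne_top)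
    rwa [mul_zero] at h3
  · have : ∀ m, (fun x => (z • X) x - ∑ i, z * c m i * (ξ (b m i) x - ξ (a m i) x)) =
        z • (fun x => X x - ∑ i, c m i * (ξ (b m i) x - ξ (a m i) x)) := by
      intro m
      ext w
      simp only [Pi.smul_apply, smul_eq_mul, mul_sub, Finset.mul_sum, mul_assoc]
    simp_rw [this, eLpNorm_const_smul]
    have h3 := ENNReal.Tendsto.const_mul (a := ‖z‖ₑ) h2 (Or.inr enorm_ne_top)
    rwa [mul_zero] at h3

lemma IsSpectralProcess.aestronglyMeasurable_stepSum (hξ : IsSpectralProcess P ξ g) {N : ℕ}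
    {a b : Fin N → ℝ} {c : Fin N → ℂ} (h : Admissible a b) :
    AEStronglyMeasurable (stepSum ξ a b c) P :=
  (hξ.stepSum_mem h 1).1

/-- Intervals may overlap in the approximating step functions, so concatenating two lists of
intervals approximates the sum. -/
lemma IsSpectralIntegral.add (hξ : IsSpectralProcess P ξ g) (h : IsSpectralIntegral P ξ φ X)
    (h' : IsSpectralIntegral P ξ φ' X') : IsSpectralIntegral P ξ (φ + φ') (X + X') := by
  obtain ⟨hφ, hX, N, a, b, c, hadm, h1, h2⟩ := h
  obtain ⟨hφ', hX', N', a', b', c', hadm', h1', h2'⟩ := h'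
  refine ⟨hφ.add hφ', hX.add hX', fun m => N m + N' m, fun m => Fin.append (a m) (a' m),
    fun m => Fin.append (b m) (b' m), fun m => Fin.append (c m) (c' m), fun m => ?_, ?_, ?_⟩
  · intro i
    refine Fin.addCases (fun i => ?_) (fun i => ?_) i
    · simpa using hadm m i
    · simpa using hadm' m i
  · have h3 := h1.add h1'
    rw [add_zero] at h3
    refine tendsto_of_tendsto_of_tendsto_of_le_of_le tendsto_const_nhds h3
      (fun _ => zero_le) (fun m => ?_)
    refine le_trans (le_of_eq ?_) (eLpNorm_add_le
      (hφ.1.sub (measurable_stepFun (a m) (b m) (c m)).aestronglyMeasurable)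
      (hφ'.1.sub (measurable_stepFun (a' m) (b' m) (c' m)).aestronglyMeasurable) one_le_two)
    congr 1
    ext w
    simp only [Fin.sum_univ_add, Fin.append_left, Fin.append_right, Pi.add_apply]
    ring
  · have h3 := h2.add h2'
    rw [add_zero] at h3
    refine tendsto_of_tendsto_of_tendsto_of_le_of_le tendsto_const_nhds h3
      (fun _ => zero_le) (fun m => ?_)
    refine le_trans (le_of_eq ?_) (eLpNorm_add_le
      (hX.1.sub (hξ.aestronglyMeasurable_stepSum (c := c m) (hadm m)))
      (hX'.1.sub (hξ.aestronglyMeasurable_stepSum (c := c' m) (hadm' m))) one_le_two)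
    congr 1
    ext w
    simp only [Fin.sum_univ_add, Fin.append_left, Fin.append_right, Pi.add_apply]
    ring

lemma IsSpectralIntegral.sub (hξ : IsSpectralProcess P ξ g) (h : IsSpectralIntegral P ξ φ X)
    (h' : IsSpectralIntegral P ξ φ' X') : IsSpectralIntegral P ξ (φ - φ') (X - X') := by
  have := h.add hξ (h'.const_smul (-1))
  rwa [neg_one_smul, neg_one_smul, ← sub_eq_add_neg, ← sub_eq_add_neg] at this

lemma IsSpectralIntegral.exists_step (h : IsSpectralIntegral P ξ φ X) :
    ∃ (N : ℕ → ℕ) (a b : (m : ℕ) → Fin (N m) → ℝ) (c : (m : ℕ) → Fin (N m) → ℂ),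
      (∀ m, Admissible (a m) (b m)) ∧
      Tendsto (fun m => eLpNorm (stepFun (a m) (b m) (c m)) 2 freq) atTop
        (𝓝 (eLpNorm φ 2 freq)) ∧
      Tendsto (fun m => eLpNorm (X - stepSum ξ (a m) (b m) (c m)) 2 P) atTop (𝓝 0) := by
  obtain ⟨hφ, hX, N, a, b, c, hadm, h1, h2⟩ := h
  exact ⟨N, a, b, c, hadm, tendsto_eLpNorm_of_sub one_le_two hφ
    (fun m => (measurable_stepFun _ _ _).aestronglyMeasurable) h1, h2⟩

lemma memLp_stepFun {N : ℕ} (a b : Fin N → ℝ) (c : Fin N → ℂ) (p : ℝ≥0∞) :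
    MemLp (stepFun a b c) p freq :=
  MemLp.of_bound (measurable_stepFun _ _ _).aestronglyMeasurable _
    (ae_of_all _ (norm_stepFun_le a b c))

lemma IsSpectralProcess.eLpNorm_stepSum [IsProbabilityMeasure P] (hξ : IsSpectralProcess P ξ g)
    {N : ℕ} {a b : Fin N → ℝ} {c : Fin N → ℂ} (h : Admissible a b) :
    eLpNorm (stepSum ξ a b c) 2 P = eLpNorm (stepFun a b c) 2 freq := by
  have h1 := integral_norm_pow_eq (p := 2) two_ne_zero (hξ.stepSum_mem (c := c) h 2)
  have h2 := integral_norm_pow_eq (p := 2) two_ne_zero (memLp_stepFun a b c (2 : ℕ))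
  rw [hξ.integral_norm_sq_stepSum h, h2] at h1
  rw [pow_left_inj₀ ENNReal.toReal_nonneg ENNReal.toReal_nonneg two_ne_zero] at h1
  exact ((ENNReal.toReal_eq_toReal_iff' (hξ.stepSum_mem (c := c) h 2).2.ne
    (memLp_stepFun a b c (2 : ℕ)).2.ne).1 h1.symm)

lemma IsSpectralIntegral.integral_eq_zero [IsProbabilityMeasure P]
    (hξ : IsSpectralProcess P ξ g) (h : IsSpectralIntegral P ξ φ X) : ∫ x, X x ∂P = 0 := by
  obtain ⟨N, a, b, c, hadm, -, h2⟩ := h.exists_step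
  have hX := h.2.1
  have h3 : Tendsto (fun m => ∫ x, stepSum ξ (a m) (b m) (c m) x ∂P) atTop
      (𝓝 (∫ x, X x ∂P)) := by
    refine tendsto_integral_of_L1' _ hX.1
      (Eventually.of_forall fun m => allMoments_integrable (hξ.stepSum_mem (hadm m))) ?_
    refine tendsto_of_tendsto_of_tendsto_of_le_of_le tendsto_const_nhds h2
      (fun _ => zero_le) (fun m => ?_)
    rw [eLpNorm_sub_comm]
    exact eLpNorm_le_eLpNorm_of_exponent_le one_le_two
      (hX.1.sub (hξ.aestronglyMeasurable_stepSum (hadm m)))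
  simp_rw [hξ.integral_stepSum (hadm _)] at h3
  exact tendsto_nhds_unique h3 tendsto_const_nhds

lemma IsSpectralIntegral.eLpNorm_eq [IsProbabilityMeasure P]
    (hξ : IsSpectralProcess P ξ g) (h : IsSpectralIntegral P ξ φ X) :
    eLpNorm X 2 P = eLpNorm φ 2 freq := by
  obtain ⟨N, a, b, c, hadm, h1, h2⟩ := h.exists_step
  have h3 := tendsto_eLpNorm_of_sub one_le_two h.2.1
    (fun m => hξ.aestronglyMeasurable_stepSum (c := c m) (hadm m)) h2
  simp_rw [hξ.eLpNorm_stepSum (hadm _)] at h3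
  exact tendsto_nhds_unique h3 h1

/-- The isometry property of the stochastic integral. -/
lemma IsSpectralIntegral.integral_norm_sq [IsProbabilityMeasure P]
    (hξ : IsSpectralProcess P ξ g) (h : IsSpectralIntegral P ξ φ X) :
    ∫ x, ‖X x‖ ^ 2 ∂P = ∫ w, ‖φ w‖ ^ 2 ∂freq := by
  have h1 := integral_norm_pow_eq (p := 2) two_ne_zero (f := X) h.2.1
  have h2 := integral_norm_pow_eq (p := 2) two_ne_zero (f := φ) h.1
  rw [h1, h2]
  congr 2
  exact h.eLpNorm_eq hξ

/-- The stochastic integral has fourth moments, bounded by the square of the second ones. -/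
lemma IsSpectralProcess.fourth_moment [IsProbabilityMeasure P] (hξ : IsSpectralProcess P ξ g) :
    ∃ C : ℝ, 0 ≤ C ∧ ∀ φ X, IsSpectralIntegral P ξ φ X → MemLp X 4 P ∧
      ∫ x, ‖X x‖ ^ 4 ∂P ≤ C * (∫ w, ‖φ w‖ ^ 2 ∂freq) ^ 2 := by
  obtain ⟨C, hC0, hC⟩ := hξ.integral_norm_four_stepSum
  refine ⟨C, hC0, fun φ X h => ?_⟩
  obtain ⟨N, a, b, c, hadm, h1, h2⟩ := h.exists_step
  have hmeas := fun m => hξ.aestronglyMeasurable_stepSum (c := c m) (hadm m)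
  -- The approximation holds in `L²` only. An almost surely convergent subsequence and Fatou's lemma
  -- transfer the uniform `L⁴` bound to the limit.
  have h3 : TendstoInMeasure P (fun m => stepSum ξ (a m) (b m) (c m)) atTop X := by
    refine tendstoInMeasure_of_tendsto_eLpNorm (p := 2) two_ne_zero hmeas h.2.1.1 ?_
    simp_rw [eLpNorm_sub_comm]
    exact h2
  obtain ⟨ns, hns, hae⟩ := h3.exists_seq_tendsto_ae
  have hfat := Lp.eLpNorm_lim_le_liminf_eLpNorm (p := 4) (fun m => hmeas (ns m)) X hae
  have hstep : ∀ m, (eLpNorm (stepSum ξ (a m) (b m) (c m)) 4 P).toReal ^ 4 ≤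
      C * ((eLpNorm (stepFun (a m) (b m) (c m)) 2 freq).toReal ^ 2) ^ 2 := by
    intro m
    have e1 := integral_norm_pow_eq (p := 4) four_ne_zero
      (hξ.stepSum_mem (c := c m) (hadm m) 4)
    have e2 := integral_norm_pow_eq (p := 2) two_ne_zero
      (memLp_stepFun (a m) (b m) (c m) (2 : ℕ))
    have e3 := hC (a m) (b m) (c m) (hadm m)
    rw [e1, e2] at e3
    exact e3
  set q := (eLpNorm φ 2 freq).toReal with hq
  -- Fatou's lemma is stated for the norm, so the fourth root of the bound is taken here and undone
  -- at the end.
  have hle : eLpNorm X 4 P ≤ ENNReal.ofReal ((C * (q ^ 2) ^ 2) ^ ((4 : ℕ) : ℝ)⁻¹) := by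
    refine hfat.trans ?_
    have hlim : Tendsto (fun m => ENNReal.ofReal ((C *
        ((eLpNorm (stepFun (a (ns m)) (b (ns m)) (c (ns m))) 2 freq).toReal ^ 2) ^ 2) ^
          ((4 : ℕ) : ℝ)⁻¹)) atTop (𝓝 (ENNReal.ofReal ((C * (q ^ 2) ^ 2) ^ ((4 : ℕ) : ℝ)⁻¹))) := by
      refine ENNReal.tendsto_ofReal (Tendsto.rpow_const ?_ (Or.inr (by positivity)))
      refine Tendsto.const_mul _ (Tendsto.pow (Tendsto.pow ?_ _) _)
      exact ((ENNReal.tendsto_toReal h.1.2.ne).comp h1).comp hns.tendsto_atTop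
    rw [← hlim.liminf_eq]
    refine liminf_le_liminf (Eventually.of_forall fun m => ?_)
    have hfin : eLpNorm (stepSum ξ (a (ns m)) (b (ns m)) (c (ns m))) 4 P ≠ ∞ :=
      (hξ.stepSum_mem (c := c (ns m)) (hadm (ns m)) 4).2.ne
    rw [← ENNReal.ofReal_toReal hfin]
    refine ENNReal.ofReal_le_ofReal ?_
    rw [← Real.pow_rpow_inv_natCast (ENNReal.toReal_nonneg
      (a := eLpNorm (stepSum ξ (a (ns m)) (b (ns m)) (c (ns m))) 4 P)) four_ne_zero]
    exact Real.rpow_le_rpow (by positivity) (hstep _) (by positivity)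
  have hmem : MemLp X 4 P := ⟨h.2.1.1, hle.trans_lt ENNReal.ofReal_lt_top⟩
  refine ⟨hmem, ?_⟩
  rw [integral_norm_pow_eq (p := 4) four_ne_zero hmem,
    integral_norm_pow_eq (p := 2) two_ne_zero (f := φ) h.1]
  have := ENNReal.toReal_mono ENNReal.ofReal_ne_top hle
  rw [ENNReal.toReal_ofReal (by positivity)] at this
  have h5 := pow_le_pow_left₀ ENNReal.toReal_nonneg this 4
  rw [Real.rpow_inv_natCast_pow (by positivity) four_ne_zero] at h5
  exact h5

end SpectralIntegrals

/-! ### Regimes, regularity of the transfer function, decay of Fourier coefficients -/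

section Transfer

variable {m : ℕ} {lam : Fin (m + 2) → ℝ} {A : ℝ → ℝ → ℂ}

lemma regime_subset (hlam : IsBreakFractions lam) (j : Fin (m + 1)) :
    regime lam j ⊆ Ioc 0 1 := by
  intro u hu
  have h0 : 0 ≤ lam j.castSucc := by
    rw [← hlam.first]
    exact hlam.strictMono.monotone (Fin.zero_le _)
  have h1 : lam j.succ ≤ 1 := by
    rw [← hlam.last]
    exact hlam.strictMono.monotone (Fin.le_last _)
  exact ⟨h0.trans_lt hu.1, hu.2.trans h1⟩

lemma lam_succ_mem_regime (hlam : IsBreakFractions lam) (j : Fin (m + 1)) :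
    lam j.succ ∈ regime lam j :=
  ⟨hlam.strictMono Fin.castSucc_lt_succ, le_rfl⟩

/-- Consecutive half-open intervals between the values of a function cover the whole range. -/
lemma exists_mem_Ioc_of_lt_of_le {α : Type*} [LinearOrder α] {m : ℕ} (f : Fin (m + 2) → α) {x : α}
    (h0 : f 0 < x) (h1 : x ≤ f (Fin.last (m + 1))) :
    ∃ j : Fin (m + 1), x ∈ Ioc (f j.castSucc) (f j.succ) := by
  by_contra! hcon
  have : ∀ i : Fin (m + 2), f i < x := by
    intro i
    induction i using Fin.induction with
    | zero => exact h0
    | succ i ih =>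
      by_contra! hx
      exact hcon i ⟨ih, hx⟩
  exact absurd h1 (not_le.2 (this _))

lemma exists_regime (hlam : IsBreakFractions lam) {u : ℝ} (hu : u ∈ Ioc (0 : ℝ) 1) :
    ∃ j, u ∈ regime lam j :=
  exists_mem_Ioc_of_lt_of_le lam (by rw [hlam.first]; exact hu.1) (by rw [hlam.last]; exact hu.2)

lemma exists_dates (hlam : IsBreakFractions lam) {T : ℕ} {t : ℤ} (h1 : 1 ≤ t) (h2 : t ≤ T) :
    ∃ j, t ∈ dates lam T j :=
  exists_mem_Ioc_of_lt_of_le (fun i => ⌊(T : ℝ) * lam i⌋) (by simp [hlam.first]; omega)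
    (by simp [hlam.last, h2])

lemma dates_subset (hlam : IsBreakFractions lam) {T : ℕ} {j : Fin (m + 1)} {t : ℤ}
    (ht : t ∈ dates lam T j) : 1 ≤ t ∧ t ≤ T := by
  have h0 : 0 ≤ lam j.castSucc := by
    rw [← hlam.first]
    exact hlam.strictMono.monotone (Fin.zero_le _)
  have h1 : lam j.succ ≤ 1 := by
    rw [← hlam.last]
    exact hlam.strictMono.monotone (Fin.le_last _)
  have h2 : 0 ≤ ⌊(T : ℝ) * lam j.castSucc⌋ := Int.floor_nonneg.2 (by positivity)
  have h3 : ⌊(T : ℝ) * lam j.succ⌋ ≤ T := by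
    have : (⌊(T : ℝ) * lam j.succ⌋ : ℝ) ≤ ((T : ℤ) : ℝ) :=
      (Int.floor_le _).trans (by push_cast; nlinarith [Nat.cast_nonneg (α := ℝ) T])
    exact_mod_cast this
  exact ⟨by have := ht.1; omega, by have := ht.2; omega⟩

lemma div_mem_regime {T : ℕ} (hT : 1 ≤ T) {j : Fin (m + 1)} {t : ℤ} (ht : t ∈ dates lam T j) :
    (t : ℝ) / T ∈ regime lam j := by
  have hT' : (0 : ℝ) < T := by exact_mod_cast hT
  constructor
  · rw [lt_div_iff₀ hT', mul_comm]
    exact Int.floor_lt.1 ht.1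
  · rw [div_le_iff₀ hT', mul_comm]
    exact Int.le_floor.1 ht.2

lemma SmoothTransfer.exists_lipschitz_time (hA : SmoothTransfer lam A) :
    ∃ L : ℝ, 0 ≤ L ∧ ∀ j, ∀ u ∈ regime lam j, ∀ v ∈ regime lam j, ∀ w,
      ‖A u w - A v w‖ ≤ L * |u - v| := by
  obtain ⟨B, hB⟩ := hA.smooth_time
  refine ⟨B, B.2, fun j u hu v hv w => ?_⟩
  have hlip := (convex_Ioc _ _).lipschitzOnWith_of_nnnorm_derivWithin_le
    ((hB w j).1.differentiableOn (by norm_num)) (C := B) (s := regime lam j)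
    (fun x hx => by exact_mod_cast ((hB w j).2.1 x hx).1)
  simpa [dist_eq_norm] using hlip.dist_le_mul u hu v hv

lemma SmoothTransfer.exists_lipschitz_freq (hA : SmoothTransfer lam A) :
    ∃ L : ℝ, 0 ≤ L ∧ ∀ u ∈ Ioc (0 : ℝ) 1, ∀ w w', ‖A u w - A u w'‖ ≤ L * |w - w'| := by
  obtain ⟨L, hL⟩ := hA.lipschitz_freq
  refine ⟨L, L.2, fun u hu w w' => ?_⟩
  simpa [dist_eq_norm] using (hL u hu).dist_le_mul w w'

lemma SmoothTransfer.continuous_freq (hA : SmoothTransfer lam A) {u : ℝ}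
    (hu : u ∈ Ioc (0 : ℝ) 1) : Continuous (A u) := by
  obtain ⟨L, hL⟩ := hA.lipschitz_freq
  exact (hL u hu).continuous

/-- Periodicity brings `w` into `(-π, π]`; then `A` is compared with its value at the right end of
the regime and at frequency `0`. There are finitely many such reference values, and both moves cost
a Lipschitz constant times a bounded distance. -/
lemma SmoothTransfer.exists_bound (hA : SmoothTransfer lam A) (hlam : IsBreakFractions lam)
    (hper : ∀ u ∈ Ioc (0 : ℝ) 1, Function.Periodic (A u) (2 * π)) :
    ∃ K : ℝ, 0 ≤ K ∧ ∀ u ∈ Ioc (0 : ℝ) 1, ∀ w, ‖A u w‖ ≤ K := by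
  obtain ⟨L, hL0, hL⟩ := hA.exists_lipschitz_time
  obtain ⟨L', hL0', hL'⟩ := hA.exists_lipschitz_freq
  refine ⟨(∑ j : Fin (m + 1), ‖A (lam j.succ) 0‖) + L' * π + L, by positivity, ?_⟩
  intro u hu w
  obtain ⟨j, hj⟩ := exists_regime hlam hu
  have hv := lam_succ_mem_regime hlam j
  have hw : A u w = A u (wrap w) := by
    rw [wrap, toIocMod]
    exact ((hper u hu).sub_zsmul_eq _).symm
  have hwr : |wrap w| ≤ π := by
    have := toIocMod_mem_Ioc Real.two_pi_pos (-π) w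
    rw [abs_le]
    exact ⟨this.1.le, by have := this.2; linarith⟩
  have h1 := hL j u hj _ hv (wrap w)
  have h2 := hL' _ (regime_subset hlam j hv) (wrap w) 0
  have h3 : |u - lam j.succ| ≤ 1 := by
    have := regime_subset hlam j hv
    rw [abs_le]
    constructor <;> linarith [hu.1, hu.2, this.1, this.2]
  have h4 : ‖A (lam j.succ) 0‖ ≤ ∑ j : Fin (m + 1), ‖A (lam j.succ) 0‖ :=
    Finset.single_le_sum (f := fun j : Fin (m + 1) => ‖A (lam j.succ) 0‖)
      (fun _ _ => norm_nonneg _) (Finset.mem_univ j)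
  rw [hw]
  have e : A u (wrap w) = (A u (wrap w) - A (lam j.succ) (wrap w)) +
      (A (lam j.succ) (wrap w) - A (lam j.succ) 0) + A (lam j.succ) 0 := by ring
  rw [e]
  refine (norm_add₃_le).trans ?_
  rw [sub_zero] at h2
  have h5 : L * |u - lam j.succ| ≤ L * 1 := mul_le_mul_of_nonneg_left h3 hL0
  have h6 : L' * |wrap w| ≤ L' * π := mul_le_mul_of_nonneg_left hwr hL0'
  linarith

/-- Fourier coefficients of Lipschitz functions decay like `1 / |k|`. -/
lemma norm_fourier_le {f : ℝ → ℂ} (hper : Function.Periodic f (2 * π)) (hf : Continuous f)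
    {K L : ℝ} (hK : ∀ w, ‖f w‖ ≤ K) (hL : ∀ w w', ‖f w - f w'‖ ≤ L * |w - w'|) (k : ℤ) :
    ‖∫ w in (-π)..π, Complex.exp (Complex.I * w * k) * f w‖ ≤
      (2 * π * K + 2 * π ^ 2 * L) / (1 + |k|) := by
  have hK0 : 0 ≤ K := (norm_nonneg _).trans (hK 0)
  have hL0 : 0 ≤ L := by simpa using (norm_nonneg _).trans (hL 1 0)
  have hexp : ∀ w : ℝ, ‖Complex.exp (Complex.I * w * k)‖ = 1 := by
    intro w
    rw [Complex.norm_exp]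
    simp
  rcases eq_or_ne k 0 with rfl | hk
  · have := intervalIntegral.norm_integral_le_of_norm_le_const
      (f := fun w : ℝ => Complex.exp (Complex.I * w * (0 : ℤ)) * f w) (a := -π) (b := π) (C := K)
      (fun w _ => by rw [norm_mul, hexp, one_mul]; exact hK w)
    refine this.trans ?_
    rw [abs_of_nonneg (by linarith [Real.pi_pos])]
    simp only [abs_zero, Int.cast_zero, add_zero, div_one]
    nlinarith [mul_nonneg (sq_nonneg π) hL0]
  · have hk' : (k : ℝ) ≠ 0 := by exact_mod_cast hk
    have hkC : (k : ℂ) ≠ 0 := by exact_mod_cast hk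
    set F : ℝ → ℂ := fun w => Complex.exp (Complex.I * w * k) * f w with hF
    have hFc : Continuous F := by rw [hF]; fun_prop
    have hFper : Function.Periodic F (2 * π) := by
      intro w
      simp only [hF]
      rw [hper w]
      congr 1
      push_cast
      rw [show Complex.I * (w + 2 * π) * k = Complex.I * w * k + k * (2 * π * Complex.I) by ring,
        Complex.exp_add, Complex.exp_int_mul_two_pi_mul_I, mul_one]
    -- A shift by `π / k` reverses the sign of the exponential. Adding the shifted integral to the
    -- original replaces `f` by the difference `f w - f (w + π / k)`, which is at most `L π / |k|`
    -- in norm.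
    have hshift : ∫ w in (-π)..π, F w = ∫ w in (-π)..π, F (w + π / k) := by
      rw [intervalIntegral.integral_comp_add_right F]
      have := hFper.intervalIntegral_add_eq (-π) (-π + π / k)
      rw [show -π + 2 * π = π by ring, show -π + π / k + 2 * π = π + π / k by ring] at this
      exact this
    have hFs : ∀ w : ℝ, F (w + π / k) = -(Complex.exp (Complex.I * w * k) * f (w + π / k)) := by
      intro w
      simp only [hF]
      push_cast
      rw [show Complex.I * (w + π / k) * k = Complex.I * w * k + π * Complex.I by
        field_simp, Complex.exp_add, Complex.exp_pi_mul_I]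
      ring
    have h2 : 2 * ∫ w in (-π)..π, F w =
        ∫ w in (-π)..π, Complex.exp (Complex.I * w * k) * (f w - f (w + π / k)) := by
      rw [two_mul]
      nth_rewrite 2 [hshift]
      rw [← intervalIntegral.integral_add (hFc.intervalIntegrable _ _)
        (Continuous.intervalIntegrable (by fun_prop) _ _)]
      refine intervalIntegral.integral_congr fun w _ => ?_
      simp only [hFs]
      simp only [hF]
      ring
    have h3 := intervalIntegral.norm_integral_le_of_norm_le_const
      (f := fun w : ℝ => Complex.exp (Complex.I * w * k) * (f w - f (w + π / k))) (a := -π)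
      (b := π) (C := L * (π / |(k : ℝ)|)) (fun w _ => by
        rw [norm_mul, hexp, one_mul]
        refine (hL _ _).trans_eq ?_
        rw [show w - (w + π / k) = -(π / k) by ring, abs_neg, abs_div, abs_of_pos Real.pi_pos])
    rw [← h2, norm_mul, abs_of_nonneg (show (0 : ℝ) ≤ π - -π by linarith [Real.pi_pos])] at h3
    simp only [Complex.norm_ofNat] at h3
    have hk1 : (1 : ℝ) ≤ |(k : ℝ)| := by exact_mod_cast Int.one_le_abs hk
    have h4 : ‖∫ w in (-π)..π, F w‖ ≤ π ^ 2 * L / |(k : ℝ)| := by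
      have : L * (π / |(k : ℝ)|) * (π - -π) = 2 * (π ^ 2 * L / |(k : ℝ)|) := by ring
      linarith
    refine h4.trans ?_
    push_cast
    rw [div_le_div_iff₀ (by linarith) (by linarith)]
    have h5 : 0 ≤ π ^ 2 * L := by positivity
    have h6 : 0 ≤ π * K * |(k : ℝ)| := by positivity
    nlinarith [mul_le_mul_of_nonneg_left hk1 h5]

end Transfer

/-! ### Observations as real spectral integrals -/

section Moments

variable {Ω : Type*} [MeasurableSpace Ω] {P : Measure Ω}
  {m : ℕ} {lam : Fin (m + 2) → ℝ} {A : ℝ → ℝ → ℂ} {μ : Fin (m + 1) → ℝ → ℝ} {V : ℕ → ℕ → Ω → ℝ}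

omit [MeasurableSpace Ω] in
lemma obs_eq_zero {T : ℕ} {t : ℤ} (h : ¬ (1 ≤ t ∧ t ≤ T)) : obs V T t = 0 := by
  ext x
  simp [obs, h]

lemma centered_eq_zero {T : ℕ} {t : ℤ} (h : ¬ (1 ≤ t ∧ t ≤ T)) : centered P V T t = 0 := by
  ext x
  simp [centered, obs_eq_zero h]

lemma autoCov_comm (T : ℕ) (s t : ℤ) : autoCov P V T s t = autoCov P V T t s := by
  simp only [autoCov, mul_comm]

lemma autoCov_eq_zero_left {T : ℕ} {s t : ℤ} (h : ¬ (1 ≤ s ∧ s ≤ T)) :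
    autoCov P V T s t = 0 := by
  simp [autoCov, centered_eq_zero h]

lemma autoCov_eq_zero_right {T : ℕ} {s t : ℤ} (h : ¬ (1 ≤ t ∧ t ≤ T)) :
    autoCov P V T s t = 0 := by
  rw [autoCov_comm, autoCov_eq_zero_left h]

/-- The integrand of the spectral representation at the date `t`. -/
def phase (A : ℝ → ℝ → ℂ) (T : ℕ) (t : ℤ) (w : ℝ) : ℂ :=
  Complex.exp (Complex.I * w * t) * A ((t : ℝ) / T) w

lemma norm_phase (T : ℕ) (t : ℤ) (w : ℝ) : ‖phase A T t w‖ = ‖A ((t : ℝ) / T) w‖ := by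
  rw [phase, norm_mul, Complex.norm_exp]
  simp

/-- Spectral integrals are centred and have fourth moments, so the trend is the exact mean and the
spectral part is almost surely the real centred observation. From here on `A₀` appears only through
an integrand within `K / T` of `phase`. -/
lemma IsSLS.exists_spectral [IsProbabilityMeasure P] (hlam : IsBreakFractions lam)
    (hV : IsSLS P lam A μ V) :
    ∃ (ξ : ℝ → Ω → ℂ) (g : (r : ℕ) → (Fin r → ℝ) → ℂ) (K : ℝ), 0 ≤ K ∧
      IsSpectralProcess P ξ g ∧ ∀ (T : ℕ) (j : Fin (m + 1)) (t : ℤ), 1 ≤ T → t ∈ dates lam T j →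
        ∃ (φ : ℝ → ℂ) (X : Ω → ℂ), IsSpectralIntegral P ξ φ X ∧
          (∀ᵐ x ∂P, X x = (centered P V T t x : ℂ)) ∧
          (∀ w, ‖φ w - phase A T t w‖ ≤ K / T) ∧
          MemLp (obs V T t) 4 P ∧ ∫ x, obs V T t x ∂P = μ j ((t : ℝ) / T) := by
  obtain ⟨ξ, g, A₀, K, hξ, hrep, hA₀⟩ := hV.representation
  obtain ⟨C, -, hC⟩ := hξ.fourth_moment
  refine ⟨ξ, g, |K|, abs_nonneg _, hξ, fun T j t hT ht => ?_⟩
  have h1 := dates_subset hlam ht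
  obtain ⟨n, rfl⟩ : ∃ n : ℕ, t = n := ⟨t.toNat, by omega⟩
  obtain ⟨X, hX, hVX⟩ := hrep T j n hT ht
  have hobs : ∀ᵐ x ∂P, obs V T n x = μ j ((n : ℝ) / T) + (X x).re := by
    filter_upwards [hVX] with x hx
    have : obs V T n x = V T n x := by simp [obs, h1.1, h1.2]
    rw [this]
    simpa using congrArg Complex.re hx
  have hre : MemLp (fun x => (X x).re) 4 P := (hC _ X hX).1.re
  have hint : ∫ x, obs V T n x ∂P = μ j ((n : ℝ) / T) := by
    rw [integral_congr_ae hobs, integral_add (integrable_const _)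
      (hre.integrable (by norm_num)), integral_const]
    have := integral_re (hX.2.1.integrable one_le_two)
    simp only [RCLike.re_to_complex] at this
    rw [this, hX.integral_eq_zero hξ]
    simp
  have hmem : MemLp (obs V T n) 4 P := by
    have hsum : MemLp (fun x => μ j ((n : ℝ) / T) + (X x).re) 4 P :=
      MemLp.add (f := fun _ => μ j ((n : ℝ) / T)) (memLp_const _) hre
    exact (memLp_congr_ae hobs).2 hsum
  refine ⟨fun w => Complex.exp (Complex.I * w * n) * A₀ j n T w, X, hX, ?_, fun w => ?_, hmem, hint⟩
  · filter_upwards [hVX, hobs] with x h2 h3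
    rw [centered, hint, h3, add_sub_cancel_left]
    have : obs V T n x = V T n x := by simp [obs, h1.1, h1.2]
    rw [← this, h3] at h2
    push_cast at h2
    exact (add_left_cancel h2).symm
  · have := hA₀ T j n w hT ht
    simp only [phase, Int.cast_natCast]
    rw [← mul_sub, norm_mul, Complex.norm_exp]
    simp only [Complex.mul_re, Complex.I_re, Complex.ofReal_re, zero_mul, Complex.I_im,
      Complex.ofReal_im, mul_zero, sub_self, Complex.natCast_re, Complex.natCast_im,
      Real.exp_zero, one_mul]
    exact this.trans (by gcongr; exact le_abs_self K)

/-- The inner product of stochastic integrals that are real. -/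
lemma integral_mul_eq_of_real [IsProbabilityMeasure P] {ξ : ℝ → Ω → ℂ}
    {g : (r : ℕ) → (Fin r → ℝ) → ℂ} (hξ : IsSpectralProcess P ξ g) {φ φ' : ℝ → ℂ}
    {X X' : Ω → ℂ} (h : IsSpectralIntegral P ξ φ X) (h' : IsSpectralIntegral P ξ φ' X')
    {Y Y' : Ω → ℝ} (hY : ∀ᵐ x ∂P, X x = Y x) (hY' : ∀ᵐ x ∂P, X' x = Y' x) :
    ∫ x, Y x * Y' x ∂P = ∫ w, (φ w * (starRingEnd ℂ) (φ' w)).re ∂freq := by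
  -- Polarisation from the isometry for the sum and the difference. It yields the real part of the
  -- spectral inner product, which is enough because the variables are real.
  have hp := (h.add hξ h').integral_norm_sq hξ
  have hm := (h.sub hξ h').integral_norm_sq hξ
  have i1 : ∀ {ψ : ℝ → ℂ}, MemLp ψ 2 freq → Integrable (fun w => ‖ψ w‖ ^ 2) freq :=
    fun hψ => by simpa using hψ.integrable_norm_pow (p := 2) (by norm_num)
  have i2 : ∀ {Z : Ω → ℂ}, MemLp Z 2 P → Integrable (fun w => ‖Z w‖ ^ 2) P :=
    fun hψ => by simpa using hψ.integrable_norm_pow (p := 2) (by norm_num)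
  have e1 : ∫ x, Y x * Y' x ∂P =
      (1 / 4) * (∫ x, ‖(X + X') x‖ ^ 2 ∂P - ∫ x, ‖(X - X') x‖ ^ 2 ∂P) := by
    rw [← integral_sub (i2 (h.2.1.add h'.2.1)) (i2 (h.2.1.sub h'.2.1)), ← integral_const_mul]
    refine integral_congr_ae ?_
    filter_upwards [hY, hY'] with x h1 h2
    simp only [Pi.add_apply, Pi.sub_apply, h1, h2, ← Complex.ofReal_add, ← Complex.ofReal_sub,
      Complex.norm_real, Real.norm_eq_abs, sq_abs]
    ring
  have e2 : ∫ w, (φ w * (starRingEnd ℂ) (φ' w)).re ∂freq =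
      (1 / 4) * (∫ x, ‖(φ + φ') x‖ ^ 2 ∂freq - ∫ x, ‖(φ - φ') x‖ ^ 2 ∂freq) := by
    rw [← integral_sub (i1 (h.1.add h'.1)) (i1 (h.1.sub h'.1)), ← integral_const_mul]
    refine integral_congr_ae (ae_of_all _ fun w => ?_)
    simp only [Pi.add_apply, Pi.sub_apply]
    rw [Complex.sq_norm, Complex.sq_norm, Complex.normSq_add, Complex.normSq_sub]
    ring
  rw [e1, e2, hp, hm]

/-- The moment properties of a segmented locally stationary array that the limit theory uses. -/
structure MomentBounds (P : Measure Ω) (lam : Fin (m + 2) → ℝ) (A : ℝ → ℝ → ℂ)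
    (μ : Fin (m + 1) → ℝ → ℝ) (V : ℕ → ℕ → Ω → ℝ) (C : ℝ) : Prop where
  nonneg : 0 ≤ C
  memLp : ∀ T t, MemLp (obs V T t) 4 P
  mean : ∀ (T : ℕ) (j : Fin (m + 1)) (t : ℤ), 1 ≤ T → t ∈ dates lam T j →
    ∫ x, obs V T t x ∂P = μ j ((t : ℝ) / T)
  fourth : ∀ T t, ∫ x, centered P V T t x ^ 4 ∂P ≤ C
  cov_decay : ∀ (T : ℕ) (s t : ℤ), 1 ≤ T → |autoCov P V T s t| ≤ C / (1 + |s - t|) + C / T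
  cov_local : ∀ (T : ℕ) (j : Fin (m + 1)) (s t : ℤ) (u : ℝ), 1 ≤ T → s ∈ dates lam T j →
    t ∈ dates lam T j → u ∈ regime lam j →
    |autoCov P V T s t - localCov A u (s - t)| ≤
      C * (1 / T + |(s : ℝ) / T - u| + |(t : ℝ) / T - u|)
  increment : ∀ (T S : ℕ) (j : Fin (m + 1)) (t : ℤ), 1 ≤ T → 1 ≤ S → t ∈ dates lam T j →
    t ∈ dates lam S j → ∫ x, (centered P V T t x - centered P V S t x) ^ 4 ∂P ≤
      C * (|(t : ℝ) / T - (t : ℝ) / S| + 1 / T + 1 / S) ^ 4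
  local_bound : ∀ u ∈ Ioc (0 : ℝ) 1, ∀ k : ℤ, |localCov A u k| ≤ C
  local_lipschitz : ∀ j, ∀ u ∈ regime lam j, ∀ v ∈ regime lam j, ∀ k : ℤ,
    |localCov A u k - localCov A v k| ≤ C * |u - v|

lemma integral_freq_le {f : ℝ → ℝ} {c : ℝ} (hf : ∀ w, |f w| ≤ c) : |∫ w, f w ∂freq| ≤ 2 * π * c := by
  have := norm_integral_le_of_norm_le_const (μ := freq) (f := f) (C := c) (ae_of_all _ hf)
  rwa [freq_univ, mul_comm] at this

lemma norm_mul_conj_sub_le {a a' b b' : ℂ} {K ε δ : ℝ} (ha : ‖a‖ ≤ K) (hb' : ‖b'‖ ≤ K)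
    (h1 : ‖a - a'‖ ≤ ε) (h2 : ‖b - b'‖ ≤ δ) :
    ‖a * (starRingEnd ℂ) b - a' * (starRingEnd ℂ) b'‖ ≤ K * (ε + δ) := by
  have e : a * (starRingEnd ℂ) b - a' * (starRingEnd ℂ) b' =
      a * (starRingEnd ℂ) (b - b') + (a - a') * (starRingEnd ℂ) b' := by
    rw [map_sub]
    ring
  rw [e]
  refine (norm_add_le _ _).trans ?_
  rw [norm_mul, norm_mul, RCLike.norm_conj, RCLike.norm_conj]
  have hK : 0 ≤ K := (norm_nonneg _).trans ha
  have h3 : ‖a‖ * ‖b - b'‖ ≤ K * δ := mul_le_mul ha h2 (norm_nonneg _) hK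
  have h4 : ‖a - a'‖ * ‖b'‖ ≤ ε * K :=
    mul_le_mul h1 hb' (norm_nonneg _) ((norm_nonneg _).trans h1)
  linarith

/-- The exponential depends on the dates only through their difference, so a covariance is a Fourier
coefficient at lag `s - t` of a product of transfer functions. -/
lemma phase_mul_conj (T : ℕ) (s t : ℤ) (w : ℝ) :
    phase A T s w * (starRingEnd ℂ) (phase A T t w) =
      Complex.exp (Complex.I * w * (s - t : ℤ)) *
        (A ((s : ℝ) / T) w * (starRingEnd ℂ) (A ((t : ℝ) / T) w)) := by
  rw [phase, phase, map_mul, ← Complex.exp_conj]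
  have : Complex.exp (Complex.I * w * (s - t : ℤ)) =
      Complex.exp (Complex.I * w * s) *
        Complex.exp ((starRingEnd ℂ) (Complex.I * w * t)) := by
    rw [← Complex.exp_add]
    congr 1
    simp
    ring
  rw [this]
  ring

lemma norm_exp_phase (w : ℝ) (k : ℤ) : ‖Complex.exp (Complex.I * w * k)‖ = 1 := by
  rw [Complex.norm_exp]
  simp

lemma localCov_eq {u : ℝ} (hA : Continuous (A u)) (k : ℤ) : localCov A u k =
    ∫ w, (Complex.exp (Complex.I * w * k) * (A u w * (starRingEnd ℂ) (A u w))).re ∂freq := by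
  have hc : Continuous fun w : ℝ =>
    Complex.exp (Complex.I * w * k) * (A u w * (starRingEnd ℂ) (A u w)) := by fun_prop
  have hi : Integrable (fun w : ℝ =>
      Complex.exp (Complex.I * w * k) * (A u w * (starRingEnd ℂ) (A u w))) freq :=
    (hc.integrableOn_Icc (a := -π) (b := π)).mono_set Ioc_subset_Icc_self
  have := integral_re hi
  simp only [RCLike.re_to_complex] at this
  rw [this, localCov, intervalIntegral.integral_of_le (by linarith [Real.pi_pos])]
  congr 2
  ext w
  rw [Complex.mul_conj']
  push_cast
  rfl

end Moments

/-! ### The moment bounds for segmented locally stationary arrays -/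

section MomentBounds

variable {Ω : Type*} [MeasurableSpace Ω] {P : Measure Ω}
  {m : ℕ} {lam : Fin (m + 2) → ℝ} {A : ℝ → ℝ → ℂ} {μ : Fin (m + 1) → ℝ → ℝ} {V : ℕ → ℕ → Ω → ℝ}

lemma integral_pow_four_le [IsProbabilityMeasure P] {C₄ : ℝ} (hC₄ : 0 ≤ C₄) {φ : ℝ → ℂ}
    {X : Ω → ℂ} (h4 : ∫ x, ‖X x‖ ^ 4 ∂P ≤ C₄ * (∫ w, ‖φ w‖ ^ 2 ∂freq) ^ 2)
    {Y : Ω → ℝ} (hY : ∀ᵐ x ∂P, X x = Y x) {e : ℝ} (he : ∀ w, ‖φ w‖ ≤ e) :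
    ∫ x, Y x ^ 4 ∂P ≤ C₄ * (2 * π) ^ 2 * e ^ 4 := by
  have e1 : ∫ x, Y x ^ 4 ∂P = ∫ x, ‖X x‖ ^ 4 ∂P := by
    refine integral_congr_ae ?_
    filter_upwards [hY] with x hx
    rw [hx, Complex.norm_real, Real.norm_eq_abs, Even.pow_abs (by decide)]
  have e2 : ∫ w, ‖φ w‖ ^ 2 ∂freq ≤ 2 * π * e ^ 2 := by
    refine (le_abs_self _).trans (integral_freq_le fun w => ?_)
    rw [abs_of_nonneg (by positivity)]
    exact pow_le_pow_left₀ (norm_nonneg _) (he w) 2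
  rw [e1]
  refine h4.trans ?_
  have e3 : (∫ w, ‖φ w‖ ^ 2 ∂freq) ^ 2 ≤ (2 * π * e ^ 2) ^ 2 :=
    pow_le_pow_left₀ (by positivity) e2 2
  calc C₄ * (∫ w, ‖φ w‖ ^ 2 ∂freq) ^ 2 ≤ C₄ * (2 * π * e ^ 2) ^ 2 :=
        mul_le_mul_of_nonneg_left e3 hC₄
    _ = _ := by ring

lemma abs_integral_re_sub_le {f g : ℝ → ℂ} (hf : Integrable f freq) (hg : Integrable g freq)
    {c : ℝ} (h : ∀ w, ‖f w - g w‖ ≤ c) :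
    |∫ w, (f w).re ∂freq - ∫ w, (g w).re ∂freq| ≤ 2 * π * c := by
  have h1 := integral_sub hf.re hg.re
  simp only [RCLike.re_to_complex] at h1
  rw [← h1]
  refine integral_freq_le fun w => ?_
  change |(f w).re - (g w).re| ≤ c
  rw [← Complex.sub_re]
  exact (Complex.abs_re_le_norm _).trans (h w)

lemma integrable_mul_conj {φ φ' : ℝ → ℂ} (h : MemLp φ 2 freq) (h' : MemLp φ' 2 freq) :
    Integrable (fun w => φ w * (starRingEnd ℂ) (φ' w)) freq :=
  h.integrable_mul h'.star

lemma integrable_freq_of_continuous {f : ℝ → ℂ} (hf : Continuous f) : Integrable f freq :=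
  (hf.integrableOn_Icc (a := -π) (b := π)).mono_set Ioc_subset_Icc_self

/-- Every bound is read off from integrands. Replacing `A₀` by `A` costs `O(1/T)`; Lipschitz
continuity in frequency gives decay of covariances and Lipschitz continuity in time gives their
local form. At two sample sizes the integrands of the same date share their exponential, so the
difference of the variables is a spectral integral of a uniformly small function, whose fourth
moment is controlled by `IsSpectralProcess.fourth_moment`. -/
theorem IsSLS.exists_momentBounds [IsProbabilityMeasure P] (hlam : IsBreakFractions lam)
    (hV : IsSLS P lam A μ V) (hA : SmoothTransfer lam A) : ∃ C, MomentBounds P lam A μ V C := by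
  obtain ⟨ξ, g, K, hK0, hξ, hrep⟩ := hV.exists_spectral hlam
  obtain ⟨C₄, hC₄, hfour⟩ := hξ.fourth_moment
  obtain ⟨L, hL0, hL⟩ := hA.exists_lipschitz_time
  obtain ⟨L', hL0', hL'⟩ := hA.exists_lipschitz_freq
  obtain ⟨KA, hKA0, hKA⟩ := hA.exists_bound hlam hV.periodic
  have hcont := fun u hu => hA.continuous_freq (u := u) hu
  have hdiv : ∀ {T : ℕ} {j : Fin (m + 1)} {t : ℤ}, 1 ≤ T → t ∈ dates lam T j →
      (t : ℝ) / T ∈ Ioc (0 : ℝ) 1 := fun hT ht => regime_subset hlam _ (div_mem_regime hT ht)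
  have hKT : ∀ {T : ℕ}, 1 ≤ T → K / T ≤ K := fun hT =>
    div_le_self hK0 (by exact_mod_cast hT)
  have hπ := Real.pi_pos
  have hcph : ∀ {T : ℕ} {j : Fin (m + 1)} {t : ℤ}, 1 ≤ T → t ∈ dates lam T j →
      Continuous (phase A T t) := by
    intro T j t hT ht
    have := hcont _ (hdiv hT ht)
    unfold phase
    fun_prop
  -- The dates may belong to different regimes here: the decay bound needs this generality, while
  -- the local bound uses `i = j`.
  have hcov : ∀ (T : ℕ) (i j : Fin (m + 1)) (s t : ℤ), 1 ≤ T → s ∈ dates lam T i →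
      t ∈ dates lam T j → |autoCov P V T s t -
        ∫ w, (phase A T s w * (starRingEnd ℂ) (phase A T t w)).re ∂freq| ≤
          4 * π * (KA + K) * K / T := by
    intro T i j s t hT hs ht
    obtain ⟨φ, X, hX, hXc, hφ, -, -⟩ := hrep T i s hT hs
    obtain ⟨φ', X', hX', hXc', hφ', -, -⟩ := hrep T j t hT ht
    rw [autoCov, integral_mul_eq_of_real hξ hX hX' hXc hXc']
    refine (abs_integral_re_sub_le (integrable_mul_conj hX.1 hX'.1) (integrable_freq_of_continuous
      ((hcph hT hs).mul (Complex.continuous_conj.comp (hcph hT ht))))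
      (c := (KA + K) * (K / T + K / T)) fun w => ?_).trans (le_of_eq (by ring))
    refine norm_mul_conj_sub_le ?_ ?_ (hφ w) (hφ' w)
    · have h1 := norm_sub_norm_le (φ w) (phase A T s w)
      rw [norm_phase] at h1
      linarith [hφ w, hKA _ (hdiv hT hs) w, hKT hT]
    · rw [norm_phase]
      linarith [hKA _ (hdiv hT ht) w]
  -- `C₁` is for fourth moments, `C₂` for Fourier decay, `C₃` for replacing `A₀` by `A`, `C₅` for
  -- increments in the sample size and `C₆` for Lipschitz continuity in time. Their sum serves as
  -- the common constant.
  set C₁ := C₄ * (2 * π) ^ 2 * (KA + K) ^ 4 with hC₁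
  set C₂ := 2 * π * KA ^ 2 + 2 * π ^ 2 * (2 * KA * L') with hC₂
  set C₃ := 4 * π * (KA + K) * K with hC₃
  set C₅ := C₄ * (2 * π) ^ 2 * (K + L) ^ 4 with hC₅
  set C₆ := 4 * π * KA * L with hC₆
  have h1 : 0 ≤ C₁ := by positivity
  have h2 : 0 ≤ C₂ := by positivity
  have h3 : 0 ≤ C₃ := by positivity
  have h5 : 0 ≤ C₅ := by positivity
  have h6 : 0 ≤ C₆ := by positivity
  clear_value C₃
  have hlocdiff : ∀ (u v v' : ℝ) (e e' : ℝ) (k : ℤ), u ∈ Ioc (0 : ℝ) 1 → v ∈ Ioc (0 : ℝ) 1 →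
      v' ∈ Ioc (0 : ℝ) 1 → (∀ w, ‖A v w - A u w‖ ≤ e) → (∀ w, ‖A v' w - A u w‖ ≤ e') →
      |∫ w, (Complex.exp (Complex.I * w * k) * (A v w * (starRingEnd ℂ) (A v' w))).re ∂freq -
        localCov A u k| ≤ 2 * π * (KA * (e + e')) := by
    intro u v v' e e' k hu hv hv' he he'
    have c1 := hcont u hu
    have c2 := hcont v hv
    have c3 := hcont v' hv'
    rw [localCov_eq c1]
    refine abs_integral_re_sub_le (integrable_freq_of_continuous (by fun_prop))
      (integrable_freq_of_continuous (by fun_prop)) fun w => ?_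
    rw [← mul_sub, norm_mul, norm_exp_phase, one_mul]
    exact norm_mul_conj_sub_le (hKA v hv w) (hKA u hu w) (he w) (he' w)
  refine ⟨C₁ + C₂ + C₃ + C₅ + C₆, by positivity, ?_, ?_, ?_, ?_, ?_, ?_, ?_, ?_⟩
  · intro T t
    by_cases h : 1 ≤ t ∧ t ≤ T
    · obtain ⟨j, hj⟩ := exists_dates hlam h.1 h.2
      obtain ⟨-, -, -, -, -, hmem, -⟩ := hrep T j t (by omega) hj
      exact hmem
    · rw [obs_eq_zero h]
      exact MemLp.zero
  · intro T j t hT ht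
    obtain ⟨-, -, -, -, -, -, h⟩ := hrep T j t hT ht
    exact h
  · intro T t
    by_cases h : 1 ≤ t ∧ t ≤ T
    · obtain ⟨j, hj⟩ := exists_dates hlam h.1 h.2
      have hT : 1 ≤ T := by omega
      obtain ⟨φ, X, hX, hXc, hφ, -, -⟩ := hrep T j t hT hj
      have := integral_pow_four_le hC₄ (hfour φ X hX).2 hXc (e := KA + K) fun w => by
        have h1 := norm_sub_norm_le (φ w) (phase A T t w)
        rw [norm_phase] at h1
        linarith [hφ w, hKA _ (hdiv hT hj) w, hKT hT]
      linarith
    · rw [centered_eq_zero h]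
      simp
      positivity
  · intro T s t hT
    have hnn : 0 ≤ (C₁ + C₂ + C₃ + C₅ + C₆) / (1 + |((s - t : ℤ) : ℝ)|) +
      (C₁ + C₂ + C₃ + C₅ + C₆) / T := by positivity
    push_cast at hnn
    by_cases hs : 1 ≤ s ∧ s ≤ T
    swap
    · rw [autoCov_eq_zero_left hs, abs_zero]
      simpa using hnn
    by_cases ht : 1 ≤ t ∧ t ≤ T
    swap
    · rw [autoCov_eq_zero_right ht, abs_zero]
      simpa using hnn
    obtain ⟨i, hi⟩ := exists_dates hlam hs.1 hs.2
    obtain ⟨j, hj⟩ := exists_dates hlam ht.1 ht.2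
    have e1 := hcov T i j s t hT hi hj
    have d1 := hdiv hT hi
    have d2 := hdiv hT hj
    have c1 := hcont _ d1
    have c2 := hcont _ d2
    have e2 : |∫ w, (phase A T s w * (starRingEnd ℂ) (phase A T t w)).re ∂freq| ≤
        C₂ / (1 + |(s - t : ℤ)|) := by
      have hi := integrable_freq_of_continuous
        ((hcph hT hi).mul (Complex.continuous_conj.comp (hcph hT hj)))
      have : ∫ w, (phase A T s w * (starRingEnd ℂ) (phase A T t w)).re ∂freq =
        (∫ w, phase A T s w * (starRingEnd ℂ) (phase A T t w) ∂freq).re := integral_re hi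
      rw [this]
      refine (Complex.abs_re_le_norm _).trans ?_
      simp_rw [phase_mul_conj]
      have h5 := norm_fourier_le (f := fun w => A ((s : ℝ) / T) w *
        (starRingEnd ℂ) (A ((t : ℝ) / T) w)) (K := KA ^ 2) (L := 2 * KA * L') ?_ (by fun_prop)
        ?_ ?_ (s - t)
      · rwa [intervalIntegral.integral_of_le (by linarith)] at h5
      · intro w
        simp only [hV.periodic _ d1 w, hV.periodic _ d2 w]
      · intro w
        rw [norm_mul, RCLike.norm_conj, sq]
        exact mul_le_mul (hKA _ d1 w) (hKA _ d2 w) (norm_nonneg _) hKA0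
      · intro w w'
        refine (norm_mul_conj_sub_le (hKA _ d1 w) (hKA _ d2 w') (hL' _ d1 w w')
          (hL' _ d2 w w')).trans_eq (by ring)
    have e3 : C₂ / (1 + |((s - t : ℤ) : ℝ)|) ≤
        (C₁ + C₂ + C₃ + C₅ + C₆) / (1 + |((s - t : ℤ) : ℝ)|) := by gcongr; linarith
    have e4 : C₃ / T ≤ (C₁ + C₂ + C₃ + C₅ + C₆) / (T : ℝ) := by gcongr; linarith
    have e5 := abs_sub_abs_le_abs_sub (autoCov P V T s t)
      (∫ w, (phase A T s w * (starRingEnd ℂ) (phase A T t w)).re ∂freq)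
    push_cast at e1 e2 e3 ⊢
    linarith
  · intro T j s t u hT hs ht hu
    have hu' := regime_subset hlam j hu
    have e1 := hcov T j j s t hT hs ht
    simp_rw [phase_mul_conj] at e1
    have e2 := hlocdiff u _ _ _ _ (s - t) hu' (hdiv hT hs) (hdiv hT ht)
      (hL j _ (div_mem_regime hT hs) u hu) (hL j _ (div_mem_regime hT ht) u hu)
    have e3 := abs_sub_le (autoCov P V T s t) (∫ w, (Complex.exp (Complex.I * w * (s - t : ℤ)) *
      (A ((s : ℝ) / T) w * (starRingEnd ℂ) (A ((t : ℝ) / T) w))).re ∂freq) (localCov A u (s - t))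
    have e4 : 2 * π * (KA * (L * |(s : ℝ) / T - u| + L * |(t : ℝ) / T - u|)) ≤
        C₆ * (|(s : ℝ) / T - u| + |(t : ℝ) / T - u|) := by
      have : 0 ≤ π * KA * L * (|(s : ℝ) / T - u| + |(t : ℝ) / T - u|) := by positivity
      rw [hC₆]
      nlinarith
    have e5 : 0 ≤ (C₁ + C₂ + C₃ + C₅) * (|(s : ℝ) / T - u| + |(t : ℝ) / T - u|) := by positivity
    have e6 : 0 ≤ (C₁ + C₂ + C₅ + C₆) * (1 / (T : ℝ)) := by positivity
    have e7 : C₃ / T = C₃ * (1 / (T : ℝ)) := by ring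
    nlinarith
  · intro T S j t hT hS ht ht'
    obtain ⟨φ, X, hX, hXc, hφ, -, -⟩ := hrep T j t hT ht
    obtain ⟨φ', X', hX', hXc', hφ', -, -⟩ := hrep S j t hS ht'
    have hsub := hX.sub hξ hX'
    have := integral_pow_four_le hC₄ (hfour _ _ hsub).2
      (Y := fun x => centered P V T t x - centered P V S t x) (by
        filter_upwards [hXc, hXc'] with x h1 h2
        simp [h1, h2]) (e := (K + L) * (|(t : ℝ) / T - (t : ℝ) / S| + 1 / T + 1 / S)) fun w => by
        have e1 := hφ w
        have e2 := hφ' w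
        have e3 : ‖phase A T t w - phase A S t w‖ ≤ L * |(t : ℝ) / T - (t : ℝ) / S| := by
          rw [phase, phase, ← mul_sub, norm_mul, norm_exp_phase, one_mul]
          exact hL j _ (div_mem_regime hT ht) _ (div_mem_regime hS ht') w
        have e4 : φ w - φ' w = (φ w - phase A T t w) + (phase A T t w - phase A S t w) -
          (φ' w - phase A S t w) := by ring
        rw [Pi.sub_apply, e4]
        refine (norm_sub_le _ _).trans ?_
        have e5 := norm_add_le (φ w - phase A T t w) (phase A T t w - phase A S t w)
        have e6 : 0 ≤ K * |(t : ℝ) / T - (t : ℝ) / S| := by positivity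
        have e7 : 0 ≤ L * (1 / (T : ℝ) + 1 / S) := by positivity
        have e8 : K / T = K * (1 / (T : ℝ)) := by ring
        have e9 : K / S = K * (1 / (S : ℝ)) := by ring
        linarith
    refine this.trans ?_
    rw [mul_pow (K + L), ← mul_assoc, ← hC₅]
    gcongr
    linarith
  · intro u hu k
    have c1 := hcont u hu
    rw [localCov_eq c1]
    refine (integral_freq_le (c := KA ^ 2) fun w => ?_).trans ?_
    · refine (Complex.abs_re_le_norm _).trans ?_
      rw [norm_mul, norm_exp_phase, one_mul, norm_mul, RCLike.norm_conj, sq]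
      exact mul_le_mul (hKA _ hu w) (hKA _ hu w) (norm_nonneg _) hKA0
    · have : 0 ≤ 2 * π ^ 2 * (2 * KA * L') := by positivity
      linarith
  · intro j u hu v hv k
    have hu' := regime_subset hlam j hu
    have hv' := regime_subset hlam j hv
    have e2 := hlocdiff v u u _ _ k hv' hu' hu' (hL j u hu v hv) (hL j u hu v hv)
    rw [← localCov_eq (hcont u hu')] at e2
    refine e2.trans ?_
    have e5 : 0 ≤ (C₁ + C₂ + C₃ + C₅) * |u - v| := by positivity
    rw [hC₆]
    linarith

end MomentBounds

/-! ### Variances of quadratic and linear forms -/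

section Variance

variable {Ω : Type*} [MeasurableSpace Ω] {P : Measure Ω}
  {m : ℕ} {lam : Fin (m + 2) → ℝ} {A : ℝ → ℝ → ℂ} {μ : Fin (m + 1) → ℝ → ℝ} {V : ℕ → ℕ → Ω → ℝ}
  {C : ℝ}

lemma MomentBounds.centered_memLp [IsFiniteMeasure P] (h : MomentBounds P lam A μ V C) (T : ℕ)
    (t : ℤ) : MemLp (centered P V T t) 4 P :=
  (h.memLp T t).sub (memLp_const _)

lemma memLp_two_mul {X Y : Ω → ℝ} (hX : MemLp X 4 P) (hY : MemLp Y 4 P) :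
    MemLp (fun x => X x * Y x) 2 P := by
  have : ENNReal.HolderTriple 4 4 2 := by
    constructor
    rw [show (4 : ℝ≥0∞) = 2 * 2 by norm_num, ENNReal.mul_inv (by simp) (by simp), ← add_mul,
      ENNReal.inv_two_add_inv_two, one_mul]
  exact hY.mul hX

lemma MomentBounds.mul_memLp [IsFiniteMeasure P] (h : MomentBounds P lam A μ V C) (T : ℕ)
    (s t : ℤ) : MemLp (fun x => centered P V T s x * centered P V T t x) 2 P :=
  memLp_two_mul (h.centered_memLp T s) (h.centered_memLp T t)

lemma summable_inv_sq_int : Summable fun d : ℤ => (1 / (1 + |(d : ℝ)|)) ^ 2 := by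
  have h : Summable fun n : ℕ => (1 / (1 + (n : ℝ))) ^ 2 := by
    have := (summable_nat_add_iff 1).2 (Real.summable_one_div_nat_pow.2 one_lt_two)
    refine this.congr fun n => ?_
    push_cast
    rw [div_pow, one_pow, add_comm]
  refine Summable.of_nat_of_neg ?_ ?_
  · simpa using h
  · simpa using h

/-- Square summability of the autocovariances. -/
lemma MomentBounds.exists_sum_sq_autoCov (h : MomentBounds P lam A μ V C) :
    ∃ D : ℝ, 0 ≤ D ∧ ∀ (T : ℕ) (s : ℤ) (J : Finset ℤ), 1 ≤ T →
      ∑ t ∈ J, autoCov P V T s t ^ 2 ≤ D := by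
  have hC := h.nonneg
  refine ⟨2 * C ^ 2 * (∑' d : ℤ, (1 / (1 + |(d : ℝ)|)) ^ 2) + 2 * C ^ 2, by positivity, ?_⟩
  intro T s J hT
  have hT' : (1 : ℝ) ≤ T := by exact_mod_cast hT
  -- The bound on covariances contains `C / T`, which does not decay in the lag. Restricting to the
  -- at most `T` dates of the sample makes its squares sum to at most a constant.
  have h1 : ∑ t ∈ J, autoCov P V T s t ^ 2 =
      ∑ t ∈ J with 1 ≤ t ∧ t ≤ (T : ℤ), autoCov P V T s t ^ 2 := by
    rw [Finset.sum_filter]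
    refine Finset.sum_congr rfl fun t _ => ?_
    split_ifs with ht
    · rfl
    · rw [autoCov_eq_zero_right ht]
      simp
  have h2 : ∀ t, autoCov P V T s t ^ 2 ≤
      2 * C ^ 2 * (1 / (1 + |((s - t : ℤ) : ℝ)|)) ^ 2 + 2 * C ^ 2 / T ^ 2 := by
    intro t
    have h3 := h.cov_decay T s t hT
    rw [← sq_abs]
    refine (pow_le_pow_left₀ (abs_nonneg _) h3 2).trans ?_
    have := add_sq_le (a := C / (1 + |(s : ℝ) - t|)) (b := C / T)
    push_cast
    refine this.trans (le_of_eq ?_)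
    ring
  have hcard : ((J.filter fun t => 1 ≤ t ∧ t ≤ (T : ℤ)).card : ℝ) ≤ T := by
    have : (J.filter fun t => 1 ≤ t ∧ t ≤ (T : ℤ)) ⊆ Finset.Icc (1 : ℤ) (T : ℤ) := by
      intro t ht
      simpa using (Finset.mem_filter.1 ht).2
    have := Finset.card_le_card this
    simp at this
    exact_mod_cast this
  rw [h1]
  refine (Finset.sum_le_sum fun t _ => h2 t).trans ?_
  rw [Finset.sum_add_distrib, ← Finset.mul_sum, Finset.sum_const, nsmul_eq_mul]
  refine add_le_add (mul_le_mul_of_nonneg_left ?_ (by positivity)) ?_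
  · have hinj : Function.Injective fun t : ℤ => s - t := fun a b hab => by simpa using hab
    exact (summable_inv_sq_int.comp_injective hinj).sum_le_tsum _ (fun _ _ => sq_nonneg _)
      |>.trans (tsum_comp_le_tsum_of_inj summable_inv_sq_int (fun _ => sq_nonneg _) hinj)
  · calc ((J.filter fun t => 1 ≤ t ∧ t ≤ (T : ℤ)).card : ℝ) * (2 * C ^ 2 / T ^ 2)
        ≤ T * (2 * C ^ 2 / T ^ 2) := mul_le_mul_of_nonneg_right hcard (by positivity)
      _ = 2 * C ^ 2 / T := by field_simp
      _ ≤ 2 * C ^ 2 := div_le_self (by positivity) hT'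

/-- Summability of the fourth cumulants of products along a fixed lag. -/
lemma WeakDependence.exists_sum_cumulant (hdep : WeakDependence P lam A V) :
    ∃ D : ℝ, 0 ≤ D ∧ ∀ (T : ℕ) (q s : ℤ) (J : Finset ℤ), 1 ≤ T →
      ∑ t ∈ J, |fourthCumulant P V T s q (t - s) (t - s + q)| ≤ D := by
  obtain ⟨D, hD⟩ := hdep.cum_summable
  refine ⟨|D|, abs_nonneg _, fun T q s J hT => ?_⟩
  by_cases hs : 1 ≤ s ∧ s ≤ T
  · obtain ⟨b, hb, hbD, hbκ⟩ := hD T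
    have hT' : (0 : ℝ) < T := by exact_mod_cast hT
    -- The summability assumption is indexed by rescaled time, and `s / T` is the point that returns
    -- the date `s`.
    have hfl : ⌊(T : ℝ) * ((s : ℝ) / T)⌋ = s := by
      rw [mul_div_cancel₀ _ hT'.ne', Int.floor_intCast]
    have hu : (s : ℝ) / T ∈ Icc (0 : ℝ) 1 := by
      have h1 : (0 : ℝ) ≤ s := by exact_mod_cast (by omega : (0 : ℤ) ≤ s)
      have h2 : (s : ℝ) ≤ T := by exact_mod_cast hs.2
      exact ⟨by positivity, by rw [div_le_one hT']; exact h2⟩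
    have hle : ∀ k p l, |fourthCumulant P V T s k p l| ≤ b (k, p, l) := by
      intro k p l
      have := hbκ _ hu k p l
      rwa [hfl] at this
    have hb0 : ∀ q, 0 ≤ b q := fun q => (abs_nonneg _).trans (hle q.1 q.2.1 q.2.2)
    -- With `s` and `q` fixed the cumulants run along a line in the lag lattice, so their sum is at
    -- most the full triple sum.
    have hinj : Function.Injective fun t : ℤ => ((q, t - s, t - s + q) : ℤ × ℤ × ℤ) := by
      intro a c hac
      simp only [Prod.mk.injEq] at hac
      omega
    calc ∑ t ∈ J, |fourthCumulant P V T s q (t - s) (t - s + q)|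
        ≤ ∑ t ∈ J, b (q, t - s, t - s + q) := Finset.sum_le_sum fun t _ => hle _ _ _
      _ ≤ ∑' t : ℤ, b (q, t - s, t - s + q) :=
          (hb.comp_injective hinj).sum_le_tsum _ (fun _ _ => hb0 _)
      _ ≤ ∑' q, b q := tsum_comp_le_tsum_of_inj hb hb0 hinj
      _ ≤ |D| := hbD.trans (le_abs_self D)
  · have : ∀ k p l, fourthCumulant P V T s k p l = 0 := by
      intro k p l
      simp [fourthCumulant, autoCov, centered_eq_zero hs]
    simp [this]

/-- Bounds for second moments of linear and quadratic forms in the centred observations. -/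
structure VarianceBounds (P : Measure Ω) (V : ℕ → ℕ → Ω → ℝ) (D : ℝ) : Prop where
  nonneg : 0 ≤ D
  quadratic : ∀ (T : ℕ) (q : ℤ) (J : Finset ℤ), 1 ≤ T →
    ∫ x, (∑ s ∈ J, (centered P V T s x * centered P V T (s + q) x -
      autoCov P V T s (s + q))) ^ 2 ∂P ≤ D * J.card
  linear : ∀ (T : ℕ) (J : Finset ℤ) (a : ℤ → ℝ) (B : ℝ), 1 ≤ T → (∀ s ∈ J, |a s| ≤ B) →
    (∫ x, (∑ s ∈ J, a s * centered P V T s x) ^ 2 ∂P) ^ 2 ≤ B ^ 4 * D * (J.card : ℝ) ^ 3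

lemma integral_sum_sq {ι : Type*} {J : Finset ι} {Z : ι → Ω → ℝ} (hZ : ∀ i ∈ J, MemLp (Z i) 2 P) :
    ∫ x, (∑ i ∈ J, Z i x) ^ 2 ∂P = ∑ i ∈ J, ∑ j ∈ J, ∫ x, Z i x * Z j x ∂P := by
  have hi : ∀ i ∈ J, ∀ j ∈ J, Integrable (fun x => Z i x * Z j x) P := fun i hi j hj =>
    (hZ i hi).integrable_mul (hZ j hj)
  simp_rw [sq, Finset.sum_mul_sum]
  rw [integral_finsetSum _ fun i h => integrable_finsetSum _ fun j h' => hi i h j h']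
  exact Finset.sum_congr rfl fun i h => integral_finsetSum _ fun j h' => hi i h j h'

lemma integral_sub_mul_sub [IsProbabilityMeasure P] {f g : Ω → ℝ} (hf : MemLp f 2 P)
    (hg : MemLp g 2 P) (a b : ℝ) :
    ∫ x, (f x - a) * (g x - b) ∂P =
      ∫ x, f x * g x ∂P - b * ∫ x, f x ∂P - a * ∫ x, g x ∂P + a * b := by
  have i1 : Integrable (fun x => f x * g x) P := hf.integrable_mul hg
  have i2 : Integrable (fun x => b * f x) P := (hf.integrable one_le_two).const_mul b
  have i3 : Integrable (fun x => a * g x) P := (hg.integrable one_le_two).const_mul a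
  have i4 : Integrable (fun x => f x * g x - b * f x) P := i1.sub i2
  have i5 : Integrable (fun x => f x * g x - b * f x - a * g x) P := i4.sub i3
  have e : ∀ x, (f x - a) * (g x - b) = f x * g x - b * f x - a * g x + a * b := fun x => by ring
  simp_rw [e]
  rw [integral_add i5 (integrable_const _), integral_sub i4 i3, integral_sub i1 i2,
    integral_const_mul, integral_const_mul, integral_const, probReal_univ, one_smul]

/-- The covariance of two lagged products is a fourth cumulant plus two products of covariances.
Cumulants are summable in the second date, and covariance products are so by `2xy ≤ x² + y²` and
square summability. Hence each row of the double sum is bounded and the variance is linear in `|J|`.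
-/
theorem MomentBounds.exists_varianceBounds [IsProbabilityMeasure P]
    (h : MomentBounds P lam A μ V C) (hdep : WeakDependence P lam A V) :
    ∃ D, VarianceBounds P V D := by
  obtain ⟨D₁, hD₁, hcov⟩ := h.exists_sum_sq_autoCov
  obtain ⟨D₂, hD₂, hcum⟩ := hdep.exists_sum_cumulant
  have hcov' : ∀ (T : ℕ) (s : ℤ) (q : ℤ) (J : Finset ℤ), 1 ≤ T →
      ∑ t ∈ J, autoCov P V T s (t + q) ^ 2 ≤ D₁ := by
    intro T s q J hT
    have := hcov T s (J.map (addRightEmbedding q)) hT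
    simpa using this
  refine ⟨2 * D₁ + D₂, by positivity, ?_, ?_⟩
  · intro T q J hT
    have hint : ∀ s t, Integrable (fun x => centered P V T s x * centered P V T t x) P :=
      fun s t => (h.mul_memLp T s t).integrable one_le_two
    rw [integral_sum_sq (Z := fun s x => centered P V T s x * centered P V T (s + q) x -
      autoCov P V T s (s + q)) fun s _ => (h.mul_memLp T s (s + q)).sub (memLp_const _)]
    have hterm : ∀ s t, ∫ x, (centered P V T s x * centered P V T (s + q) x -
        autoCov P V T s (s + q)) * (centered P V T t x * centered P V T (t + q) x -
        autoCov P V T t (t + q)) ∂P = fourthCumulant P V T s q (t - s) (t - s + q) +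
          autoCov P V T s t * autoCov P V T (s + q) (t + q) +
          autoCov P V T s (t + q) * autoCov P V T (s + q) t := by
      intro s t
      have e1 : s + (t - s) = t := by ring
      have e2 : s + (t - s + q) = t + q := by ring
      rw [fourthCumulant, e1, e2]
      have e3 : ∫ x, centered P V T s x * centered P V T (s + q) x * centered P V T t x *
          centered P V T (t + q) x ∂P = ∫ x, centered P V T s x * centered P V T (s + q) x *
        (centered P V T t x * centered P V T (t + q) x) ∂P := by
        simp only [mul_assoc]
      rw [e3, integral_sub_mul_sub (h.mul_memLp T s (s + q)) (h.mul_memLp T t (t + q))]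
      have a1 : ∫ x, centered P V T s x * centered P V T (s + q) x ∂P = autoCov P V T s (s + q) :=
        rfl
      have a2 : ∫ x, centered P V T t x * centered P V T (t + q) x ∂P = autoCov P V T t (t + q) :=
        rfl
      rw [a1, a2]
      ring
    simp_rw [hterm]
    have hrow : ∀ s ∈ J, ∑ t ∈ J, (fourthCumulant P V T s q (t - s) (t - s + q) +
          autoCov P V T s t * autoCov P V T (s + q) (t + q) +
          autoCov P V T s (t + q) * autoCov P V T (s + q) t) ≤ 2 * D₁ + D₂ := by
      intro s _
      have h1 := hcum T q s J hT
      have h2 := hcov T s J hT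
      have h3 := hcov' T (s + q) q J hT
      have h4 := hcov' T s q J hT
      have h5 := hcov T (s + q) J hT
      calc _ ≤ ∑ t ∈ J, (|fourthCumulant P V T s q (t - s) (t - s + q)| +
            (1 / 2) * (autoCov P V T s t ^ 2 + autoCov P V T (s + q) (t + q) ^ 2 +
              autoCov P V T s (t + q) ^ 2 + autoCov P V T (s + q) t ^ 2)) := by
            refine Finset.sum_le_sum fun t _ => ?_
            have := le_abs_self (fourthCumulant P V T s q (t - s) (t - s + q))
            nlinarith [sq_nonneg (autoCov P V T s t - autoCov P V T (s + q) (t + q)),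
              sq_nonneg (autoCov P V T s (t + q) - autoCov P V T (s + q) t)]
        _ ≤ 2 * D₁ + D₂ := by
            rw [Finset.sum_add_distrib, ← Finset.mul_sum, Finset.sum_add_distrib,
              Finset.sum_add_distrib, Finset.sum_add_distrib]
            linarith
    calc _ ≤ ∑ s ∈ J, (2 * D₁ + D₂) := Finset.sum_le_sum hrow
      _ = (2 * D₁ + D₂) * J.card := by rw [Finset.sum_const, nsmul_eq_mul, mul_comm]
  · intro T J a B hT ha
    have hmem : ∀ s, MemLp (centered P V T s) 2 P := fun s =>
      (h.centered_memLp T s).mono_exponent (by norm_num)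
    have e1 : ∫ x, (∑ s ∈ J, a s * centered P V T s x) ^ 2 ∂P =
        ∑ p ∈ J ×ˢ J, a p.1 * a p.2 * autoCov P V T p.1 p.2 := by
      rw [integral_sum_sq fun s _ => (hmem s).const_mul _, Finset.sum_product]
      refine Finset.sum_congr rfl fun s _ => Finset.sum_congr rfl fun t _ => ?_
      rw [autoCov, ← integral_const_mul]
      congr 1 with x
      ring
    rw [e1]
    -- The bound `1/(1 + |s - t|)` on covariances is square summable but not summable.
    -- Cauchy–Schwarz over pairs therefore gives a variance of order `|J|^{3/2}` only, which still
    -- vanishes after division by `|J|²`.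
    have e2 : (∑ p ∈ J ×ˢ J, a p.1 * a p.2 * autoCov P V T p.1 p.2) ^ 2 ≤
        (∑ p ∈ J ×ˢ J, (a p.1 * a p.2) ^ 2) * ∑ p ∈ J ×ˢ J, autoCov P V T p.1 p.2 ^ 2 :=
      Finset.sum_mul_sq_le_sq_mul_sq _ _ _
    have e3 : ∑ p ∈ J ×ˢ J, (a p.1 * a p.2) ^ 2 ≤ B ^ 4 * (J.card : ℝ) ^ 2 := by
      have : ∀ p ∈ J ×ˢ J, (a p.1 * a p.2) ^ 2 ≤ B ^ 4 := by
        intro p hp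
        rw [Finset.mem_product] at hp
        have h1 := ha _ hp.1
        have h2 := ha _ hp.2
        rw [← sq_abs, abs_mul]
        have hB : 0 ≤ B := (abs_nonneg _).trans h1
        calc (|a p.1| * |a p.2|) ^ 2 ≤ (B * B) ^ 2 :=
              pow_le_pow_left₀ (by positivity) (mul_le_mul h1 h2 (abs_nonneg _) hB) 2
          _ = B ^ 4 := by ring
      refine (Finset.sum_le_sum this).trans (le_of_eq ?_)
      rw [Finset.sum_const, Finset.card_product, nsmul_eq_mul]
      push_cast
      ring
    have e4 : ∑ p ∈ J ×ˢ J, autoCov P V T p.1 p.2 ^ 2 ≤ J.card * D₁ := by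
      rw [Finset.sum_product]
      refine (Finset.sum_le_sum fun s _ => hcov T s J hT).trans (le_of_eq ?_)
      rw [Finset.sum_const, nsmul_eq_mul]
    calc _ ≤ _ := e2
      _ ≤ (B ^ 4 * (J.card : ℝ) ^ 2) * (J.card * D₁) :=
          mul_le_mul e3 e4 (Finset.sum_nonneg fun _ _ => sq_nonneg _) (by positivity)
      _ = B ^ 4 * D₁ * (J.card : ℝ) ^ 3 := by ring
      _ ≤ B ^ 4 * (2 * D₁ + D₂) * (J.card : ℝ) ^ 3 := by gcongr; linarith

end Variance

/-! ### A strong law along a sparse grid -/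

section AlmostSure

variable {Ω : Type*} [MeasurableSpace Ω] {P : Measure Ω}

/-- By Tonelli the series of the functions has finite integral, so it converges almost everywhere
and its terms vanish. -/
lemma ae_tendsto_zero_of_summable_integral {f : ℕ → Ω → ℝ} (h0 : ∀ n x, 0 ≤ f n x)
    (hi : ∀ n, Integrable (f n) P) (hs : Summable fun n => ∫ x, f n x ∂P) :
    ∀ᵐ x ∂P, Tendsto (fun n => f n x) atTop (𝓝 0) := by
  have h1 : ∫⁻ x, ∑' n, ENNReal.ofReal (f n x) ∂P ≠ ∞ := by
    rw [lintegral_tsum fun n => (hi n).1.aemeasurable.ennreal_ofReal]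
    simp_rw [← fun n => ofReal_integral_eq_lintegral_ofReal (hi n) (ae_of_all _ (h0 n))]
    rw [← ENNReal.ofReal_tsum_of_nonneg (fun n => integral_nonneg (h0 n)) hs]
    exact ENNReal.ofReal_ne_top
  have h2 := ae_lt_top' (AEMeasurable.tsum fun n => (hi n).1.aemeasurable.ennreal_ofReal) h1
  filter_upwards [h2] with x hx
  have h3 := ENNReal.tendsto_atTop_zero_of_tsum_ne_top hx.ne
  have h4 := (ENNReal.tendsto_toReal ENNReal.zero_ne_top).comp h3
  simpa [Function.comp_def, ENNReal.toReal_ofReal (h0 _ x)] using h4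

/-- The grid `⌊i^{3/2}⌋`. -/
def grid (i : ℕ) : ℕ := Nat.sqrt (i ^ 3)

/-- Makes `T` a sufficient search range in `gridIndex`, and sends the grid to infinity. -/
lemma le_grid (i : ℕ) : i ≤ grid i := by
  rw [grid, Nat.le_sqrt]
  rcases Nat.eq_zero_or_pos i with rfl | hi
  · simp
  · calc i * i = i * i * 1 := by ring
      _ ≤ i * i * i := Nat.mul_le_mul_left _ hi
      _ = i ^ 3 := by ring

/-- The index of the largest grid point up to `T`. -/
def gridIndex (T : ℕ) : ℕ := Nat.findGreatest (fun i => grid i ≤ T) T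

lemma grid_gridIndex_le (T : ℕ) : grid (gridIndex T) ≤ T :=
  Nat.findGreatest_spec (P := fun i => grid i ≤ T) (Nat.zero_le T) (by simp [grid])

lemma lt_grid_gridIndex_succ (T : ℕ) : T < grid (gridIndex T + 1) := by
  by_contra! h
  have h1 : gridIndex T + 1 ≤ T := (le_grid _).trans h
  exact Nat.findGreatest_is_greatest (P := fun i => grid i ≤ T) (Nat.lt_succ_self _) h1 h

lemma tendsto_gridIndex : Tendsto gridIndex atTop atTop := by
  refine tendsto_atTop.2 fun k => ?_
  filter_upwards [eventually_ge_atTop (grid k)] with T hT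
  exact Nat.le_findGreatest ((le_grid k).trans hT) hT

/-- Neighbours in the grid `i^{3/2}` differ by order `i^{1/2}`, that is `T^{1/3}`; the cube keeps
the statement in the natural numbers. -/
lemma grid_gap (T : ℕ) : (T - grid (gridIndex T)) ^ 3 ≤ 216 * (T + 1) := by
  set i := gridIndex T with hi
  set S := grid i with hS
  have hST : S ≤ T := grid_gridIndex_le T
  have h1 : i ^ 3 + 1 ≤ (S + 1) ^ 2 := by
    have := Nat.lt_succ_sqrt (i ^ 3)
    rw [hS, grid, sq]
    exact this
  have h2 : (T + 1) ^ 2 ≤ (i + 1) ^ 3 := by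
    have := lt_grid_gridIndex_succ T
    rw [← hi, grid, Nat.lt_iff_add_one_le, Nat.le_sqrt'] at this
    exact this
  obtain ⟨D, hD⟩ := Nat.exists_eq_add_of_le hST
  rw [show T - S = D by omega]
  rcases Nat.eq_zero_or_pos i with h0 | h0
  · rw [h0] at h2
    have : T = 0 := by nlinarith
    have : D = 0 := by omega
    simp [this]
  · have h3 : D * (T + 1) ≤ 6 * i ^ 2 := by
      have e1 : (T + 1) ^ 2 = (S + 1) ^ 2 + D * (T + S + 2) := by rw [hD]; ring
      have e2 : D * (T + 1) ≤ D * (T + S + 2) := Nat.mul_le_mul_left _ (by omega)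
      nlinarith
    have h4 : i ^ 3 ≤ (T + 1) ^ 2 := by
      have : (S + 1) ^ 2 ≤ (T + 1) ^ 2 := Nat.pow_le_pow_left (by omega) 2
      omega
    have h5 : D ^ 3 * (T + 1) ^ 3 ≤ 216 * (T + 1) * (T + 1) ^ 3 := by
      calc D ^ 3 * (T + 1) ^ 3 = (D * (T + 1)) ^ 3 := by ring
        _ ≤ (6 * i ^ 2) ^ 3 := Nat.pow_le_pow_left h3 3
        _ = 216 * (i ^ 3) ^ 2 := by ring
        _ ≤ 216 * ((T + 1) ^ 2) ^ 2 := Nat.mul_le_mul_left _ (Nat.pow_le_pow_left h4 2)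
        _ = 216 * (T + 1) * (T + 1) ^ 3 := by ring
    exact Nat.le_of_mul_le_mul_right h5 (by positivity)

lemma summable_inv_grid : Summable fun i => 1 / (grid i : ℝ) := by
  have h := (Real.summable_nat_rpow_inv (p := 3 / 2)).2 (by norm_num)
  refine Summable.of_norm_bounded_eventually_nat (h.mul_left 2) ?_
  filter_upwards [eventually_ge_atTop 1] with i hi
  have hi' : (0 : ℝ) < i := by exact_mod_cast hi
  have h1 : (1 : ℝ) ≤ grid i := by exact_mod_cast hi.trans (le_grid i)
  have h2 : ((i : ℝ) ^ (3 / 2 : ℝ)) ≤ grid i + 1 := by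
    have e : (i : ℝ) ^ 3 ≤ (grid i + 1) ^ 2 := by
      have := (Nat.lt_succ_sqrt (i ^ 3)).le
      rw [← sq] at this
      rw [grid]
      exact_mod_cast this
    have e2 : ((i : ℝ) ^ (3 / 2 : ℝ)) ^ 2 = (i : ℝ) ^ 3 := by
      rw [← Real.rpow_natCast, ← Real.rpow_mul hi'.le, ← Real.rpow_natCast]
      norm_num
    rw [← e2] at e
    exact (abs_le_of_sq_le_sq' e (by positivity)).2
  rw [Real.norm_of_nonneg (by positivity)]
  have h3 : (0 : ℝ) < (i : ℝ) ^ (3 / 2 : ℝ) := by positivity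
  rw [← div_eq_mul_inv, div_le_div_iff₀ (by linarith) h3]
  linarith

/-- Relative gaps are `O(T^{-2/3})`, with summable squares of order `T^{-4/3}`. The grid exponent
`3/2` exceeds `1`, so that reciprocals of grid points are summable, and is below `2`, as needed
here. -/
lemma summable_grid_gap : Summable fun T : ℕ =>
    (((T : ℝ) - grid (gridIndex T) + 1) / T) ^ 2 := by
  have h := (Real.summable_nat_rpow_inv (p := 4 / 3)).2 (by norm_num)
  refine Summable.of_norm_bounded_eventually_nat (h.mul_left (2000 ^ (2 / 3 : ℝ))) ?_
  filter_upwards [eventually_ge_atTop 1] with T hT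
  have hT' : (1 : ℝ) ≤ T := by exact_mod_cast hT
  rw [Real.norm_of_nonneg (by positivity)]
  obtain ⟨D, hD⟩ := Nat.exists_eq_add_of_le (grid_gridIndex_le T)
  have hgap := grid_gap T
  rw [show T - grid (gridIndex T) = D by omega] at hgap
  have e0 : (T : ℝ) - grid (gridIndex T) = D := by
    have : (T : ℝ) = grid (gridIndex T) + D := by exact_mod_cast hD
    linarith
  rw [e0]
  have e1 : ((D : ℝ) + 1) ^ 3 ≤ 2000 * T := by
    have e2 : (D : ℝ) ^ 3 ≤ 216 * (T + 1) := by exact_mod_cast hgap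
    have hD0 : (0 : ℝ) ≤ D := Nat.cast_nonneg D
    nlinarith [mul_nonneg (add_nonneg hD0 zero_le_one) (sq_nonneg ((D : ℝ) - 1))]
  have e3 : (D : ℝ) + 1 ≤ (2000 * T) ^ (1 / 3 : ℝ) := by
    have := Real.rpow_le_rpow (by positivity) e1 (show (0 : ℝ) ≤ 1 / 3 by norm_num)
    rw [← Real.rpow_natCast, ← Real.rpow_mul (by positivity)] at this
    norm_num at this
    norm_num
    exact this
  have e4 : ((D : ℝ) + 1) ^ 2 ≤ 2000 ^ (2 / 3 : ℝ) * (T : ℝ) ^ (2 / 3 : ℝ) := by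
    refine (pow_le_pow_left₀ (by positivity) e3 2).trans (le_of_eq ?_)
    rw [← Real.rpow_natCast, ← Real.rpow_mul (by positivity),
      Real.mul_rpow (by norm_num) (by positivity)]
    norm_num
  rw [div_pow, div_le_iff₀ (by positivity)]
  refine e4.trans (le_of_eq ?_)
  rw [mul_assoc]
  congr 1
  rw [← Real.rpow_natCast (T : ℝ) 2, ← Real.rpow_neg (by positivity),
    ← Real.rpow_add (by positivity)]
  norm_num

/-- A strong law for arrays: variances of order `T` and mean square increments of order
`(T - S)²` suffice for almost sure convergence. -/
theorem ae_tendsto_div_of_moments {G : ℕ → Ω → ℝ} {C : ℝ} (hm : ∀ T, MemLp (G T) 2 P)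
    (h1 : ∀ T : ℕ, 1 ≤ T → ∫ x, G T x ^ 2 ∂P ≤ C * T)
    (h2 : ∀ S T : ℕ, 1 ≤ S → S ≤ T → T ≤ 2 * S →
      ∫ x, (G T x - G S x) ^ 2 ∂P ≤ C * ((T : ℝ) - S + 1) ^ 2) :
    ∀ᵐ x ∂P, Tendsto (fun T : ℕ => G T x / T) atTop (𝓝 0) := by
  have hi1 : ∀ i, Integrable (fun x => (G (grid i) x / grid i) ^ 2) P := fun i => by
    simp_rw [div_pow]
    exact (hm _).integrable_sq.div_const _
  have hi2 : ∀ T : ℕ, Integrable (fun x => ((G T x - G (grid (gridIndex T)) x) / T) ^ 2) P :=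
    fun T => by
      simp_rw [div_pow]
      exact (((hm _).sub (hm _)).integrable_sq).div_const _
  have s1 : Summable fun i => ∫ x, (G (grid i) x / grid i) ^ 2 ∂P := by
    refine Summable.of_norm_bounded_eventually_nat (summable_inv_grid.mul_left C) ?_
    filter_upwards [eventually_ge_atTop 1] with i hi
    have hg : 1 ≤ grid i := hi.trans (le_grid i)
    have hg' : (0 : ℝ) < grid i := by exact_mod_cast hg
    rw [Real.norm_of_nonneg (integral_nonneg fun x => sq_nonneg _)]
    simp_rw [div_pow]
    rw [integral_div, div_le_iff₀ (by positivity)]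
    refine (h1 _ hg).trans (le_of_eq ?_)
    field_simp
  have s2 : Summable fun T : ℕ => ∫ x, ((G T x - G (grid (gridIndex T)) x) / T) ^ 2 ∂P := by
    refine Summable.of_norm_bounded_eventually_nat (summable_grid_gap.mul_left C) ?_
    -- If `T` exceeded twice the preceding grid point, the gap bound would give `(T + 1)² ≤ 1728`,
    -- which fails from `50` on. This secures the condition `T ≤ 2S` of the increment bound.
    filter_upwards [eventually_ge_atTop 50] with T hT
    have hT' : (0 : ℝ) < T := by exact_mod_cast (by omega : 0 < T)
    rw [Real.norm_of_nonneg (integral_nonneg fun x => sq_nonneg _)]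
    simp_rw [div_pow]
    rw [integral_div, ← mul_div_assoc]
    refine div_le_div_of_nonneg_right ?_ (by positivity)
    have hle := grid_gridIndex_le T
    have hgap := grid_gap T
    have h3 : T ≤ 2 * grid (gridIndex T) := by
      by_contra! hlt
      obtain ⟨D, hD⟩ := Nat.exists_eq_add_of_le hle
      rw [show T - grid (gridIndex T) = D by omega] at hgap
      have hTD : T + 1 ≤ 2 * D := by omega
      have h5 : (T + 1) ^ 3 ≤ (2 * D) ^ 3 := Nat.pow_le_pow_left hTD 3
      have h6 : (T + 1) ^ 3 ≤ 1728 * (T + 1) := by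
        calc _ ≤ _ := h5
          _ = 8 * D ^ 3 := by ring
          _ ≤ _ := by omega
      have h7 : (T + 1) ^ 2 * (T + 1) ≤ 1728 * (T + 1) := by
        calc _ = (T + 1) ^ 3 := by ring
          _ ≤ _ := h6
      have h8 := Nat.le_of_mul_le_mul_right h7 (by omega)
      nlinarith
    exact h2 _ _ (by omega) hle h3
  filter_upwards [ae_tendsto_zero_of_summable_integral (fun _ _ => sq_nonneg _) hi1 s1,
    ae_tendsto_zero_of_summable_integral (fun _ _ => sq_nonneg _) hi2 s2] with x hx1 hx2
  have ha : Tendsto (fun i => |G (grid i) x / grid i|) atTop (𝓝 0) := by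
    have := hx1.sqrt
    simpa [Real.sqrt_sq_eq_abs] using this
  have hb : Tendsto (fun T : ℕ => |(G T x - G (grid (gridIndex T)) x) / T|) atTop (𝓝 0) := by
    have := hx2.sqrt
    simpa only [Real.sqrt_sq_eq_abs, Real.sqrt_zero] using this
  have hc := hb.add (ha.comp tendsto_gridIndex)
  rw [add_zero] at hc
  refine squeeze_zero_norm' ?_ hc
  filter_upwards [tendsto_gridIndex.eventually_ge_atTop 1] with T hT
  have hS : 1 ≤ grid (gridIndex T) := hT.trans (le_grid _)
  have hS' : (0 : ℝ) < grid (gridIndex T) := by exact_mod_cast hS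
  have hST : (grid (gridIndex T) : ℝ) ≤ T := by exact_mod_cast grid_gridIndex_le T
  -- The first term vanishes by the gap estimate; the second is at most `|G_S / S|` at the preceding
  -- grid point `S ≤ T`.
  have e : G T x / T = (G T x - G (grid (gridIndex T)) x) / T + G (grid (gridIndex T)) x / T := by
    ring
  rw [e]
  refine (norm_add_le _ _).trans (add_le_add le_rfl ?_)
  simp only [Function.comp, Real.norm_eq_abs, abs_div]
  rw [abs_of_pos hS', abs_of_pos (hS'.trans_le hST)]
  gcongr

end AlmostSure

/-! ### The strong law for lagged products of the array -/

section StrongLaw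

variable {Ω : Type*} [MeasurableSpace Ω] {P : Measure Ω}
  {m : ℕ} {lam : Fin (m + 2) → ℝ} {A : ℝ → ℝ → ℂ} {μ : Fin (m + 1) → ℝ → ℝ} {V : ℕ → ℕ → Ω → ℝ}
  {C D : ℝ}

lemma integrable_pow_four {X : Ω → ℝ} (hX : MemLp X 4 P) : Integrable (fun x => X x ^ 4) P := by
  have := hX.integrable_norm_pow (p := 4) (by norm_num)
  simpa [Real.norm_eq_abs, Even.pow_abs (show Even 4 by decide)] using this

/-- Minkowski's inequality for sums of square integrable functions. -/
lemma integral_sum_sq_le {ι : Type*} {J : Finset ι} {W : ι → Ω → ℝ} {w : ι → ℝ}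
    (hW : ∀ i ∈ J, MemLp (W i) 2 P) (hw : ∀ i ∈ J, 0 < w i)
    (h : ∀ i ∈ J, ∫ x, W i x ^ 2 ∂P ≤ w i ^ 2) :
    ∫ x, (∑ i ∈ J, W i x) ^ 2 ∂P ≤ (∑ i ∈ J, w i) ^ 2 := by
  -- Cauchy–Schwarz with weights `w i`; integrating it gives Minkowski's bound without square roots,
  -- at the price of strictly positive weights.
  have h1 : ∀ x, (∑ i ∈ J, W i x) ^ 2 ≤ (∑ i ∈ J, w i) * ∑ i ∈ J, W i x ^ 2 / w i := by
    intro x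
    refine Finset.sum_sq_le_sum_mul_sum_of_sq_le_mul J (fun i hi => (hw i hi).le)
      (fun i hi => div_nonneg (sq_nonneg _) (hw i hi).le) fun i hi => ?_
    have := (hw i hi).ne'
    refine le_of_eq ?_
    field_simp
  have hi : ∀ i ∈ J, Integrable (fun x => W i x ^ 2 / w i) P := fun i hi =>
    (hW i hi).integrable_sq.div_const _
  refine (integral_mono_of_nonneg (ae_of_all _ fun x => sq_nonneg _)
    ((integrable_finsetSum _ hi).const_mul _) (ae_of_all _ h1)).trans ?_
  rw [integral_const_mul, integral_finsetSum _ hi, sq]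
  refine mul_le_mul_of_nonneg_left (Finset.sum_le_sum fun i hi => ?_)
    (Finset.sum_nonneg fun i hi => (hw i hi).le)
  rw [integral_div, div_le_iff₀ (hw i hi), ← sq]
  exact h i hi

lemma integral_sub_const_sq_le [IsProbabilityMeasure P] {f : Ω → ℝ} (hf : MemLp f 2 P) :
    ∫ x, (f x - ∫ y, f y ∂P) ^ 2 ∂P ≤ ∫ x, f x ^ 2 ∂P := by
  simp_rw [sq]
  rw [integral_sub_mul_sub hf hf]
  nlinarith [sq_nonneg (∫ y, f y ∂P)]

/-- Write `ab - cd = (a - c) b + c (b - d)`. Weighting Young's inequality by `δ²` separates each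
squared product into fourth powers, so that the `δ⁴` of the increments and the `1` of the other
factors combine to `δ²`. -/
lemma integral_mul_sub_mul_sq_le {a b c d : Ω → ℝ} {δ : ℝ} (hδ : 0 < δ) (ha : MemLp a 4 P)
    (hb : MemLp b 4 P) (hc : MemLp c 4 P) (hd : MemLp d 4 P)
    (hac : ∫ x, (a x - c x) ^ 4 ∂P ≤ C * δ ^ 4) (hbd : ∫ x, (b x - d x) ^ 4 ∂P ≤ C * δ ^ 4)
    (hbC : ∫ x, b x ^ 4 ∂P ≤ C) (hcC : ∫ x, c x ^ 4 ∂P ≤ C) :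
    ∫ x, (a x * b x - c x * d x) ^ 2 ∂P ≤ 4 * C * δ ^ 2 := by
  have i1 : Integrable (fun x => (a x - c x) ^ 4 / δ ^ 2) P :=
    (integrable_pow_four (ha.sub hc)).div_const _
  have i2 : Integrable (fun x => (b x - d x) ^ 4 / δ ^ 2) P :=
    (integrable_pow_four (hb.sub hd)).div_const _
  have i3 : Integrable (fun x => δ ^ 2 * b x ^ 4) P := (integrable_pow_four hb).const_mul _
  have i4 : Integrable (fun x => δ ^ 2 * c x ^ 4) P := (integrable_pow_four hc).const_mul _
  have i12 : Integrable (fun x => (a x - c x) ^ 4 / δ ^ 2 + (b x - d x) ^ 4 / δ ^ 2) P := i1.add i2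
  have i34 : Integrable (fun x => δ ^ 2 * b x ^ 4 + δ ^ 2 * c x ^ 4) P := i3.add i4
  have key : ∀ p q : ℝ, 2 * (p ^ 2 * q ^ 2) ≤ p ^ 4 / δ ^ 2 + δ ^ 2 * q ^ 4 := by
    intro p q
    have e : p ^ 4 / δ ^ 2 + δ ^ 2 * q ^ 4 - 2 * (p ^ 2 * q ^ 2) = (p ^ 2 / δ - δ * q ^ 2) ^ 2 := by
      field_simp
      ring
    nlinarith [sq_nonneg (p ^ 2 / δ - δ * q ^ 2)]
  refine (integral_mono_of_nonneg (ae_of_all _ fun x => sq_nonneg _) (i12.add i34)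
    (ae_of_all _ fun x => ?_)).trans ?_
  · have h1 := key (a x - c x) (b x)
    have h2 := key (b x - d x) (c x)
    simp only [Pi.add_apply]
    nlinarith [sq_nonneg ((a x - c x) * b x - c x * (b x - d x))]
  · simp only [Pi.add_apply]
    rw [integral_add i12 i34, integral_add i1 i2, integral_add i3 i4, integral_div, integral_div,
      integral_const_mul, integral_const_mul]
    have h1 : (∫ x, (a x - c x) ^ 4 ∂P) / δ ^ 2 ≤ C * δ ^ 2 := by
      rw [div_le_iff₀ (by positivity)]
      exact hac.trans_eq (by ring)
    have h2 : (∫ x, (b x - d x) ^ 4 ∂P) / δ ^ 2 ≤ C * δ ^ 2 := by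
      rw [div_le_iff₀ (by positivity)]
      exact hbd.trans_eq (by ring)
    nlinarith [sq_nonneg δ]

/-- The dates that belong to different regimes in samples of sizes `S ≤ T`. -/
def shifted (lam : Fin (m + 2) → ℝ) (S T : ℕ) : Finset ℤ :=
  Finset.univ.biUnion fun i => Finset.Ioc ⌊(S : ℝ) * lam i⌋ ⌊(T : ℝ) * lam i⌋

lemma card_Ioc_floor_le {c : ℝ} (hc : 0 ≤ c) {S T : ℕ} (hST : S ≤ T) :
    ((Finset.Ioc ⌊(S : ℝ) * c⌋ ⌊(T : ℝ) * c⌋).card : ℝ) ≤ (c + 1) * ((T : ℝ) - S + 1) := by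
  have hST' : (S : ℝ) ≤ T := by exact_mod_cast hST
  have h0 : ⌊(S : ℝ) * c⌋ ≤ ⌊(T : ℝ) * c⌋ := Int.floor_le_floor (by gcongr)
  rw [Int.card_Ioc]
  have : (((⌊(T : ℝ) * c⌋ - ⌊(S : ℝ) * c⌋).toNat : ℕ) : ℝ) =
      ((⌊(T : ℝ) * c⌋ - ⌊(S : ℝ) * c⌋ : ℤ) : ℝ) := by
    exact_mod_cast Int.toNat_of_nonneg (sub_nonneg.2 h0)
  rw [this]
  push_cast
  have h1 := Int.floor_le ((T : ℝ) * c)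
  have h2 := Int.lt_floor_add_one ((S : ℝ) * c)
  nlinarith

lemma lam_mem_Icc (hlam : IsBreakFractions lam) (i : Fin (m + 2)) : lam i ∈ Icc (0 : ℝ) 1 := by
  constructor
  · rw [← hlam.first]
    exact hlam.strictMono.monotone (Fin.zero_le _)
  · rw [← hlam.last]
    exact hlam.strictMono.monotone (Fin.le_last _)

lemma card_shifted_le (hlam : IsBreakFractions lam) {S T : ℕ} (hST : S ≤ T) :
    ((shifted lam S T).card : ℝ) ≤ 2 * (m + 2) * ((T : ℝ) - S + 1) := by
  have hST' : (S : ℝ) ≤ T := by exact_mod_cast hST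
  have h1 : ((shifted lam S T).card : ℝ) ≤
      ∑ i : Fin (m + 2), ((Finset.Ioc ⌊(S : ℝ) * lam i⌋ ⌊(T : ℝ) * lam i⌋).card : ℝ) := by
    exact_mod_cast Finset.card_biUnion_le
  refine h1.trans ((Finset.sum_le_sum (g := fun _ => 2 * ((T : ℝ) - S + 1)) fun i _ => ?_).trans
    (le_of_eq ?_))
  · have := lam_mem_Icc hlam i
    refine (card_Ioc_floor_le this.1 hST).trans ?_
    nlinarith [this.2]
  · rw [Finset.sum_const, Finset.card_univ, Fintype.card_fin, nsmul_eq_mul]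
    push_cast
    ring

/-- A sample date outside `shifted` lies in the same regime for both sample sizes, so only the
rescaled time moves, by at most `(T - S)/S`. The condition `T ≤ 2S` trades `1/S` for `2/T`. Dates
beyond both samples contribute zero. -/
lemma MomentBounds.integral_increment_le (h : MomentBounds P lam A μ V C)
    (hlam : IsBreakFractions lam) {S T : ℕ} (hS : 1 ≤ S) (hST : S ≤ T) (hTS : T ≤ 2 * S) {t : ℤ}
    (ht : t ∉ shifted lam S T) :
    ∫ x, (centered P V T t x - centered P V S t x) ^ 4 ∂P ≤
      C * (3 * ((T : ℝ) - S + 1) / T) ^ 4 := by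
  have hC := h.nonneg
  have hS' : (1 : ℝ) ≤ S := by exact_mod_cast hS
  have hST' : (S : ℝ) ≤ T := by exact_mod_cast hST
  have hTS' : (T : ℝ) ≤ 2 * S := by exact_mod_cast hTS
  by_cases h1 : 1 ≤ t ∧ t ≤ (T : ℤ)
  · obtain ⟨j, hj⟩ := exists_dates hlam h1.1 h1.2
    have hj' : t ∈ dates lam S j := by
      constructor
      · refine lt_of_le_of_lt (Int.floor_le_floor ?_) hj.1
        have := (lam_mem_Icc hlam j.castSucc).1
        gcongr
      · by_contra! hcon
        apply ht
        simp only [shifted, Finset.mem_biUnion, Finset.mem_univ, true_and, Finset.mem_Ioc]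
        exact ⟨j.succ, hcon, hj.2⟩
    refine (h.increment T S j t (hS.trans hST) hS hj hj').trans ?_
    refine mul_le_mul_of_nonneg_left (pow_le_pow_left₀ (by positivity) ?_ 4) hC
    have ht0 : (0 : ℝ) ≤ t := by exact_mod_cast (by omega : (0 : ℤ) ≤ t)
    have htT : (t : ℝ) ≤ T := by exact_mod_cast h1.2
    have e1 : |(t : ℝ) / T - t / S| = t / T * ((T - S) / S) := by
      rw [abs_sub_comm, abs_of_nonneg]
      · have hS0 : (S : ℝ) ≠ 0 := by linarith
        have hT0 : (T : ℝ) ≠ 0 := by linarith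
        field_simp
      · rw [sub_nonneg]
        gcongr
    have e2 : (t : ℝ) / T * ((T - S) / S) ≤ 1 * ((T - S) / S) := by
      refine mul_le_mul_of_nonneg_right ?_ (div_nonneg (by linarith) (by linarith))
      rw [div_le_one (by linarith)]
      exact htT
    have e3 : ∀ y : ℝ, 0 ≤ y → y / S ≤ 2 * y / T := by
      intro y hy
      rw [div_le_div_iff₀ (by linarith) (by linarith)]
      nlinarith
    have e4 := e3 ((T : ℝ) - S) (by linarith)
    have e5 := e3 1 zero_le_one
    have e6 : 3 * ((T : ℝ) - S + 1) / T = 2 * ((T : ℝ) - S) / T + 2 * 1 / T + 1 / T +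
        ((T : ℝ) - S) / T := by ring
    have e7 : 0 ≤ ((T : ℝ) - S) / T := div_nonneg (by linarith) (by linarith)
    rw [e1, e6]
    linarith
  · have h2 : ¬ (1 ≤ t ∧ t ≤ (S : ℤ)) := by omega
    rw [centered_eq_zero h1, centered_eq_zero h2]
    have : 0 ≤ (T : ℝ) - S + 1 := by linarith
    simp
    positivity

/-- Sums of lagged products over a segment of the sample obey the strong law. -/
theorem MomentBounds.ae_tendsto_quadratic [IsProbabilityMeasure P]
    (h : MomentBounds P lam A μ V C) (hD : VarianceBounds P V D) (hlam : IsBreakFractions lam)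
    {a b : ℝ} (ha : 0 ≤ a) (hb : 0 ≤ b) (q : ℤ) :
    ∀ᵐ x ∂P, Tendsto (fun T : ℕ => (∑ t ∈ Finset.Ioc ⌊(T : ℝ) * a⌋ ⌊(T : ℝ) * b⌋,
      (centered P V T t x * centered P V T (t + q) x - autoCov P V T t (t + q))) / T)
        atTop (𝓝 0) := by
  have hC := h.nonneg
  have hD0 := hD.nonneg
  set Z : ℕ → ℤ → Ω → ℝ := fun T t x =>
    centered P V T t x * centered P V T (t + q) x - autoCov P V T t (t + q) with hZ
  have hZm : ∀ T t, MemLp (Z T t) 2 P := fun T t => (h.mul_memLp T t (t + q)).sub (memLp_const _)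
  have hZ0 : ∀ (T : ℕ) (t : ℤ), ¬ (1 ≤ t ∧ t ≤ (T : ℤ)) → Z T t = 0 := by
    intro T t ht
    ext x
    simp [hZ, centered_eq_zero ht, autoCov_eq_zero_left ht]
  have hZdiff : ∀ (S T : ℕ) (t : ℤ) (δ : ℝ), 0 < δ →
      ∫ x, (centered P V T t x - centered P V S t x) ^ 4 ∂P ≤ C * δ ^ 4 →
      ∫ x, (centered P V T (t + q) x - centered P V S (t + q) x) ^ 4 ∂P ≤ C * δ ^ 4 →
      ∫ x, (Z T t x - Z S t x) ^ 2 ∂P ≤ 4 * C * δ ^ 2 := by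
    intro S T t δ hδ h1 h2
    refine le_trans ?_ (integral_mul_sub_mul_sq_le hδ (h.centered_memLp T t)
      (h.centered_memLp T (t + q)) (h.centered_memLp S t) (h.centered_memLp S (t + q)) h1 h2
      (h.fourth _ _) (h.fourth _ _))
    have hint : ∀ T, Integrable (fun x => centered P V T t x * centered P V T (t + q) x) P :=
      fun T => (h.mul_memLp T t (t + q)).integrable one_le_two
    have e := integral_sub_const_sq_le ((h.mul_memLp T t (t + q)).sub (h.mul_memLp S t (t + q)))
    simp only [Pi.sub_apply] at e
    rw [integral_sub (hint T) (hint S)] at e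
    refine le_of_eq_of_le (integral_congr_ae (ae_of_all _ fun x => ?_)) e
    simp only [hZ, autoCov]
    ring
  have hZsq : ∀ T t, ∫ x, Z T t x ^ 2 ∂P ≤ C := by
    intro T t
    refine (integral_sub_const_sq_le (h.mul_memLp T t (t + q))).trans ?_
    have i1 := (integrable_pow_four (h.centered_memLp T t)).const_mul (1 / 2)
    have i2 := (integrable_pow_four (h.centered_memLp T (t + q))).const_mul (1 / 2)
    refine (integral_mono_of_nonneg (ae_of_all _ fun x => sq_nonneg _) (i1.add i2)
      (ae_of_all _ fun x => ?_)).trans ?_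
    · simp only [Pi.add_apply]
      nlinarith [sq_nonneg (centered P V T t x ^ 2 - centered P V T (t + q) x ^ 2)]
    · simp only [Pi.add_apply]
      rw [integral_add i1 i2, integral_const_mul, integral_const_mul]
      linarith [h.fourth T t, h.fourth T (t + q)]
  set I : ℕ → Finset ℤ := fun T => Finset.Ioc ⌊(T : ℝ) * a⌋ ⌊(T : ℝ) * b⌋ with hI
  have hsum : ∀ (T R : ℕ) x, T ≤ R → ∑ t ∈ I T, Z T t x =
      ∑ t ∈ Finset.Icc (1 : ℤ) R, if t ∈ I T then Z T t x else 0 := by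
    intro T R x hTR
    rw [← Finset.sum_filter]
    symm
    refine Finset.sum_subset_zero_on_sdiff ?_ ?_ fun _ _ => rfl
    · intro t ht
      exact (Finset.mem_filter.1 ht).2
    · intro t ht
      rw [Finset.mem_sdiff, Finset.mem_filter, Finset.mem_Icc] at ht
      rw [hZ0 T t (by
        intro hcon
        exact ht.2 ⟨⟨hcon.1, hcon.2.trans (by exact_mod_cast hTR)⟩, ht.1⟩)]
      rfl
  -- Root mean square changes are at most `K₁ Δ / T` at ordinary dates and `K₂` at exceptional ones,
  -- and there are at most `K₃ Δ` exceptional dates. The added `1` keeps the weights positive when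
  -- `C = 0`.
  set K₁ : ℝ := 3 * (2 * √C + 1) with hK₁
  set K₂ : ℝ := 2 * √C + 1 with hK₂
  set K₃ : ℝ := (a + 1) + (b + 1) + 2 * (2 * (m + 2)) with hK₃
  have hK₁0 : 0 < K₁ := by positivity
  have hK₂0 : 0 < K₂ := by positivity
  have hK₃0 : 0 < K₃ := by positivity
  have hCsq : √C ^ 2 = C := Real.sq_sqrt hC
  refine ae_tendsto_div_of_moments (G := fun T x => ∑ t ∈ I T, Z T t x)
    (C := D + (K₂ * K₃ + K₁) ^ 2) (fun T => memLp_finsetSum _ fun t _ => hZm T t) ?_ ?_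
  · intro T hT
    have h1 := hD.quadratic T q ((I T).filter fun t => 1 ≤ t ∧ t ≤ (T : ℤ)) hT
    have h2 : ∀ x, ∑ t ∈ I T, Z T t x = ∑ t ∈ (I T).filter (fun t => 1 ≤ t ∧ t ≤ (T : ℤ)),
        Z T t x := by
      intro x
      rw [Finset.sum_filter]
      refine Finset.sum_congr rfl fun t _ => ?_
      split_ifs with ht
      · rfl
      · rw [hZ0 T t ht]
        rfl
    simp_rw [h2]
    refine h1.trans ?_
    have hcard : (((I T).filter fun t => 1 ≤ t ∧ t ≤ (T : ℤ)).card : ℝ) ≤ T := by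
      have hsub : ((I T).filter fun t => 1 ≤ t ∧ t ≤ (T : ℤ)) ⊆ Finset.Icc (1 : ℤ) (T : ℤ) := by
        intro t ht
        simpa using (Finset.mem_filter.1 ht).2
      have := Finset.card_le_card hsub
      simp at this
      exact_mod_cast this
    have hT' : (0 : ℝ) ≤ T := Nat.cast_nonneg T
    have := mul_le_mul_of_nonneg_left hcard hD0
    nlinarith [mul_nonneg (sq_nonneg (K₂ * K₃ + K₁)) hT']
  · intro S T hS hST hTS
    have hT : 1 ≤ T := hS.trans hST
    have hT' : (0 : ℝ) < T := by exact_mod_cast hT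
    have hST' : (S : ℝ) ≤ T := by exact_mod_cast hST
    set Δ : ℝ := (T : ℝ) - S + 1 with hΔ
    have hΔ0 : 0 < Δ := by linarith
    -- Exceptional dates enter or leave the summation range, or have `t` or `t + q` changing regime
    -- between `S` and `T`. They number `O(Δ)` with change `O(1)`; the at most `T` others change by
    -- `O(Δ / T)`, so Minkowski gives a total of `O(Δ)`.
    set bad : Finset ℤ := Finset.Ioc ⌊(S : ℝ) * a⌋ ⌊(T : ℝ) * a⌋ ∪
      Finset.Ioc ⌊(S : ℝ) * b⌋ ⌊(T : ℝ) * b⌋ ∪ shifted lam S T ∪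
        (shifted lam S T).image (fun t => t - q) with hbad
    have hbadcard : (bad.card : ℝ) ≤ K₃ * Δ := by
      have h1 := card_Ioc_floor_le ha hST
      have h2 := card_Ioc_floor_le hb hST
      have h3 := card_shifted_le hlam hST
      have h4 : bad.card ≤ (Finset.Ioc ⌊(S : ℝ) * a⌋ ⌊(T : ℝ) * a⌋).card +
          (Finset.Ioc ⌊(S : ℝ) * b⌋ ⌊(T : ℝ) * b⌋).card + (shifted lam S T).card +
          (shifted lam S T).card := by
        refine (Finset.card_union_le _ _).trans (add_le_add ?_ Finset.card_image_le)
        refine (Finset.card_union_le _ _).trans (add_le_add ?_ le_rfl)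
        exact Finset.card_union_le _ _
      have h5 : (bad.card : ℝ) ≤ (Finset.Ioc ⌊(S : ℝ) * a⌋ ⌊(T : ℝ) * a⌋).card +
          (Finset.Ioc ⌊(S : ℝ) * b⌋ ⌊(T : ℝ) * b⌋).card + (shifted lam S T).card +
          (shifted lam S T).card := by exact_mod_cast h4
      rw [hK₃]
      linarith
    set w : ℤ → ℝ := fun t => if t ∈ bad then K₂ else K₁ * (Δ / T) with hw
    have hmono : ∀ c : ℝ, 0 ≤ c → ⌊(S : ℝ) * c⌋ ≤ ⌊(T : ℝ) * c⌋ := fun c hc =>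
      Int.floor_le_floor (by gcongr)
    have hdiff : ∀ x, (∑ t ∈ I T, Z T t x) - ∑ t ∈ I S, Z S t x =
        ∑ t ∈ Finset.Icc (1 : ℤ) T, ((if t ∈ I T then Z T t x else 0) -
          if t ∈ I S then Z S t x else 0) := by
      intro x
      rw [hsum T T x le_rfl, hsum S T x hST, Finset.sum_sub_distrib]
    simp_rw [hdiff]
    have hitem : ∀ R t, MemLp (fun x => if t ∈ I R then Z R t x else 0) 2 P := by
      intro R t
      split_ifs
      · exact hZm R t
      · exact memLp_const 0
    have hmink := integral_sum_sq_le (P := P) (J := Finset.Icc (1 : ℤ) T)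
      (W := fun t x => (if t ∈ I T then Z T t x else 0) - if t ∈ I S then Z S t x else 0)
      (w := w) (fun t _ => (hitem T t).sub (hitem S t)) (fun t _ => by
        simp only [hw]
        split_ifs <;> positivity) (fun t _ => by
        simp only [hw]
        by_cases hb' : t ∈ bad
        · rw [if_pos hb']
          have hsq : ∀ R, ∫ x, (if t ∈ I R then Z R t x else 0) ^ 2 ∂P ≤ C := by
            intro R
            split_ifs
            · exact hZsq R t
            · simpa using hC
          have i1 := (hitem T t).integrable_sq.const_mul 2
          have i2 := (hitem S t).integrable_sq.const_mul 2
          refine (integral_mono_of_nonneg (ae_of_all _ fun x => sq_nonneg _) (i1.add i2)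
            (ae_of_all _ fun x => ?_)).trans ?_
          · simp only [Pi.add_apply]
            nlinarith [sq_nonneg ((if t ∈ I T then Z T t x else 0) +
              if t ∈ I S then Z S t x else 0)]
          · simp only [Pi.add_apply]
            rw [integral_add i1 i2, integral_const_mul, integral_const_mul, hK₂]
            nlinarith [hsq T, hsq S, Real.sqrt_nonneg C]
        · rw [if_neg hb']
          simp only [hbad, Finset.mem_union, not_or, Finset.mem_Ioc, Finset.mem_image] at hb'
          obtain ⟨⟨⟨hb1, hb2⟩, hb3⟩, hb4⟩ := hb'
          have hiff : t ∈ I T ↔ t ∈ I S := by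
            have := hmono a ha
            have := hmono b hb
            simp only [hI, Finset.mem_Ioc]
            omega
          by_cases hIS : t ∈ I S
          · have hIT := hiff.2 hIS
            simp only [hIS, hIT, if_true]
            have hq : t + q ∉ shifted lam S T := fun hcon => hb4 ⟨t + q, hcon, by ring⟩
            refine (hZdiff S T t _ (by positivity)
              (h.integral_increment_le hlam hS hST hTS hb3)
              (h.integral_increment_le hlam hS hST hTS hq)).trans ?_
            have e : 4 * C * (3 * ((T : ℝ) - S + 1) / T) ^ 2 = (3 * (2 * √C)) ^ 2 * (Δ / T) ^ 2 := by
              rw [mul_pow 3, mul_pow 2, hCsq, ← hΔ]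
              ring
            rw [e, mul_pow K₁]
            refine mul_le_mul_of_nonneg_right ?_ (by positivity)
            refine pow_le_pow_left₀ (by positivity) ?_ 2
            rw [hK₁]
            linarith
          · have hIT : t ∉ I T := fun hcon => hIS (hiff.1 hcon)
            simp only [hIS, hIT, if_false]
            simp
            positivity)
    refine hmink.trans ?_
    have hwsum : ∑ t ∈ Finset.Icc (1 : ℤ) T, w t ≤ (K₂ * K₃ + K₁) * Δ := by
      have h1 : ∀ t, w t ≤ (if t ∈ bad then K₂ else 0) + K₁ * (Δ / T) := by
        intro t
        have : 0 ≤ K₁ * (Δ / T) := by positivity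
        simp only [hw]
        split_ifs <;> linarith
      refine (Finset.sum_le_sum fun t _ => h1 t).trans ?_
      rw [Finset.sum_add_distrib, ← Finset.sum_filter, Finset.sum_const, Finset.sum_const,
        nsmul_eq_mul, nsmul_eq_mul, Int.card_Icc]
      have h2 : (((Finset.Icc (1 : ℤ) T).filter (· ∈ bad)).card : ℝ) ≤ bad.card := by
        have hsub : (Finset.Icc (1 : ℤ) T).filter (· ∈ bad) ⊆ bad := by
          intro t ht
          exact (Finset.mem_filter.1 ht).2
        exact_mod_cast Finset.card_le_card hsub
      have h3 : (((T : ℤ) + 1 - 1).toNat : ℝ) * (K₁ * (Δ / T)) = K₁ * Δ := by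
        rw [add_sub_cancel_right, Int.toNat_natCast]
        field_simp
      rw [h3]
      have := mul_le_mul_of_nonneg_right (h2.trans hbadcard) hK₂0.le
      linarith
    have hw0 : 0 ≤ ∑ t ∈ Finset.Icc (1 : ℤ) T, w t := by
      refine Finset.sum_nonneg fun t _ => ?_
      simp only [hw]
      split_ifs <;> positivity
    refine (pow_le_pow_left₀ hw0 hwsum 2).trans ?_
    rw [mul_pow]
    refine mul_le_mul_of_nonneg_right ?_ (by positivity)
    linarith

end StrongLaw

/-! ### Concentration of the sample local autocovariance -/

section LocalWindow

variable {Ω : Type*} [MeasurableSpace Ω] {P : Measure Ω}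
  {m : ℕ} {lam : Fin (m + 2) → ℝ} {A : ℝ → ℝ → ℂ} {μ : Fin (m + 1) → ℝ → ℝ} {V : ℕ → ℕ → Ω → ℝ}
  {C D : ℝ}

/-- The average of `f` over the window `c + 1, …, c + N`. -/
def winAvg (N : ℕ) (c : ℤ) (f : ℤ → ℝ) : ℝ := (N : ℝ)⁻¹ * ∑ r ∈ Finset.Ioc c (c + N), f r

lemma sum_range_eq_sum_Ioc (N : ℕ) (c : ℤ) (f : ℤ → ℝ) :
    ∑ s ∈ Finset.range N, f (c + s + 1) = ∑ r ∈ Finset.Ioc c (c + N), f r := by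
  refine Finset.sum_bij (fun s _ => c + s + 1) ?_ ?_ ?_ fun _ _ => rfl
  · intro s hs
    rw [Finset.mem_range] at hs
    rw [Finset.mem_Ioc]
    omega
  · intro a _ b _ hab
    omega
  · intro r hr
    rw [Finset.mem_Ioc] at hr
    exact ⟨(r - c - 1).toNat, Finset.mem_range.2 (by omega), by omega⟩

lemma winAvg_add (N : ℕ) (c : ℤ) (f g : ℤ → ℝ) :
    winAvg N c (fun r => f r + g r) = winAvg N c f + winAvg N c g := by
  simp only [winAvg, Finset.sum_add_distrib, mul_add]

lemma winAvg_sub (N : ℕ) (c : ℤ) (f g : ℤ → ℝ) :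
    winAvg N c (fun r => f r - g r) = winAvg N c f - winAvg N c g := by
  simp only [winAvg, Finset.sum_sub_distrib, mul_sub]

lemma winAvg_const_mul (N : ℕ) (c : ℤ) (a : ℝ) (f : ℤ → ℝ) :
    winAvg N c (fun r => a * f r) = a * winAvg N c f := by
  simp only [winAvg, ← Finset.mul_sum]
  ring

lemma winAvg_const {N : ℕ} (hN : 1 ≤ N) (c : ℤ) (a : ℝ) : winAvg N c (fun _ => a) = a := by
  have : (N : ℝ) ≠ 0 := by exact_mod_cast (by omega : N ≠ 0)
  simp only [winAvg, Finset.sum_const, Int.card_Ioc, nsmul_eq_mul, add_sub_cancel_left,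
    Int.toNat_natCast]
  field_simp

lemma winAvg_mono (N : ℕ) (c : ℤ) {f g : ℤ → ℝ} (h : ∀ r ∈ Finset.Ioc c (c + N), f r ≤ g r) :
    winAvg N c f ≤ winAvg N c g :=
  mul_le_mul_of_nonneg_left (Finset.sum_le_sum h) (by positivity)

lemma winAvg_congr (N : ℕ) (c : ℤ) {f g : ℤ → ℝ} (h : ∀ r ∈ Finset.Ioc c (c + N), f r = g r) :
    winAvg N c f = winAvg N c g := by
  rw [winAvg, winAvg, Finset.sum_congr rfl h]

lemma abs_winAvg_le {N : ℕ} (hN : 1 ≤ N) (c : ℤ) {f : ℤ → ℝ} {B : ℝ} (h : ∀ r, |f r| ≤ B) :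
    |winAvg N c f| ≤ B := by
  have h1 := winAvg_mono N c (f := f) (g := fun _ => B) fun r _ => (abs_le.1 (h r)).2
  have h2 := winAvg_mono N c (f := fun _ => -B) (g := f) fun r _ => (abs_le.1 (h r)).1
  rw [winAvg_const hN] at h1 h2
  exact abs_le.2 ⟨h2, h1⟩

/-- Jensen's inequality, read off from nonnegativity of the variance over the window. -/
lemma sq_winAvg_le {N : ℕ} (hN : 1 ≤ N) (c : ℤ) (f : ℤ → ℝ) :
    winAvg N c f ^ 2 ≤ winAvg N c (fun r => f r ^ 2) := by
  have h : winAvg N c (fun r => (f r - winAvg N c f) ^ 2) =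
      winAvg N c (fun r => f r ^ 2) - winAvg N c f ^ 2 := by
    have : ∀ r, (f r - winAvg N c f) ^ 2 =
        (f r ^ 2 - (2 * winAvg N c f) * f r) + winAvg N c f ^ 2 := fun r => by ring
    simp_rw [this]
    rw [winAvg_add, winAvg_sub, winAvg_const_mul, winAvg_const hN]
    ring
  have h0 := winAvg_mono N c (f := fun _ => 0) (g := fun r => (f r - winAvg N c f) ^ 2)
    fun r _ => sq_nonneg _
  rw [winAvg_const hN, h] at h0
  linarith

/-- The sample local autocovariance at a window `c + 1, …, c + N` and lag `2M`. -/
def winCov (N : ℕ) (c M : ℤ) (v : ℤ → ℝ) : ℝ :=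
  winAvg N c fun r => (v (r + M) - winAvg N c v) * (v (r - M) - winAvg N c v)

omit [MeasurableSpace Ω] in
lemma sampleLocalCov_eq (N T : ℕ) (u : ℝ) (k : ℤ) (x : Ω) :
    sampleLocalCov V N T u k x =
      winCov N (⌊(T : ℝ) * u⌋ - (N : ℤ) / 2) (|k| / 2) (fun t => obs V T t x) := by
  have h1 : localMean V N T ⌊(T : ℝ) * u⌋ x =
      winAvg N (⌊(T : ℝ) * u⌋ - (N : ℤ) / 2) (fun t => obs V T t x) := by
    rw [localMean, winAvg, ← sum_range_eq_sum_Ioc]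
  rw [sampleLocalCov, winCov, winAvg, h1, ← sum_range_eq_sum_Ioc]
  congr 1
  refine Finset.sum_congr rfl fun s _ => ?_
  rw [show ⌊(T : ℝ) * u⌋ + |k| / 2 - (N : ℤ) / 2 + s + 1 =
      ⌊(T : ℝ) * u⌋ - (N : ℤ) / 2 + s + 1 + |k| / 2 by ring,
    show ⌊(T : ℝ) * u⌋ - |k| / 2 - (N : ℤ) / 2 + s + 1 =
      ⌊(T : ℝ) * u⌋ - (N : ℤ) / 2 + s + 1 - |k| / 2 by ring]

/-- Expansion of the sample autocovariance of a sum of a trend and a noise. -/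
lemma winCov_add {N : ℕ} (hN : 1 ≤ N) (c M : ℤ) (a y : ℤ → ℝ) :
    winCov N c M (fun r => a r + y r) =
      winCov N c M a + winAvg N c (fun r => y (r + M) * y (r - M)) +
        winAvg N c (fun r => (a (r + M) - winAvg N c a) * y (r - M)) +
        winAvg N c (fun r => (a (r - M) - winAvg N c a) * y (r + M)) -
        winAvg N c y * (winAvg N c (fun r => a (r + M) - winAvg N c a) +
          winAvg N c (fun r => a (r - M) - winAvg N c a)) -
        winAvg N c y * (winAvg N c (fun r => y (r + M)) + winAvg N c (fun r => y (r - M))) +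
        winAvg N c y ^ 2 := by
  rw [winCov, winCov, winAvg_add]
  have : ∀ r, (a (r + M) + y (r + M) - (winAvg N c a + winAvg N c y)) *
      (a (r - M) + y (r - M) - (winAvg N c a + winAvg N c y)) =
      ((((((a (r + M) - winAvg N c a) * (a (r - M) - winAvg N c a) + y (r + M) * y (r - M)) +
        (a (r + M) - winAvg N c a) * y (r - M)) + (a (r - M) - winAvg N c a) * y (r + M)) -
        winAvg N c y * ((a (r + M) - winAvg N c a) + (a (r - M) - winAvg N c a))) -
        winAvg N c y * (y (r + M) + y (r - M))) + winAvg N c y ^ 2 := fun r => by ring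
  simp_rw [this]
  rw [winAvg_add, winAvg_sub, winAvg_sub, winAvg_add, winAvg_add, winAvg_add, winAvg_const_mul,
    winAvg_const_mul, winAvg_const hN, winAvg_add, winAvg_add]

/-- Expectation of an observation, set to `0` outside the sample. -/
def obsMean (P : Measure Ω) (V : ℕ → ℕ → Ω → ℝ) (T : ℕ) (t : ℤ) : ℝ := ∫ x, obs V T t x ∂P

lemma obs_eq_add (T : ℕ) (t : ℤ) (x : Ω) :
    obs V T t x = obsMean P V T t + centered P V T t x := by
  rw [centered, obsMean]
  ring

lemma integral_abs_le_sqrt [IsProbabilityMeasure P] {X : Ω → ℝ} (hX : MemLp X 2 P) {e : ℝ}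
    (h : ∫ x, X x ^ 2 ∂P ≤ e) : ∫ x, |X x| ∂P ≤ √e := by
  have hm : MemLp (fun x => |X x|) 2 P := hX.norm
  refine Real.le_sqrt_of_sq_le (le_trans ?_ h)
  have := integral_nonneg (μ := P) (f := fun x => (|X x| - ∫ y, |X y| ∂P) ^ 2)
    fun x => sq_nonneg _
  have e := integral_sub_mul_sub hm hm (∫ y, |X y| ∂P) (∫ y, |X y| ∂P)
  simp_rw [← sq, sq_abs] at e
  rw [e] at this
  linarith

/-- The deterministic centring of the sample local autocovariance. -/
def winCentre (P : Measure Ω) (V : ℕ → ℕ → Ω → ℝ) (N T : ℕ) (c M : ℤ) : ℝ :=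
  winAvg N c (fun r => autoCov P V T (r + M) (r - M)) + winCov N c M (obsMean P V T)

lemma sum_Ioc_shift (c : ℤ) (N : ℕ) (M : ℤ) (f : ℤ → ℝ) :
    ∑ r ∈ Finset.Ioc c (c + N), f (r + M) = ∑ r ∈ Finset.Ioc (c + M) (c + M + N), f r := by
  refine Finset.sum_bij (fun r _ => r + M) ?_ ?_ ?_ fun _ _ => rfl
  · intro r hr
    rw [Finset.mem_Ioc] at hr ⊢
    omega
  · intro a _ b _ hab
    omega
  · intro r hr
    rw [Finset.mem_Ioc] at hr
    exact ⟨r - M, Finset.mem_Ioc.2 (by omega), by omega⟩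

/-- Mean square bound for averages of centred observations, at lag `M`. -/
lemma VarianceBounds.winAvg_sq_le (hD : VarianceBounds P V D)
    {T N : ℕ} (hT : 1 ≤ T) (hN : 1 ≤ N) (c M : ℤ) {a : ℤ → ℝ} {B : ℝ} (ha : ∀ r, |a r| ≤ B) :
    ∫ x, winAvg N c (fun r => a r * centered P V T (r + M) x) ^ 2 ∂P ≤ √(B ^ 4 * D / N) := by
  have hN' : (0 : ℝ) < N := by exact_mod_cast hN
  have hD0 := hD.nonneg
  have h1 := hD.linear T (Finset.Ioc (c + M) (c + M + N)) (fun r => a (r - M)) B hT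
    fun r _ => ha _
  have e : ∀ x, winAvg N c (fun r => a r * centered P V T (r + M) x) ^ 2 =
      ((N : ℝ)⁻¹) ^ 2 * (∑ r ∈ Finset.Ioc (c + M) (c + M + N), a (r - M) *
        centered P V T r x) ^ 2 := by
    intro x
    rw [winAvg, mul_pow, ← sum_Ioc_shift c N M fun r => a (r - M) * centered P V T r x]
    simp only [add_sub_cancel_right]
  simp_rw [e]
  rw [integral_const_mul]
  refine Real.le_sqrt_of_sq_le ?_
  rw [mul_pow]
  simp only [Int.card_Ioc, add_sub_cancel_left, Int.toNat_natCast] at h1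
  calc _ ≤ (((N : ℝ)⁻¹) ^ 2) ^ 2 * (B ^ 4 * D * (N : ℝ) ^ 3) :=
        mul_le_mul_of_nonneg_left h1 (by positivity)
    _ = B ^ 4 * D / N := by field_simp

lemma memLp_winAvg {N : ℕ} {c : ℤ} {f : ℤ → Ω → ℝ} (hf : ∀ r, MemLp (f r) 2 P) :
    MemLp (fun x => winAvg N c (fun r => f r x)) 2 P :=
  (memLp_finsetSum _ fun r _ => hf r).const_mul _

/-- The sample local autocovariance concentrates at its centring, uniformly over windows. -/
theorem MomentBounds.exists_winCov_concentration [IsProbabilityMeasure P]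
    (h : MomentBounds P lam A μ V C) (hD : VarianceBounds P V D) {K : ℝ}
    (hK : ∀ T t, |obsMean P V T t| ≤ K) :
    ∃ β : ℕ → ℝ, Tendsto β atTop (𝓝 0) ∧ ∀ (T N : ℕ) (c M : ℤ), 1 ≤ T → 1 ≤ N →
      Integrable (fun x => winCov N c M (fun t => obs V T t x) - winCentre P V N T c M) P ∧
      ∫ x, |winCov N c M (fun t => obs V T t x) - winCentre P V N T c M| ∂P ≤ β N := by
  have hK0 : 0 ≤ K := (abs_nonneg _).trans (hK 0 0)
  have hD0 := hD.nonneg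
  -- Centred means are at most `2K`; making the bound at least `1` lets it serve unweighted averages
  -- too.
  set B : ℝ := 2 * K + 1 with hB
  have hB1 : 1 ≤ B := by linarith
  -- The three summands come from the quadratic part, from the linear parts (two trend–noise terms
  -- and `4K` times the noise average, each with second moment at most `s`), and from the squared
  -- noise averages with total coefficient four.
  refine ⟨fun N => √(D / N) + (2 + 4 * K) * √(√(B ^ 4 * D / N)) + 4 * √(B ^ 4 * D / N), ?_, ?_⟩
  · have h0 : ∀ a : ℝ, Tendsto (fun N : ℕ => √(a / N)) atTop (𝓝 0) := fun a => by
      simpa using (tendsto_const_div_atTop_nhds_zero_nat a).sqrt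
    have h1 := ((h0 D).add (((h0 (B ^ 4 * D)).sqrt).const_mul (2 + 4 * K))).add
      ((h0 (B ^ 4 * D)).const_mul 4)
    simpa using h1
  · intro T N c M hT hN
    have hN' : (0 : ℝ) < N := by exact_mod_cast hN
    set s : ℝ := √(B ^ 4 * D / N) with hs
    have hs0 : 0 ≤ s := Real.sqrt_nonneg _
    have hY2 : ∀ t, MemLp (centered P V T t) 2 P := fun t =>
      (h.centered_memLp T t).mono_exponent (by norm_num)
    set a : ℤ → ℝ := obsMean P V T with ha
    set ā : ℝ := winAvg N c a with hā
    have hā' : |ā| ≤ K := abs_winAvg_le hN c fun r => hK T r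
    have haB : ∀ r, |a r - ā| ≤ B := fun r =>
      (abs_sub _ _).trans (by linarith [hK T r])
    have ha2 : ∀ r, |a r - ā| ≤ 2 * K := fun r =>
      (abs_sub _ _).trans (by linarith [hK T r])
    -- the pieces of the expansion
    set Q : Ω → ℝ := fun x => winAvg N c (fun r => centered P V T (r + M) x *
      centered P V T (r - M) x - autoCov P V T (r + M) (r - M)) with hQ
    set L₁ : Ω → ℝ := fun x => winAvg N c (fun r => (a (r + M) - ā) * centered P V T (r - M) x)
      with hL₁
    set L₂ : Ω → ℝ := fun x => winAvg N c (fun r => (a (r - M) - ā) * centered P V T (r + M) x)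
      with hL₂
    set Y₀ : Ω → ℝ := fun x => winAvg N c (fun r => centered P V T r x) with hY₀
    set Y₁ : Ω → ℝ := fun x => winAvg N c (fun r => centered P V T (r + M) x) with hY₁
    set Y₂ : Ω → ℝ := fun x => winAvg N c (fun r => centered P V T (r - M) x) with hY₂
    set κ : ℝ := winAvg N c (fun r => a (r + M) - ā) + winAvg N c (fun r => a (r - M) - ā) with hκ
    have hκ' : |κ| ≤ 4 * K := by
      refine (abs_add_le _ _).trans ?_
      have e1 := abs_winAvg_le hN c (f := fun r => a (r + M) - ā) fun r => ha2 (r + M)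
      have e2 := abs_winAvg_le hN c (f := fun r => a (r - M) - ā) fun r => ha2 (r - M)
      linarith
    have hexp : ∀ x, winCov N c M (fun t => obs V T t x) - winCentre P V N T c M =
        Q x + L₁ x + L₂ x - Y₀ x * κ - Y₀ x * (Y₁ x + Y₂ x) + Y₀ x ^ 2 := by
      intro x
      have e1 : (fun t => obs V T t x) = fun t => a t + centered P V T t x := by
        ext t
        exact obs_eq_add T t x
      rw [e1, winCov_add hN, winCentre]
      simp only [hQ, winAvg_sub, hL₁, hL₂, hY₀, hY₁, hY₂, hκ, hā, ha]
      ring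
    have mQ : MemLp Q 2 P := memLp_winAvg fun r => (h.mul_memLp T (r + M) (r - M)).sub
      (memLp_const _)
    have mL₁ : MemLp L₁ 2 P := memLp_winAvg fun r => (hY2 _).const_mul _
    have mL₂ : MemLp L₂ 2 P := memLp_winAvg fun r => (hY2 _).const_mul _
    have mY₀ : MemLp Y₀ 2 P := memLp_winAvg fun r => hY2 _
    have mY₁ : MemLp Y₁ 2 P := memLp_winAvg fun r => hY2 _
    have mY₂ : MemLp Y₂ 2 P := memLp_winAvg fun r => hY2 _
    have bQ : ∫ x, Q x ^ 2 ∂P ≤ D / N := by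
      -- The product of values at `r + M` and `r - M` is a product at lag `2M` based at `r - M`, so
      -- the summation range moves by `-M`.
      have h1 := hD.quadratic T (2 * M) (Finset.Ioc (c - M) (c - M + N)) hT
      have e : ∀ x, Q x ^ 2 = ((N : ℝ)⁻¹) ^ 2 * (∑ r ∈ Finset.Ioc (c - M) (c - M + N),
          (centered P V T r x * centered P V T (r + 2 * M) x -
            autoCov P V T r (r + 2 * M))) ^ 2 := by
        intro x
        have := sum_Ioc_shift c N (-M) fun r => (centered P V T r x * centered P V T (r + 2 * M) x -
            autoCov P V T r (r + 2 * M))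
        simp only [← sub_eq_add_neg] at this
        rw [← this, ← mul_pow]
        simp only [hQ, winAvg]
        congr 2
        refine Finset.sum_congr rfl fun r _ => ?_
        rw [show r - M + 2 * M = r + M by ring, autoCov_comm, mul_comm]
      simp_rw [e]
      rw [integral_const_mul]
      simp only [Int.card_Ioc, add_sub_cancel_left, Int.toNat_natCast] at h1
      calc _ ≤ ((N : ℝ)⁻¹) ^ 2 * (D * N) := mul_le_mul_of_nonneg_left h1 (by positivity)
        _ = D / N := by field_simp
    have bL₁ : ∫ x, L₁ x ^ 2 ∂P ≤ s := by
      have := hD.winAvg_sq_le hT hN c (-M) (a := fun r => a (r + M) - ā) (B := B) fun r => haB _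
      simpa only [← sub_eq_add_neg] using this
    have bL₂ : ∫ x, L₂ x ^ 2 ∂P ≤ s :=
      hD.winAvg_sq_le hT hN c M (a := fun r => a (r - M) - ā) (B := B) fun r => haB _
    have hone : ∀ M : ℤ, ∫ x, winAvg N c (fun r => centered P V T (r + M) x) ^ 2 ∂P ≤ s := by
      intro M
      have := hD.winAvg_sq_le hT hN c M (a := fun _ => 1) (B := B) fun r => by
        rw [abs_one]
        exact hB1
      simpa only [one_mul] using this
    have bY₀ : ∫ x, Y₀ x ^ 2 ∂P ≤ s := by simpa only [add_zero] using hone 0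
    have bY₁ : ∫ x, Y₁ x ^ 2 ∂P ≤ s := hone M
    have bY₂ : ∫ x, Y₂ x ^ 2 ∂P ≤ s := by simpa only [← sub_eq_add_neg] using hone (-M)
    have iQ : Integrable Q P := mQ.integrable one_le_two
    have iL₁ : Integrable L₁ P := mL₁.integrable one_le_two
    have iL₂ : Integrable L₂ P := mL₂.integrable one_le_two
    have iY₀ : Integrable Y₀ P := mY₀.integrable one_le_two
    have iR : Integrable (fun x => winCov N c M (fun t => obs V T t x) -
        winCentre P V N T c M) P := by
      simp_rw [hexp]
      exact ((((iQ.add iL₁).add iL₂).sub (iY₀.mul_const κ)).sub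
        (mY₀.integrable_mul (mY₁.add mY₂))).add mY₀.integrable_sq
    refine ⟨iR, ?_⟩
    have hle : ∀ x, |winCov N c M (fun t => obs V T t x) - winCentre P V N T c M| ≤
        |Q x| + (|L₁ x| + (|L₂ x| + (4 * K * |Y₀ x| +
          (2 * Y₀ x ^ 2 + (Y₁ x ^ 2 + Y₂ x ^ 2))))) := by
      intro x
      rw [hexp]
      have e1 : |Y₀ x * κ| ≤ 4 * K * |Y₀ x| := by
        rw [abs_mul, mul_comm]
        exact mul_le_mul_of_nonneg_right hκ' (abs_nonneg _)
      have e2 : |Y₀ x * (Y₁ x + Y₂ x)| ≤ Y₀ x ^ 2 + (Y₁ x ^ 2 + Y₂ x ^ 2) := by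
        rw [abs_le]
        constructor <;> nlinarith [sq_nonneg (Y₀ x + Y₁ x), sq_nonneg (Y₀ x - Y₁ x),
          sq_nonneg (Y₀ x + Y₂ x), sq_nonneg (Y₀ x - Y₂ x), sq_nonneg (Y₁ x), sq_nonneg (Y₂ x)]
      have e3 := abs_le.1 e1
      have e4 := abs_le.1 e2
      have e5 := abs_le.1 (le_refl |Q x|)
      have e6 := abs_le.1 (le_refl |L₁ x|)
      have e7 := abs_le.1 (le_refl |L₂ x|)
      have e8 := sq_nonneg (Y₀ x)
      rw [abs_le]
      constructor <;> linarith [e3.1, e3.2, e4.1, e4.2, e5.1, e5.2, e6.1, e6.2, e7.1, e7.2]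
    have j12 : Integrable (fun x => Y₁ x ^ 2 + Y₂ x ^ 2) P :=
      mY₁.integrable_sq.add mY₂.integrable_sq
    have j0 : Integrable (fun x => 2 * Y₀ x ^ 2 + (Y₁ x ^ 2 + Y₂ x ^ 2)) P :=
      (mY₀.integrable_sq.const_mul 2).add j12
    have jK : Integrable (fun x => 4 * K * |Y₀ x| +
        (2 * Y₀ x ^ 2 + (Y₁ x ^ 2 + Y₂ x ^ 2))) P := (iY₀.abs.const_mul _).add j0
    have jL₂ : Integrable (fun x => |L₂ x| + (4 * K * |Y₀ x| +
        (2 * Y₀ x ^ 2 + (Y₁ x ^ 2 + Y₂ x ^ 2)))) P := iL₂.abs.add jK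
    have jL₁ : Integrable (fun x => |L₁ x| + (|L₂ x| + (4 * K * |Y₀ x| +
        (2 * Y₀ x ^ 2 + (Y₁ x ^ 2 + Y₂ x ^ 2))))) P := iL₁.abs.add jL₂
    refine (integral_mono iR.abs (iQ.abs.add jL₁) hle).trans ?_
    simp only [Pi.add_apply]
    rw [integral_add iQ.abs jL₁, integral_add iL₁.abs jL₂, integral_add iL₂.abs jK,
      integral_add (iY₀.abs.const_mul _) j0, integral_add (mY₀.integrable_sq.const_mul 2) j12,
      integral_add mY₁.integrable_sq mY₂.integrable_sq, integral_const_mul, integral_const_mul]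
    have f1 := integral_abs_le_sqrt mQ bQ
    have f2 := integral_abs_le_sqrt mL₁ bL₁
    have f3 := integral_abs_le_sqrt mL₂ bL₂
    have f4 := mul_le_mul_of_nonneg_left (integral_abs_le_sqrt mY₀ bY₀)
      (by positivity : (0 : ℝ) ≤ 4 * K)
    linarith

end LocalWindow

/-! ### The deterministic centring of a window with at most one break -/

section WindowLimit

variable {Ω : Type*} [MeasurableSpace Ω] {P : Measure Ω}
  {m : ℕ} {lam : Fin (m + 2) → ℝ} {A : ℝ → ℝ → ℂ} {μ : Fin (m + 1) → ℝ → ℝ} {V : ℕ → ℕ → Ω → ℝ}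
  {C : ℝ}

/-- A function that is Lipschitz to the right of `a` has a right-hand limit there. -/
lemma tendsto_rightLim {f : ℝ → ℝ} {a b L : ℝ}
    (hf : ∀ u ∈ Ioc a b, ∀ v ∈ Ioc a b, |f u - f v| ≤ L * |u - v|) (hab : a < b) :
    Tendsto f (𝓝[>] a) (𝓝 (Function.rightLim f a)) := by
  have hL : LipschitzOnWith L.toNNReal f (Ioc a b) := by
    refine LipschitzOnWith.of_dist_le_mul fun u hu v hv => ?_
    rw [Real.dist_eq, Real.dist_eq]
    refine (hf u hu v hv).trans (mul_le_mul_of_nonneg_right ?_ (abs_nonneg _))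
    exact Real.le_coe_toNNReal L
  -- A Lipschitz extension to the line is continuous at `a`, and its value there is the right-hand
  -- limit.
  obtain ⟨g, hg, hfg⟩ := hL.extend_real
  have ht : Tendsto f (𝓝[>] a) (𝓝 (g a)) := by
    refine (hg.continuous.continuousAt.tendsto.mono_left nhdsWithin_le_nhds).congr' ?_
    filter_upwards [Ioc_mem_nhdsGT hab] with v hv using (hfg hv).symm
  rwa [rightLim_eq_of_tendsto ht]

lemma abs_sub_rightLim_le {f : ℝ → ℝ} {a b L : ℝ}
    (hf : ∀ u ∈ Ioc a b, ∀ v ∈ Ioc a b, |f u - f v| ≤ L * |u - v|) {u : ℝ} (hu : u ∈ Ioc a b) :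
    |f u - Function.rightLim f a| ≤ L * |u - a| := by
  have hab : a < b := hu.1.trans_le hu.2
  refine le_of_tendsto_of_tendsto ((tendsto_const_nhds.sub (tendsto_rightLim hf hab)).abs)
    ((tendsto_const_nhds.sub (tendsto_id.mono_left nhdsWithin_le_nhds)).abs.const_mul L) ?_
  filter_upwards [Ioc_mem_nhdsGT hab] with v hv using hf u hu v hv

lemma abs_rightLim_le {f : ℝ → ℝ} {a b L B : ℝ}
    (hf : ∀ u ∈ Ioc a b, ∀ v ∈ Ioc a b, |f u - f v| ≤ L * |u - v|) (hab : a < b)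
    (hB : ∀ u ∈ Ioc a b, |f u| ≤ B) : |Function.rightLim f a| ≤ B := by
  refine le_of_tendsto (tendsto_rightLim hf hab).abs ?_
  filter_upwards [Ioc_mem_nhdsGT hab] with v hv using hB v hv

lemma localCov_neg (u : ℝ) (k : ℤ) : localCov A u (-k) = localCov A u k := by
  rw [localCov, localCov, ← Complex.conj_re,
    intervalIntegral.integral_of_le (by linarith [Real.pi_pos]),
    intervalIntegral.integral_of_le (by linarith [Real.pi_pos]), ← integral_conj]
  congr 2
  ext w
  rw [map_mul, ← Complex.exp_conj, Complex.conj_ofReal]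
  simp

lemma localCov_abs (u : ℝ) (k : ℤ) : localCov A u |k| = localCov A u k := by
  rcases abs_choice k with h | h <;> rw [h]
  exact localCov_neg u k

/-- The average of a function that is close to `f₁` before a cut and to `f₂` after it, away from
few exceptional points. -/
lemma abs_winAvg_sub_le {N : ℕ} (hN : 1 ≤ N) (c : ℤ) {p : ℤ} (hp0 : 0 ≤ p) (hpN : p ≤ N)
    {F : ℤ → ℝ} {f₁ f₂ B ε : ℝ} (hε : 0 ≤ ε) (hF : ∀ r, |F r| ≤ B) (h₁ : |f₁| ≤ B) (h₂ : |f₂| ≤ B)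
    (bad : Finset ℤ)
    (hpre : ∀ r ∈ Finset.Ioc c (c + N), r ∉ bad → r ≤ c + p → |F r - f₁| ≤ ε)
    (hpost : ∀ r ∈ Finset.Ioc c (c + N), r ∉ bad → c + p < r → |F r - f₂| ≤ ε) :
    |winAvg N c F - ((p : ℝ) / N * f₁ + (1 - (p : ℝ) / N) * f₂)| ≤ ε + 2 * B * bad.card / N := by
  have hN' : (0 : ℝ) < N := by exact_mod_cast hN
  have hB : 0 ≤ B := (abs_nonneg _).trans h₁
  have hcut : winAvg N c (fun r => if r ≤ c + p then f₁ else f₂) =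
      (p : ℝ) / N * f₁ + (1 - (p : ℝ) / N) * f₂ := by
    have hs : ∑ r ∈ Finset.Ioc c (c + N), (if r ≤ c + p then f₁ else f₂) =
        p * f₁ + (N - p) * f₂ := by
      rw [Finset.sum_ite, Finset.sum_const, Finset.sum_const, nsmul_eq_mul, nsmul_eq_mul]
      have e1 : (Finset.Ioc c (c + N)).filter (fun r => r ≤ c + p) = Finset.Ioc c (c + p) := by
        ext r
        simp only [Finset.mem_filter, Finset.mem_Ioc]
        omega
      have e2 : (Finset.Ioc c (c + N)).filter (fun r => ¬ r ≤ c + p) =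
          Finset.Ioc (c + p) (c + N) := by
        ext r
        simp only [Finset.mem_filter, Finset.mem_Ioc]
        omega
      rw [e1, e2, Int.card_Ioc, Int.card_Ioc]
      have e3 : (((c + p - c).toNat : ℕ) : ℝ) = p := by
        exact_mod_cast (by omega : ((c + p - c).toNat : ℤ) = p)
      have e4 : (((c + N - (c + p)).toNat : ℕ) : ℝ) = N - p := by
        exact_mod_cast (by omega : ((c + N - (c + p)).toNat : ℤ) = N - p)
      rw [e3, e4]
    rw [winAvg, hs]
    field_simp
  rw [← hcut, ← winAvg_sub, winAvg, abs_mul, abs_of_pos (inv_pos.2 hN')]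
  have hpt : ∀ r ∈ Finset.Ioc c (c + N), |F r - if r ≤ c + p then f₁ else f₂| ≤
      ε + if r ∈ bad then 2 * B else 0 := by
    intro r hr
    by_cases hb : r ∈ bad
    · rw [if_pos hb]
      have : |(if r ≤ c + p then f₁ else f₂)| ≤ B := by split_ifs <;> assumption
      refine (abs_sub _ _).trans ?_
      linarith [hF r]
    · rw [if_neg hb, add_zero]
      split_ifs with h
      · exact hpre r hr hb h
      · exact hpost r hr hb (by omega)
  have hsum : |∑ r ∈ Finset.Ioc c (c + N), (F r - if r ≤ c + p then f₁ else f₂)| ≤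
      N * ε + 2 * B * bad.card := by
    refine (Finset.abs_sum_le_sum_abs _ _).trans ((Finset.sum_le_sum hpt).trans ?_)
    rw [Finset.sum_add_distrib, Finset.sum_const, nsmul_eq_mul, Int.card_Ioc,
      ← Finset.sum_filter, Finset.sum_const, nsmul_eq_mul]
    have e1 : (((c + N - c).toNat : ℕ) : ℝ) = N := by simp
    rw [e1]
    have e2 : (((Finset.Ioc c (c + N)).filter (fun r => r ∈ bad)).card : ℝ) ≤ bad.card := by
      exact_mod_cast Finset.card_le_card fun r hr => (Finset.mem_filter.1 hr).2
    nlinarith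
  calc _ ≤ (N : ℝ)⁻¹ * (N * ε + 2 * B * bad.card) :=
        mul_le_mul_of_nonneg_left hsum (inv_pos.2 hN').le
    _ = _ := by field_simp

/-- Points of a window whose neighbours at distance `M` may leave the window shifted by at most `M`
or lie on different sides of the cut. -/
def windowBad (N : ℕ) (c M p : ℤ) : Finset ℤ :=
  Finset.Ioc c (c + 2 * M) ∪ Finset.Ioc (c + N - 2 * M) (c + N) ∪
    Finset.Ioc (c + p - 2 * M) (c + p + 2 * M)

lemma card_windowBad_le (N : ℕ) (c p : ℤ) {M : ℤ} (hM : 0 ≤ M) :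
    ((windowBad N c M p).card : ℝ) ≤ 8 * M := by
  have h : (windowBad N c M p).card ≤ (c + 2 * M - c).toNat +
      (c + N - (c + N - 2 * M)).toNat + (c + p + 2 * M - (c + p - 2 * M)).toNat := by
    refine (Finset.card_union_le _ _).trans (add_le_add ((Finset.card_union_le _ _).trans ?_) ?_)
    · rw [Int.card_Ioc, Int.card_Ioc]
    · rw [Int.card_Ioc]
  have h' : ((windowBad N c M p).card : ℤ) ≤ 8 * M := by omega
  exact_mod_cast h'

/-- The sample autocovariance of a trend with one jump, plus an average of covariances with one
jump. -/
lemma abs_winAvg_add_winCov_sub_le {N : ℕ} (hN : 1 ≤ N) (c κ : ℤ) {p : ℤ} (hp0 : 0 ≤ p)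
    (hpN : p ≤ N) {G a : ℤ → ℝ} {g₁ g₂ a₁ a₂ B ε : ℝ} (hε : 0 ≤ ε)
    (hG : ∀ r, |G r| ≤ B) (hg₁ : |g₁| ≤ B) (hg₂ : |g₂| ≤ B)
    (ha : ∀ r, |a r| ≤ B) (ha₁ : |a₁| ≤ B) (ha₂ : |a₂| ≤ B)
    (hGpre : ∀ r, r + |κ| ∈ Ioc (c + κ) (c + κ + p) → r - |κ| ∈ Ioc (c + κ) (c + κ + p) →
      |G r - g₁| ≤ ε)
    (hGpost : ∀ r, r + |κ| ∈ Ioc (c + κ + p) (c + κ + N) →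
      r - |κ| ∈ Ioc (c + κ + p) (c + κ + N) → |G r - g₂| ≤ ε)
    (hapre : ∀ r ∈ Ioc (c + κ) (c + κ + p), |a r - a₁| ≤ ε)
    (hapost : ∀ r ∈ Ioc (c + κ + p) (c + κ + N), |a r - a₂| ≤ ε) :
    |winAvg N c G + winCov N c |κ| a -
      ((p : ℝ) / N * g₁ + (1 - (p : ℝ) / N) * g₂ +
        (p : ℝ) / N * (1 - (p : ℝ) / N) * (a₁ - a₂) ^ 2)| ≤
      (1 + 6 * B) * (ε + 16 * B * |κ| / N) := by
  have hN' : (0 : ℝ) < N := by exact_mod_cast hN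
  have hB : 0 ≤ B := (abs_nonneg _).trans hg₁
  set M : ℤ := |κ| with hM
  have hM0 : 0 ≤ M := abs_nonneg κ
  have hκ1 : κ ≤ M := le_abs_self κ
  have hκ2 : -M ≤ κ := neg_abs_le κ
  set bad := windowBad N c M p with hbad
  set α : ℝ := (p : ℝ) / N with hα
  have hcard := card_windowBad_le N c p hM0
  rw [← hbad] at hcard
  set e : ℝ := ε + 16 * B * M / N with he
  have hM0' : (0 : ℝ) ≤ M := by exact_mod_cast hM0
  have he0 : 0 ≤ e := by positivity
  -- The averages run over the window starting at `c`, while the break is located in the window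
  -- shifted by `κ`. With a further shift `|s| ≤ M`, points move by at most `2M` relative to the
  -- ends and to the cut, and such points were discarded as `bad`.
  have hpre : ∀ r ∈ Finset.Ioc c (c + N), r ∉ bad → r ≤ c + p → ∀ s : ℤ, |s| ≤ M →
      r + s ∈ Ioc (c + κ) (c + κ + p) := by
    intro r hr hb hrp s hs
    simp only [hbad, windowBad, Finset.mem_union, Finset.mem_Ioc, not_or, not_and, not_le] at hr hb
    rw [abs_le] at hs
    constructor <;> omega
  have hpost : ∀ r ∈ Finset.Ioc c (c + N), r ∉ bad → c + p < r → ∀ s : ℤ, |s| ≤ M →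
      r + s ∈ Ioc (c + κ + p) (c + κ + N) := by
    intro r hr hb hrp s hs
    simp only [hbad, windowBad, Finset.mem_union, Finset.mem_Ioc, not_or, not_and, not_le] at hr hb
    rw [abs_le] at hs
    constructor <;> omega
  have hMM : |M| ≤ M := (abs_of_nonneg hM0).le
  have hMM' : |-M| ≤ M := by rw [abs_neg, abs_of_nonneg hM0]
  have herr : ∀ {b ε' : ℝ}, 0 ≤ b → ε' + 2 * b * bad.card / N ≤ ε' + 16 * b * M / N := by
    intro b ε' hb
    have : 2 * b * bad.card ≤ 16 * b * M := by nlinarith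
    gcongr
  have k0 : |winAvg N c G - (α * g₁ + (1 - α) * g₂)| ≤ e := by
    refine (abs_winAvg_sub_le hN c hp0 hpN hε hG hg₁ hg₂ bad ?_ ?_).trans (herr hB)
    · exact fun r hr hb hrp => hGpre r (hpre r hr hb hrp M hMM) (hpre r hr hb hrp (-M) hMM')
    · exact fun r hr hb hrp => hGpost r (hpost r hr hb hrp M hMM) (hpost r hr hb hrp (-M) hMM')
  have kshift : ∀ s : ℤ, |s| ≤ M →
      |winAvg N c (fun r => a (r + s)) - (α * a₁ + (1 - α) * a₂)| ≤ e := by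
    intro s hs
    refine (abs_winAvg_sub_le hN c hp0 hpN hε (fun r => ha _) ha₁ ha₂ bad ?_ ?_).trans (herr hB)
    · exact fun r hr hb hrp => hapre _ (hpre r hr hb hrp s hs)
    · exact fun r hr hb hrp => hapost _ (hpost r hr hb hrp s hs)
  have hprod : ∀ {x y z : ℝ}, |x| ≤ B → |z| ≤ B → |x - z| ≤ ε → |y - z| ≤ ε →
      |x * y - z ^ 2| ≤ 2 * B * ε := by
    intro x y z hx hz hxz hyz
    have e1 : x * y - z ^ 2 = x * (y - z) + (x - z) * z := by ring
    rw [e1]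
    refine (abs_add_le _ _).trans ?_
    rw [abs_mul, abs_mul]
    have := mul_le_mul hx hyz (abs_nonneg _) hB
    have := mul_le_mul hxz hz (abs_nonneg _) hε
    linarith
  have hsq : ∀ {x y : ℝ}, |x| ≤ B → |y| ≤ B → |x * y| ≤ B * B := by
    intro x y hx hy
    rw [abs_mul]
    exact mul_le_mul hx hy (abs_nonneg _) hB
  have k2 : |winAvg N c (fun r => a (r + M) * a (r - M)) - (α * a₁ ^ 2 + (1 - α) * a₂ ^ 2)| ≤
      2 * B * e := by
    refine (abs_winAvg_sub_le hN c hp0 hpN (ε := 2 * B * ε) (B := B * B) (by positivity)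
      (fun r => hsq (ha _) (ha _)) (by rw [sq]; exact hsq ha₁ ha₁) (by rw [sq]; exact hsq ha₂ ha₂)
      bad ?_ ?_).trans ?_
    · exact fun r hr hb hrp => hprod (ha _) ha₁ (hapre _ (hpre r hr hb hrp M hMM))
        (hapre _ (hpre r hr hb hrp (-M) hMM'))
    · exact fun r hr hb hrp => hprod (ha _) ha₂ (hapost _ (hpost r hr hb hrp M hMM))
        (hapost _ (hpost r hr hb hrp (-M) hMM'))
    · refine (herr (b := B * B) (by positivity)).trans ?_
      rw [he]
      have : 0 ≤ B * B * M / N := by positivity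
      have e2 : 2 * B * (ε + 16 * B * M / N) = 2 * B * ε + 32 * (B * B * M / N) := by ring
      have e3 : 16 * (B * B) * M / N = 16 * (B * B * M / N) := by ring
      rw [e2, e3]
      linarith
  have kp := kshift M hMM
  have km := kshift (-M) hMM'
  have kc := kshift 0 (by simpa using hM0)
  simp only [add_zero] at kc
  simp only [← sub_eq_add_neg] at km
  have hexp : winCov N c M a = winAvg N c (fun r => a (r + M) * a (r - M)) -
      winAvg N c a * (winAvg N c (fun r => a (r + M)) + winAvg N c (fun r => a (r - M))) +
        winAvg N c a ^ 2 := by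
    have : ∀ r, (a (r + M) - winAvg N c a) * (a (r - M) - winAvg N c a) =
        (a (r + M) * a (r - M) - winAvg N c a * (a (r + M) + a (r - M))) + winAvg N c a ^ 2 :=
      fun r => by ring
    rw [winCov]
    simp_rw [this]
    rw [winAvg_add, winAvg_sub, winAvg_const_mul, winAvg_const hN, winAvg_add]
  have hā : |winAvg N c a| ≤ B := abs_winAvg_le hN c ha
  rw [hexp]
  have hα0 : 0 ≤ α := by
    have : (0 : ℝ) ≤ p := by exact_mod_cast hp0
    positivity
  have hα1 : α ≤ 1 := by
    rw [hα, div_le_one hN']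
    exact_mod_cast hpN
  set a₀ : ℝ := α * a₁ + (1 - α) * a₂ with ha₀
  have ha₀' : |a₀| ≤ B := by
    rw [abs_le] at ha₁ ha₂ ⊢
    constructor <;> nlinarith
  generalize winAvg N c G = wG at *
  generalize winAvg N c (fun r => a (r + M) * a (r - M)) = w2 at *
  generalize winAvg N c (fun r => a (r + M)) = wp at *
  generalize winAvg N c (fun r => a (r - M)) = wm at *
  generalize winAvg N c a = w at *
  -- The mean square `α a₁² + (1 - α) a₂²` minus the squared mean `a₀²` is `α (1 - α)(a₁ - a₂)²`.
  -- The remaining brackets are approximation errors, of size `e`, `2Be` and `4Be`, which produces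
  -- the factor `1 + 6B`.
  have hsplit : wG + (w2 - w * (wp + wm) + w ^ 2) -
      (α * g₁ + (1 - α) * g₂ + α * (1 - α) * (a₁ - a₂) ^ 2) =
      (wG - (α * g₁ + (1 - α) * g₂)) + (w2 - (α * a₁ ^ 2 + (1 - α) * a₂ ^ 2)) +
        ((w - a₀) * (w - a₀) - w * ((wp - a₀) + (wm - a₀))) := by
    rw [ha₀]
    ring
  have b1 : |(w - a₀) * (w - a₀)| ≤ 2 * B * e := by
    rw [abs_mul]
    refine mul_le_mul ((abs_sub _ _).trans (by linarith)) kc (abs_nonneg _) (by positivity)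
  have b2 : |w * ((wp - a₀) + (wm - a₀))| ≤ B * (2 * e) := by
    rw [abs_mul]
    refine mul_le_mul hā ((abs_add_le _ _).trans (by linarith)) (abs_nonneg _) hB
  rw [hsplit]
  refine (abs_add_le _ _).trans ?_
  have := abs_add_le (wG - (α * g₁ + (1 - α) * g₂)) (w2 - (α * a₁ ^ 2 + (1 - α) * a₂ ^ 2))
  have := abs_sub ((w - a₀) * (w - a₀)) (w * ((wp - a₀) + (wm - a₀)))
  linarith

/-- The observations have uniformly bounded means. -/
lemma MomentBounds.exists_obsMean_bound (h : MomentBounds P lam A μ V C)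
    (hlam : IsBreakFractions lam) {K : ℝ} (hK0 : 0 ≤ K)
    (hK : ∀ j, ∀ u ∈ regime lam j, |μ j u| ≤ K) (T : ℕ) (t : ℤ) : |obsMean P V T t| ≤ K := by
  by_cases ht : 1 ≤ t ∧ t ≤ T
  · have hT : 1 ≤ T := by omega
    obtain ⟨j, hj⟩ := exists_dates hlam ht.1 ht.2
    rw [obsMean, h.mean T j t hT hj]
    exact hK j _ (div_mem_regime hT hj)
  · simpa [obsMean, obs_eq_zero ht] using hK0

/-- The trends are bounded and Lipschitz on their regimes, with common constants. -/
lemma IsSLS.exists_trend_bounds (hlam : IsBreakFractions lam) (hV : IsSLS P lam A μ V) :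
    ∃ K : ℝ, 0 ≤ K ∧ (∀ j, ∀ u ∈ regime lam j, |μ j u| ≤ K) ∧
      ∀ j, ∀ u ∈ regime lam j, ∀ v ∈ regime lam j, |μ j u - μ j v| ≤ K * |u - v| := by
  choose L hL using hV.trend_lipschitz
  have hS : ∀ j, (L j : ℝ) ≤ ∑ i, (L i : ℝ) := fun j =>
    Finset.single_le_sum (f := fun i => (L i : ℝ)) (fun i _ => (L i).2) (Finset.mem_univ j)
  have hS' : ∀ j, |μ j (lam j.succ)| ≤ ∑ i : Fin (m + 1), |μ i (lam i.succ)| := fun j =>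
    Finset.single_le_sum (f := fun i : Fin (m + 1) => |μ i (lam i.succ)|)
      (fun i _ => abs_nonneg _) (Finset.mem_univ j)
  have hLS0 : 0 ≤ ∑ i, (L i : ℝ) := Finset.sum_nonneg fun i _ => (L i).2
  have hMS0 : 0 ≤ ∑ i : Fin (m + 1), |μ i (lam i.succ)| := Finset.sum_nonneg fun i _ => abs_nonneg _
  have hlip : ∀ j, ∀ u ∈ regime lam j, ∀ v ∈ regime lam j,
      |μ j u - μ j v| ≤ (∑ i, (L i : ℝ)) * |u - v| := fun j u hu v hv => by
    have := (hL j).dist_le_mul u hu v hv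
    rw [Real.dist_eq, Real.dist_eq] at this
    exact this.trans (mul_le_mul_of_nonneg_right (hS j) (abs_nonneg _))
  refine ⟨(∑ i, (L i : ℝ)) + ∑ i : Fin (m + 1), |μ i (lam i.succ)|, by positivity, ?_, ?_⟩
  · intro j u hu
    have h1 := hlip j u hu _ (lam_succ_mem_regime hlam j)
    have h2 : |u - lam j.succ| ≤ 1 := by
      have e1 := regime_subset hlam j hu
      have e2 := regime_subset hlam j (lam_succ_mem_regime hlam j)
      rw [abs_le]
      constructor <;> linarith [e1.1, e1.2, e2.1, e2.2]
    have h3 := abs_add_le (μ j u - μ j (lam j.succ)) (μ j (lam j.succ))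
    rw [sub_add_cancel] at h3
    nlinarith [hS' j]
  · intro j u hu v hv
    refine (hlip j u hu v hv).trans (mul_le_mul_of_nonneg_right (by linarith) (abs_nonneg _))

lemma MomentBounds.abs_autoCov_le (h : MomentBounds P lam A μ V C) (T : ℕ) (s t : ℤ) :
    |autoCov P V T s t| ≤ 2 * C := by
  by_cases ht : 1 ≤ t ∧ t ≤ T
  · have hT : 1 ≤ T := by omega
    have hC := h.nonneg
    refine (h.cov_decay T s t hT).trans ?_
    have h0 : (0 : ℝ) ≤ (|s - t| : ℤ) := by exact_mod_cast abs_nonneg (s - t)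
    have h1 : C / (1 + (|s - t| : ℤ)) ≤ C := div_le_self hC (by linarith)
    have h2 : C / T ≤ C := div_le_self hC (by exact_mod_cast hT)
    linarith
  · rw [autoCov_eq_zero_right ht, abs_zero]
    linarith [h.nonneg]

/-- The centring of the sample local autocovariance when the window splits, at `c + κ + p`, into
dates of one regime near `l₁` and dates of another regime near `l₂`. -/
lemma MomentBounds.abs_winCentre_sub_le (h : MomentBounds P lam A μ V C)
    {K : ℝ} (hKC : 2 * C ≤ K) (hK : ∀ T t, |obsMean P V T t| ≤ K) {T N : ℕ} (hT : 1 ≤ T)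
    (hN : 1 ≤ N) (c κ : ℤ) {p : ℤ} (hp0 : 0 ≤ p) (hpN : p ≤ N) {j₁ j₂ : Fin (m + 1)}
    {l₁ l₂ g₁ g₂ a₁ a₂ η : ℝ} (hη : 0 ≤ η)
    (hg₁ : |g₁| ≤ K) (hg₂ : |g₂| ≤ K) (ha₁ : |a₁| ≤ K) (ha₂ : |a₂| ≤ K)
    (hgl₁ : ∀ v ∈ regime lam j₁, |localCov A v (2 * κ) - g₁| ≤ K * |v - l₁|)
    (hgl₂ : ∀ v ∈ regime lam j₂, |localCov A v (2 * κ) - g₂| ≤ K * |v - l₂|)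
    (hal₁ : ∀ v ∈ regime lam j₁, |μ j₁ v - a₁| ≤ K * |v - l₁|)
    (hal₂ : ∀ v ∈ regime lam j₂, |μ j₂ v - a₂| ≤ K * |v - l₂|)
    (hpre : ∀ t ∈ Ioc (c + κ) (c + κ + p), t ∈ dates lam T j₁ ∧ |(t : ℝ) / T - l₁| ≤ η)
    (hpost : ∀ t ∈ Ioc (c + κ + p) (c + κ + N), t ∈ dates lam T j₂ ∧ |(t : ℝ) / T - l₂| ≤ η) :
    |winCentre P V N T c |κ| - ((p : ℝ) / N * g₁ + (1 - (p : ℝ) / N) * g₂ +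
        (p : ℝ) / N * (1 - (p : ℝ) / N) * (a₁ - a₂) ^ 2)| ≤
      (1 + 6 * K) * (K * ((1 + 2 * |κ|) / T + η) + 16 * K * |κ| / N) := by
  have hC := h.nonneg
  have hK0 : 0 ≤ K := by linarith
  have hT' : (0 : ℝ) < T := by exact_mod_cast hT
  have hε : 0 ≤ K * ((1 + 2 * (|κ| : ℤ)) / T + η) := by
    have : (0 : ℝ) ≤ (|κ| : ℤ) := by exact_mod_cast abs_nonneg κ
    positivity
  -- The later date is the base point, and the earlier one is `2|κ| / T` away in rescaled time. The
  -- lag appears as `|2κ|`, which the evenness of `localCov` identifies with `2κ`.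
  have hG : ∀ (j : Fin (m + 1)) (r : ℤ) (g l : ℝ),
      (∀ v ∈ regime lam j, |localCov A v (2 * κ) - g| ≤ K * |v - l|) →
      (r + |κ| ∈ dates lam T j ∧ |((r + |κ| : ℤ) : ℝ) / T - l| ≤ η) → r - |κ| ∈ dates lam T j →
      |autoCov P V T (r + |κ|) (r - |κ|) - g| ≤ K * ((1 + 2 * (|κ| : ℤ)) / T + η) := by
    intro j r g l hl h1 h2
    have e1 := h.cov_local T j (r + |κ|) (r - |κ|) _ hT h1.1 h2 (div_mem_regime hT h1.1)
    have e2 := hl _ (div_mem_regime hT h1.1)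
    have e3 : r + |κ| - (r - |κ|) = |2 * κ| := by
      rw [abs_mul, abs_two]
      ring
    rw [e3, localCov_abs, sub_self, abs_zero, add_zero] at e1
    have e4 : |((r - |κ| : ℤ) : ℝ) / T - ((r + |κ| : ℤ) : ℝ) / T| = 2 * (|κ| : ℤ) / T := by
      rw [← sub_div, abs_div, abs_of_pos hT']
      congr 1
      have : (0 : ℝ) ≤ (|κ| : ℤ) := by exact_mod_cast abs_nonneg κ
      rw [abs_sub_comm]
      push_cast at this ⊢
      rw [show (r : ℝ) + |(κ : ℝ)| - (r - |(κ : ℝ)|) = 2 * |(κ : ℝ)| by ring, abs_of_nonneg]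
      linarith
    rw [e4] at e1
    have e5 := abs_add_le (autoCov P V T (r + |κ|) (r - |κ|) -
      localCov A (((r + |κ| : ℤ) : ℝ) / T) (2 * κ))
      (localCov A (((r + |κ| : ℤ) : ℝ) / T) (2 * κ) - g)
    rw [sub_add_sub_cancel] at e5
    have e6 : C * (1 / (T : ℝ) + 2 * (|κ| : ℤ) / T) ≤ K * ((1 + 2 * (|κ| : ℤ)) / T) := by
      rw [← add_div]
      have : (0 : ℝ) ≤ (|κ| : ℤ) := by exact_mod_cast abs_nonneg κ
      refine mul_le_mul_of_nonneg_right (by linarith) (by positivity)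
    have e7 := mul_le_mul_of_nonneg_left h1.2 hK0
    linarith
  have ha : ∀ (j : Fin (m + 1)) (r : ℤ) (a l : ℝ),
      (∀ v ∈ regime lam j, |μ j v - a| ≤ K * |v - l|) →
      (r ∈ dates lam T j ∧ |(r : ℝ) / T - l| ≤ η) →
      |obsMean P V T r - a| ≤ K * ((1 + 2 * (|κ| : ℤ)) / T + η) := by
    intro j r a l hl h1
    rw [obsMean, h.mean T j r hT h1.1]
    have e2 := hl _ (div_mem_regime hT h1.1)
    have e7 := mul_le_mul_of_nonneg_left h1.2 hK0
    have e8 : 0 ≤ K * ((1 + 2 * (|κ| : ℤ)) / T) := by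
      have : (0 : ℝ) ≤ (|κ| : ℤ) := by exact_mod_cast abs_nonneg κ
      positivity
    linarith
  have := abs_winAvg_add_winCov_sub_le hN c κ hp0 hpN
    (G := fun r => autoCov P V T (r + |κ|) (r - |κ|)) (a := obsMean P V T) hε
    (fun r => (h.abs_autoCov_le T _ _).trans hKC) hg₁ hg₂ (hK T) ha₁ ha₂
    (fun r h1 h2 => hG j₁ r g₁ l₁ hgl₁ (hpre _ h1) (hpre _ h2).1)
    (fun r h1 h2 => hG j₂ r g₂ l₂ hgl₂ (hpost _ h1) (hpost _ h2).1)
    (fun r h1 => ha j₁ r a₁ l₁ hal₁ (hpre _ h1)) (fun r h1 => ha j₂ r a₂ l₂ hal₂ (hpost _ h1))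
  rw [winCentre]
  push_cast at this ⊢
  exact this

end WindowLimit

/-! ### Limits of the centring with and without a break -/

section LocalLimit

variable {Ω : Type*} [MeasurableSpace Ω] {P : Measure Ω}
  {m : ℕ} {lam : Fin (m + 2) → ℝ} {A : ℝ → ℝ → ℂ} {μ : Fin (m + 1) → ℝ → ℝ} {V : ℕ → ℕ → Ω → ℝ}
  {C K D : ℝ} {n₂ : ℕ → ℕ}

/-- Markov's inequality, after adding the deterministic error of the centring to the `L¹` error. -/
lemma eqInProbability_of_integral_le [IsProbabilityMeasure P] {X : ℕ → Ω → ℝ} {w b β : ℕ → ℝ}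
    (hβ : Tendsto β atTop (𝓝 0))
    (h : ∀ᶠ T in atTop, Integrable (fun x => X T x - w T) P ∧ ∫ x, |X T x - w T| ∂P ≤ β T)
    (hw : Tendsto (fun T => w T - b T) atTop (𝓝 0)) : EqInProbability P X b := by
  rw [EqInProbability, tendstoInMeasure_iff_measureReal_norm]
  intro ε hε
  have hlim : Tendsto (fun T => (β T + |w T - b T|) / ε) atTop (𝓝 0) := by
    simpa using (hβ.add hw.abs).div_const ε
  refine tendsto_of_tendsto_of_tendsto_of_le_of_le' tendsto_const_nhds hlim
    (Eventually.of_forall fun T => measureReal_nonneg) ?_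
  filter_upwards [h] with T hT
  have hi : Integrable (fun x => X T x - b T) P := by
    have := hT.1.add (integrable_const (w T - b T))
    refine this.congr (ae_of_all _ fun x => ?_)
    simp
  have h1 := mul_meas_ge_le_integral_of_nonneg (μ := P) (f := fun x => |X T x - b T|)
    (ae_of_all _ fun x => abs_nonneg _) hi.abs ε
  have h2 : ∫ x, |X T x - b T| ∂P ≤ ∫ x, (|X T x - w T| + |w T - b T|) ∂P := by
    refine integral_mono hi.abs (hT.1.abs.add (integrable_const _)) fun x => ?_
    have := abs_add_le (X T x - w T) (w T - b T)
    rwa [sub_add_sub_cancel] at this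
  rw [integral_add hT.1.abs (integrable_const _), integral_const] at h2
  simp only [probReal_univ, one_smul] at h2
  rw [le_div_iff₀ hε, mul_comm]
  simp only [sub_zero, Real.norm_eq_abs]
  linarith [hT.2]

lemma EqInProbability.ge [IsProbabilityMeasure P] {X : ℕ → Ω → ℝ} {b : ℕ → ℝ}
    (h : EqInProbability P X b) : GeInProbability P X b := by
  rw [EqInProbability, tendstoInMeasure_iff_norm] at h
  intro ε hε
  refine tendsto_of_tendsto_of_tendsto_of_le_of_le tendsto_const_nhds (h ε hε)
    (fun T => zero_le) fun T => measure_mono fun x hx => ?_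
  simp only [mem_ofPred_eq, sub_zero, Real.norm_eq_abs] at hx ⊢
  rw [abs_of_neg (by linarith)]
  linarith

/-- It is enough to control the centring of the sample local autocovariance. -/
lemma MomentBounds.eqInProbability_sampleLocalCov [IsProbabilityMeasure P]
    (h : MomentBounds P lam A μ V C) (hD : VarianceBounds P V D)
    (hK : ∀ T t, |obsMean P V T t| ≤ K) (hn₂ : Tendsto n₂ atTop atTop) (κ : ℤ) (u b : ℕ → ℝ)
    (hw : Tendsto (fun T : ℕ => winCentre P V (n₂ T) T (⌊(T : ℝ) * u T⌋ - (n₂ T : ℤ) / 2) |κ| - b T)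
      atTop (𝓝 0)) :
    EqInProbability P (fun T => sampleLocalCov V (n₂ T) T (u T) (2 * κ)) b := by
  obtain ⟨β, hβ, hbd⟩ := h.exists_winCov_concentration hD hK
  refine eqInProbability_of_integral_le (hβ.comp hn₂) ?_ hw
  filter_upwards [eventually_ge_atTop 1, hn₂.eventually_ge_atTop 1] with T hT hN
  have e : |2 * κ| / 2 = |κ| := by
    rw [abs_mul, abs_two]
    omega
  simp_rw [sampleLocalCov_eq, e]
  exact hbd T (n₂ T) _ _ hT hN

/-- The regimes share Lipschitz constants and bounds for trends and local autocovariances. -/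
structure RegimeBounds (lam : Fin (m + 2) → ℝ) (A : ℝ → ℝ → ℂ) (μ : Fin (m + 1) → ℝ → ℝ)
    (K : ℝ) : Prop where
  nonneg : 0 ≤ K
  cov_bound : ∀ j, ∀ u ∈ regime lam j, ∀ k : ℤ, |localCov A u k| ≤ K
  cov_lipschitz : ∀ j, ∀ u ∈ regime lam j, ∀ v ∈ regime lam j, ∀ k : ℤ,
    |localCov A u k - localCov A v k| ≤ K * |u - v|
  trend_bound : ∀ j, ∀ u ∈ regime lam j, |μ j u| ≤ K
  trend_lipschitz : ∀ j, ∀ u ∈ regime lam j, ∀ v ∈ regime lam j, |μ j u - μ j v| ≤ K * |u - v|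

lemma MomentBounds.exists_regimeBounds (h : MomentBounds P lam A μ V C)
    (hlam : IsBreakFractions lam) (hV : IsSLS P lam A μ V) :
    ∃ K, 2 * C ≤ K ∧ RegimeBounds lam A μ K := by
  obtain ⟨K, hK0, hK, hKL⟩ := hV.exists_trend_bounds hlam
  have hC := h.nonneg
  refine ⟨2 * C + K, by linarith, by linarith, fun j u hu k => ?_, fun j u hu v hv k => ?_,
    fun j u hu => ?_, fun j u hu v hv => ?_⟩
  · linarith [h.local_bound u (regime_subset hlam j hu) k]
  · exact (h.local_lipschitz j u hu v hv k).trans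
      (mul_le_mul_of_nonneg_right (by linarith) (abs_nonneg _))
  · linarith [hK j u hu]
  · exact (hKL j u hu v hv).trans (mul_le_mul_of_nonneg_right (by linarith) (abs_nonneg _))

lemma tendsto_window_div {n₂ : ℕ → ℕ} (hn₂T : Tendsto (fun T : ℕ => (n₂ T : ℝ) / T) atTop (𝓝 0))
    (a : ℝ) : Tendsto (fun T : ℕ => (n₂ T + a) / T) atTop (𝓝 0) := by
  have := hn₂T.add (tendsto_const_div_atTop_nhds_zero_nat a)
  simpa [add_div] using this

lemma tendsto_const_div_window {n₂ : ℕ → ℕ} (hn₂ : Tendsto n₂ atTop atTop) (a : ℝ) :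
    Tendsto (fun T : ℕ => a / (n₂ T : ℝ)) atTop (𝓝 0) :=
  (tendsto_const_div_atTop_nhds_zero_nat a).comp hn₂

lemma tendsto_windowError (hn₂ : Tendsto n₂ atTop atTop)
    (hn₂T : Tendsto (fun T : ℕ => (n₂ T : ℝ) / T) atTop (𝓝 0)) (κ : ℤ) (K a : ℝ) :
    Tendsto (fun T : ℕ => (1 + 6 * K) * (K * ((1 + 2 * (|κ| : ℤ)) / T + (n₂ T + a) / T) +
      16 * K * (|κ| : ℤ) / n₂ T)) atTop (𝓝 0) := by
  have h1 := ((((tendsto_const_div_atTop_nhds_zero_nat (1 + 2 * ((|κ| : ℤ) : ℝ))).add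
    (tendsto_window_div hn₂T a)).const_mul K).add
      (tendsto_const_div_window hn₂ (16 * K * (|κ| : ℤ)))).const_mul (1 + 6 * K)
  simpa using h1

lemma eventually_window_lt (hn₂T : Tendsto (fun T : ℕ => (n₂ T : ℝ) / T) atTop (𝓝 0)) (a : ℝ)
    {δ : ℝ} (hδ : 0 < δ) : ∀ᶠ T : ℕ in atTop, (n₂ T : ℝ) + a < T * δ := by
  filter_upwards [(tendsto_window_div hn₂T a).eventually (gt_mem_nhds hδ), eventually_ge_atTop 1]
    with T h1 hT
  have hT' : (0 : ℝ) < T := by exact_mod_cast hT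
  rw [div_lt_iff₀ hT'] at h1
  linarith

/-- A window without a break and away from the ends of the sample lies in one regime. -/
lemma tendsto_winCentre_of_no_break (h : MomentBounds P lam A μ V C) (hlam : IsBreakFractions lam)
    (hKC : 2 * C ≤ K) (hR : RegimeBounds lam A μ K) (hev : ∀ T, Even (n₂ T))
    (hn₂ : Tendsto n₂ atTop atTop) (hn₂T : Tendsto (fun T : ℕ => (n₂ T : ℝ) / T) atTop (𝓝 0))
    (κ : ℤ) {u : ℕ → ℝ} {δ : ℝ} (hδ : 0 < δ) (hu : ∀ T, u T ∈ Icc δ (1 - δ))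
    (hno : ∀ᶠ T : ℕ in atTop, ∀ j : Fin m, breakDate lam T j ∉
      Icc (winLo (n₂ T) T (u T) (2 * κ)) (winHi (n₂ T) T (u T) (2 * κ))) :
    Tendsto (fun T : ℕ => winCentre P V (n₂ T) T (⌊(T : ℝ) * u T⌋ - (n₂ T : ℤ) / 2) |κ| -
      localCov A (u T) (2 * κ)) atTop (𝓝 0) := by
  refine squeeze_zero_norm' ?_ (tendsto_windowError hn₂ hn₂T κ K ((|κ| : ℤ) + 1))
  filter_upwards [hno, eventually_window_lt hn₂T ((|κ| : ℤ) + 2) hδ, eventually_ge_atTop 1,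
    -- For such `N` the date `⌊Tu⌋` itself lies inside the window shifted by `κ`. A break outside
    -- the window and not after this date then lies to the left of the whole window, and
    -- symmetrically on the right.
    hn₂.eventually_ge_atTop (2 * κ.natAbs + 2)] with T hno hδT hT hN
  have hT' : (0 : ℝ) < T := by exact_mod_cast hT
  have hu0 : 0 < u T := hδ.trans_le (hu T).1
  have hu1 : u T ≤ 1 := (hu T).2.trans (by linarith)
  obtain ⟨j, hj⟩ := exists_regime hlam ⟨hu0, hu1⟩
  obtain ⟨M, hM⟩ := hev T
  set N := n₂ T with hNdef
  set f : ℤ := ⌊(T : ℝ) * u T⌋ with hf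
  have hf1 : (f : ℝ) ≤ T * u T := Int.floor_le _
  have hf2 : (T : ℝ) * u T < f + 1 := Int.lt_floor_add_one _
  have hκ1 : κ ≤ |κ| := le_abs_self κ
  have hκ2 : -|κ| ≤ κ := neg_abs_le κ
  have hκ3 : |κ| = κ.natAbs := Int.abs_eq_natAbs κ
  have hlo : (N : ℤ) + |κ| + 1 < f := by
    have : (N : ℝ) + (|κ| : ℤ) + 1 < f := by
      have := mul_le_mul_of_nonneg_left (hu T).1 hT'.le
      linarith
    exact_mod_cast this
  have hhi : f + N + |κ| + 2 < T := by
    have : (f : ℝ) + N + (|κ| : ℤ) + 2 < T := by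
      have := mul_le_mul_of_nonneg_left (hu T).2 hT'.le
      linarith
    exact_mod_cast this
  have hN2 : (N : ℤ) / 2 = M := by omega
  simp only [winLo, winHi, ← hf, hN2, mem_Icc, not_and, not_le] at hno
  rw [hN2, Real.norm_eq_abs]
  have hk2 : 2 * κ / 2 = κ := by omega
  rw [hk2] at hno
  -- The first regime has no break on its left; there the distance `δ` from the end of the sample is
  -- what keeps the window inside.
  have hjlo : ⌊(T : ℝ) * lam j.castSucc⌋ ≤ f - M + κ := by
    rcases Fin.eq_zero_or_eq_succ j with rfl | ⟨i, rfl⟩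
    · rw [Fin.castSucc_zero, hlam.first]
      simp
      omega
    · have h1 : breakDate lam T i ≤ f := Int.floor_le_floor (by gcongr; exact hj.1.le)
      have h2 := hno i
      change breakDate lam T i ≤ _
      by_contra hcon
      have := h2 (by omega)
      omega
  have hjhi : f - M + κ + N ≤ ⌊(T : ℝ) * lam j.succ⌋ := by
    rcases Fin.eq_castSucc_or_eq_last j with ⟨i, rfl⟩ | rfl
    · have h1 : f ≤ breakDate lam T i := Int.floor_le_floor (by gcongr; exact hj.2)
      have h2 := hno i (by omega)
      change _ ≤ breakDate lam T i
      omega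
    · rw [Fin.succ_last, hlam.last]
      simp
      omega
  have hdates : ∀ t ∈ Ioc (f - M + κ) (f - M + κ + N), t ∈ dates lam T j ∧
      |(t : ℝ) / T - u T| ≤ (N + ((|κ| : ℤ) + 1)) / T := by
    intro t ht
    refine ⟨⟨hjlo.trans_lt ht.1, ht.2.trans hjhi⟩, ?_⟩
    have e : (t : ℝ) / T - u T = (t - T * u T) / T := by field_simp
    rw [e, abs_div, abs_of_pos hT']
    refine div_le_div_of_nonneg_right ?_ hT'.le
    have h1 : (t : ℝ) ≤ f + N + (|κ| : ℤ) := by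
      have : t ≤ f + N + |κ| := by
        have := ht.2
        omega
      exact_mod_cast this
    have h2 : (f : ℝ) ≤ t + N + (|κ| : ℤ) := by
      have : f ≤ t + N + |κ| := by
        have := ht.1
        omega
      exact_mod_cast this
    rw [abs_le]
    constructor <;> linarith
  -- The cut is at `p = 0`: the first piece is empty and both pieces carry the same limits, so the
  -- jump term vanishes.
  have key := h.abs_winCentre_sub_le hKC (h.exists_obsMean_bound hlam hR.nonneg hR.trend_bound) hT
    (by omega : 1 ≤ N) (f - M) κ le_rfl (by omega) (j₁ := j) (j₂ := j) (l₁ := u T) (l₂ := u T)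
    (g₁ := localCov A (u T) (2 * κ)) (g₂ := localCov A (u T) (2 * κ)) (a₁ := μ j (u T))
    (a₂ := μ j (u T)) (η := (N + ((|κ| : ℤ) + 1)) / T)
    (by
      have : (0 : ℝ) ≤ (|κ| : ℤ) := by exact_mod_cast abs_nonneg κ
      positivity)
    (hR.cov_bound j _ hj _) (hR.cov_bound j _ hj _) (hR.trend_bound j _ hj)
    (hR.trend_bound j _ hj) (fun v hv => hR.cov_lipschitz j v hv _ hj _)
    (fun v hv => hR.cov_lipschitz j v hv _ hj _) (fun v hv => hR.trend_lipschitz j v hv _ hj)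
    (fun v hv => hR.trend_lipschitz j v hv _ hj) (fun t ht => by
      rw [add_zero] at ht
      exact absurd (ht.1.trans_le ht.2) (lt_irrefl _)) (fun t ht => by
      rw [add_zero] at ht
      exact hdates t ht)
  simpa using key

/-- The limit of the centring when the break splits the window in the ratio `γ : 1 - γ`. -/
lemma tendsto_winCentre_of_break (h : MomentBounds P lam A μ V C) (hlam : IsBreakFractions lam)
    (hKC : 2 * C ≤ K) (hR : RegimeBounds lam A μ K) (hev : ∀ T, Even (n₂ T))
    (hn₂ : Tendsto n₂ atTop atTop) (hn₂T : Tendsto (fun T : ℕ => (n₂ T : ℝ) / T) atTop (𝓝 0))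
    (κ : ℤ) {u : ℕ → ℝ} {j : Fin m} {γ : ℝ} (hin : BreakInWindow lam n₂ u (2 * κ) j)
    (hγ : LeftFraction lam n₂ u (2 * κ) j γ) :
    Tendsto (fun T : ℕ => winCentre P V (n₂ T) T (⌊(T : ℝ) * u T⌋ - (n₂ T : ℤ) / 2) |κ|) atTop
      (𝓝 (γ * localCov A (breakFrac lam j) (2 * κ) +
        (1 - γ) * Function.rightLim (fun v => localCov A v (2 * κ)) (breakFrac lam j) +
        γ * (1 - γ) * (μ j.castSucc (breakFrac lam j) -
          Function.rightLim (μ j.succ) (breakFrac lam j)) ^ 2)) := by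
  set l := breakFrac lam j with hl
  set g₁ := localCov A l (2 * κ)
  set g₂ := Function.rightLim (fun v => localCov A v (2 * κ)) l
  set a₁ := μ j.castSucc l
  set a₂ := Function.rightLim (μ j.succ) l
  -- The break date belongs to the regime before it, so the exact share of that regime in the window
  -- has one date more than the edge distance; the difference `1/N` is negligible.
  set α : ℕ → ℝ := fun T =>
    ((breakDate lam T j - winLo (n₂ T) T (u T) (2 * κ) + 1 : ℤ) : ℝ) / n₂ T with hα
  have hαγ : Tendsto α atTop (𝓝 γ) := by
    have := hγ.add (tendsto_const_div_window hn₂ 1)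
    rw [add_zero] at this
    refine this.congr fun T => ?_
    simp only [hα]
    push_cast
    ring
  have hlim : Tendsto (fun T => α T * g₁ + (1 - α T) * g₂ + α T * (1 - α T) * (a₁ - a₂) ^ 2) atTop
      (𝓝 (γ * g₁ + (1 - γ) * g₂ + γ * (1 - γ) * (a₁ - a₂) ^ 2)) :=
    ((hαγ.mul_const _).add ((hαγ.const_sub 1).mul_const _)).add
      ((hαγ.mul (hαγ.const_sub 1)).mul_const _)
  have hl₁ : l ∈ regime lam j.castSucc := lam_succ_mem_regime hlam j.castSucc
  have hlt₁ : lam j.castSucc.castSucc < l := hl₁.1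
  have hlt₂ : l < lam j.succ.succ := hlam.strictMono Fin.castSucc_lt_succ
  have hdiff : Tendsto (fun T : ℕ => winCentre P V (n₂ T) T
      (⌊(T : ℝ) * u T⌋ - (n₂ T : ℤ) / 2) |κ| -
      (α T * g₁ + (1 - α T) * g₂ + α T * (1 - α T) * (a₁ - a₂) ^ 2)) atTop (𝓝 0) := by
    refine squeeze_zero_norm' ?_ (tendsto_windowError hn₂ hn₂T κ K 1)
    -- Eventually the window is shorter than both regimes adjacent to the break, so it meets no
    -- other regime.
    filter_upwards [hin, eventually_window_lt hn₂T 1 (sub_pos.2 hlt₁),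
      eventually_window_lt hn₂T 1 (sub_pos.2 hlt₂), eventually_ge_atTop 1,
      hn₂.eventually_ge_atTop 1] with T hin hT₁ hT₂ hT hN
    have hT' : (0 : ℝ) < T := by exact_mod_cast hT
    obtain ⟨M, hM⟩ := hev T
    set N := n₂ T with hNdef
    set f : ℤ := ⌊(T : ℝ) * u T⌋ with hf
    have hN2 : (N : ℤ) / 2 = M := by omega
    have hk2 : 2 * κ / 2 = κ := by omega
    simp only [winLo, winHi, ← hf, hN2, hk2, mem_Icc] at hin
    set p : ℤ := breakDate lam T j - (f + κ - M + 1) + 1 with hp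
    have hαT : α T = (p : ℝ) / N := by simp only [hα, winLo, ← hf, ← hNdef, hN2, hk2, hp]
    have hq : f - M + κ + p = breakDate lam T j := by omega
    have hq1 : (breakDate lam T j : ℝ) ≤ T * l := Int.floor_le _
    have hq2 : (T : ℝ) * l < breakDate lam T j + 1 := Int.lt_floor_add_one _
    have hnear : ∀ t ∈ Ioc (f - M + κ) (f - M + κ + N), |(t : ℝ) / T - l| ≤ (N + 1) / T := by
      intro t ht
      have e : (t : ℝ) / T - l = (t - T * l) / T := by field_simp
      rw [e, abs_div, abs_of_pos hT']
      refine div_le_div_of_nonneg_right ?_ hT'.le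
      have h1 : (t : ℝ) ≤ breakDate lam T j + N := by
        have : t ≤ breakDate lam T j + N := by
          have := ht.2
          omega
        exact_mod_cast this
      have h2 : (breakDate lam T j : ℝ) ≤ t + N := by
        have : breakDate lam T j ≤ t + N := by
          have := ht.1
          omega
        exact_mod_cast this
      rw [abs_le]
      constructor <;> linarith
    rw [hN2, Real.norm_eq_abs, hαT]
    refine h.abs_winCentre_sub_le hKC (h.exists_obsMean_bound hlam hR.nonneg hR.trend_bound) hT
      hN (f - M) κ (p := p) (by omega) (by omega) (j₁ := j.castSucc) (j₂ := j.succ) (l₁ := l)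
      (l₂ := l) (η := (N + 1) / T) (by positivity)
      (hR.cov_bound _ _ hl₁ _)
      (abs_rightLim_le (fun x hx y hy => hR.cov_lipschitz _ x hx y hy _) hlt₂
        fun x hx => hR.cov_bound _ x hx _) (hR.trend_bound _ _ hl₁)
      (abs_rightLim_le (hR.trend_lipschitz _) hlt₂ (hR.trend_bound _))
      (fun v hv => hR.cov_lipschitz _ v hv _ hl₁ _)
      (fun v hv => abs_sub_rightLim_le (fun x hx y hy => hR.cov_lipschitz _ x hx y hy _) hv)
      (fun v hv => hR.trend_lipschitz _ v hv _ hl₁)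
      (fun v hv => abs_sub_rightLim_le (hR.trend_lipschitz _) hv) ?_ ?_
    · intro t ht
      refine ⟨⟨?_, ?_⟩, hnear t ⟨ht.1, by have := ht.2; omega⟩⟩
      · rw [Int.floor_lt]
        have h2 : (breakDate lam T j : ℝ) ≤ t + N := by
          have : breakDate lam T j ≤ t + N := by
            have := ht.1
            omega
          exact_mod_cast this
        rw [mul_sub] at hT₁
        linarith
      · exact ht.2.trans (le_of_eq hq)
    · intro t ht
      refine ⟨⟨?_, ?_⟩, hnear t ⟨by have := ht.1; omega, ht.2⟩⟩
      · exact lt_of_eq_of_lt hq.symm ht.1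
      · rw [Int.le_floor]
        have h2 : (t : ℝ) ≤ breakDate lam T j + N := by
          have : t ≤ breakDate lam T j + N := by
            have := ht.2
            omega
          exact_mod_cast this
        rw [mul_sub] at hT₂
        linarith
  simpa using hdiff.add hlim

end LocalLimit

/-! ### Limit theorems for a single window -/

section BreakLimit

variable {Ω : Type*} [MeasurableSpace Ω] {P : Measure Ω}
  {m : ℕ} {lam : Fin (m + 2) → ℝ} {A : ℝ → ℝ → ℂ} {μ : Fin (m + 1) → ℝ → ℝ} {V : ℕ → ℕ → Ω → ℝ}
  {C K D : ℝ} {n₂ : ℕ → ℕ} {κ : ℤ} {u : ℕ → ℝ} {j : Fin m}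

/-- A point whose local window contains a break tends to the break fraction. -/
lemma BreakInWindow.tendsto (hin : BreakInWindow lam n₂ u (2 * κ) j)
    (hn₂T : Tendsto (fun T : ℕ => (n₂ T : ℝ) / T) atTop (𝓝 0)) :
    Tendsto u atTop (𝓝 (breakFrac lam j)) := by
  rw [tendsto_iff_norm_sub_tendsto_zero]
  refine squeeze_zero' (Eventually.of_forall fun T => norm_nonneg _) ?_
    (tendsto_window_div hn₂T ((|κ| : ℤ) + 3))
  filter_upwards [hin, eventually_ge_atTop 1] with T hin hT
  have hT' : (0 : ℝ) < T := by exact_mod_cast hT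
  have hk2 : 2 * κ / 2 = κ := by omega
  simp only [winLo, winHi, hk2, mem_Icc] at hin
  set f : ℤ := ⌊(T : ℝ) * u T⌋ with hf
  have hf1 : (f : ℝ) ≤ T * u T := Int.floor_le _
  have hf2 : (T : ℝ) * u T < f + 1 := Int.lt_floor_add_one _
  have hq1 : (breakDate lam T j : ℝ) ≤ T * breakFrac lam j := Int.floor_le _
  have hq2 : (T : ℝ) * breakFrac lam j < breakDate lam T j + 1 := Int.lt_floor_add_one _
  have hκ1 : κ ≤ |κ| := le_abs_self κ
  have hκ2 : -|κ| ≤ κ := neg_abs_le κ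
  have h1 : (breakDate lam T j : ℝ) ≤ f + n₂ T + (|κ| : ℤ) := by
    have : breakDate lam T j ≤ f + n₂ T + |κ| := by omega
    exact_mod_cast this
  have h2 : (f : ℝ) ≤ breakDate lam T j + n₂ T + (|κ| : ℤ) := by
    have : f ≤ breakDate lam T j + n₂ T + |κ| := by omega
    exact_mod_cast this
  have e : u T - breakFrac lam j = (T * u T - T * breakFrac lam j) / T := by field_simp
  rw [e, Real.norm_eq_abs, abs_div, abs_of_pos hT']
  refine div_le_div_of_nonneg_right ?_ hT'.le
  rw [abs_le]
  constructor <;> linarith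

/-- An even `N` makes the window consist of exactly `N` dates, so the distances from the two edges
add up to `N`. All statements thereby reduce to the left edge. -/
lemma LeftFraction.of_right {γ : ℝ} (hev : ∀ T, Even (n₂ T)) (hn₂ : Tendsto n₂ atTop atTop)
    (h : RightFraction lam n₂ u (2 * κ) j γ) : LeftFraction lam n₂ u (2 * κ) j (1 - γ) := by
  refine (h.const_sub 1).congr' ?_
  filter_upwards [hn₂.eventually_ge_atTop 1] with T hN
  have hN' : (n₂ T : ℝ) ≠ 0 := by exact_mod_cast (by omega : n₂ T ≠ 0)
  obtain ⟨M, hM⟩ := hev T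
  have e : ((winHi (n₂ T) T (u T) (2 * κ) : ℤ) : ℝ) + 1 =
      winLo (n₂ T) T (u T) (2 * κ) + n₂ T := by
    have : winHi (n₂ T) T (u T) (2 * κ) + 1 = winLo (n₂ T) T (u T) (2 * κ) + n₂ T := by
      simp only [winHi, winLo]
      omega
    exact_mod_cast this
  rw [e]
  field_simp
  ring

/-- A break near the left edge of the window lies before its centre. -/
lemma LeftFraction.eventually_lt (h : LeftFraction lam n₂ u (2 * κ) j 0) (hev : ∀ T, Even (n₂ T))
    (hn₂ : Tendsto n₂ atTop atTop) : ∀ᶠ T : ℕ in atTop, breakFrac lam j < u T := by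
  -- A break in the first quarter of the window precedes its centre date, which sits `N / 2` from
  -- the edge up to the offset `κ`; the lower bound on `N` absorbs that offset.
  filter_upwards [h.eventually (gt_mem_nhds (show (0 : ℝ) < 1 / 4 by norm_num)),
    hn₂.eventually_ge_atTop (4 * κ.natAbs + 8)] with T h1 hN
  have hN' : (0 : ℝ) < n₂ T := by exact_mod_cast (by omega : 0 < n₂ T)
  obtain ⟨M, hM⟩ := hev T
  rw [div_lt_iff₀ hN'] at h1
  have h2 : 4 * (breakDate lam T j - winLo (n₂ T) T (u T) (2 * κ)) < n₂ T := by
    have : (4 : ℝ) * (breakDate lam T j - winLo (n₂ T) T (u T) (2 * κ)) < n₂ T := by linarith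
    exact_mod_cast this
  simp only [winLo] at h2
  have h3 : breakDate lam T j < ⌊(T : ℝ) * u T⌋ := by omega
  by_contra! hcon
  exact absurd h3 (not_lt.2 (Int.floor_le_floor (by gcongr)))

/-- A break near the right edge of the window lies after its centre. -/
lemma LeftFraction.eventually_le (h : LeftFraction lam n₂ u (2 * κ) j 1) (hev : ∀ T, Even (n₂ T))
    (hn₂ : Tendsto n₂ atTop atTop) : ∀ᶠ T : ℕ in atTop, u T ≤ breakFrac lam j := by
  filter_upwards [h.eventually (lt_mem_nhds (show (3 / 4 : ℝ) < 1 by norm_num)),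
    hn₂.eventually_ge_atTop (4 * κ.natAbs + 8)] with T h1 hN
  have hN' : (0 : ℝ) < n₂ T := by exact_mod_cast (by omega : 0 < n₂ T)
  obtain ⟨M, hM⟩ := hev T
  rw [lt_div_iff₀ hN'] at h1
  have h2 : 3 * (n₂ T : ℤ) < 4 * (breakDate lam T j - winLo (n₂ T) T (u T) (2 * κ)) := by
    have : 3 * (n₂ T : ℝ) < 4 * (breakDate lam T j - winLo (n₂ T) T (u T) (2 * κ)) := by linarith
    exact_mod_cast this
  simp only [winLo] at h2
  have h3 : ⌊(T : ℝ) * u T⌋ < breakDate lam T j := by omega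
  by_contra! hcon
  exact absurd h3 (not_lt.2 (Int.floor_le_floor (by gcongr)))

lemma tendsto_abs_mul_sub {l : ℝ} (hu : Tendsto u atTop (𝓝 l)) :
    Tendsto (fun T => K * |u T - l|) atTop (𝓝 0) := by
  have := (hu.sub_const l).abs.const_mul K
  simpa using this

/-- The conditional evaluates `f` only to the right of `a`, where it is within `K |u - a|` of the
right-hand limit; in the other branch it is that limit. -/
lemma tendsto_postBreak {f : ℝ → ℝ} {a b : ℝ} (hab : a < b)
    (hf : ∀ x ∈ Ioc a b, ∀ y ∈ Ioc a b, |f x - f y| ≤ K * |x - y|) (hu : Tendsto u atTop (𝓝 a)) :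
    Tendsto (fun T => postBreak f a (u T)) atTop (𝓝 (Function.rightLim f a)) := by
  rw [tendsto_iff_norm_sub_tendsto_zero]
  have hK : 0 ≤ K := by
    have h1 := hf b ⟨hab, le_rfl⟩ ((a + b) / 2) ⟨by linarith, by linarith⟩
    have h2 : 0 < |b - (a + b) / 2| := abs_pos.2 (by linarith)
    exact nonneg_of_mul_nonneg_left ((abs_nonneg _).trans h1) h2
  refine squeeze_zero' (Eventually.of_forall fun T => norm_nonneg _) ?_ (tendsto_abs_mul_sub (K := K) hu)
  filter_upwards [hu.eventually (gt_mem_nhds hab)] with T hT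
  rw [postBreak, Real.norm_eq_abs]
  split_ifs with h
  · exact abs_sub_rightLim_le hf ⟨h, hT.le⟩
  · rw [sub_self, abs_zero]
    positivity

lemma tendsto_preBreak {f : ℝ → ℝ} {a b : ℝ} (hab : a < b)
    (hf : ∀ x ∈ Ioc a b, ∀ y ∈ Ioc a b, |f x - f y| ≤ K * |x - y|) (hu : Tendsto u atTop (𝓝 b)) :
    Tendsto (fun T => preBreak f b (u T)) atTop (𝓝 (f b)) := by
  rw [tendsto_iff_norm_sub_tendsto_zero]
  have hK : 0 ≤ K := by
    have h1 := hf b ⟨hab, le_rfl⟩ ((a + b) / 2) ⟨by linarith, by linarith⟩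
    have h2 : 0 < |b - (a + b) / 2| := abs_pos.2 (by linarith)
    exact nonneg_of_mul_nonneg_left ((abs_nonneg _).trans h1) h2
  refine squeeze_zero' (Eventually.of_forall fun T => norm_nonneg _) ?_ (tendsto_abs_mul_sub (K := K) hu)
  filter_upwards [hu.eventually (lt_mem_nhds hab)] with T hT
  rw [preBreak, Real.norm_eq_abs]
  split_ifs with h
  · exact hf _ ⟨hT, h⟩ _ ⟨hab, le_rfl⟩
  · rw [sub_self, abs_zero]
    positivity

lemma lam_lt_breakFrac (hlam : IsBreakFractions lam) (j : Fin m) :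
    lam j.castSucc.castSucc < breakFrac lam j :=
  (lam_succ_mem_regime hlam j.castSucc).1

lemma breakFrac_lt_lam (hlam : IsBreakFractions lam) (j : Fin m) :
    breakFrac lam j < lam j.succ.succ :=
  hlam.strictMono Fin.castSucc_lt_succ

/-- Both differences of trends across a break have the same limit. -/
lemma RegimeBounds.tendsto_meanGapLeft (hR : RegimeBounds lam A μ K) (hlam : IsBreakFractions lam)
    (hu : Tendsto u atTop (𝓝 (breakFrac lam j))) :
    Tendsto (fun T => meanGapLeft lam μ j (u T)) atTop
      (𝓝 (μ j.castSucc (breakFrac lam j) - Function.rightLim (μ j.succ) (breakFrac lam j))) :=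
  (tendsto_postBreak (breakFrac_lt_lam hlam j) (hR.trend_lipschitz j.succ) hu).const_sub _

lemma RegimeBounds.tendsto_meanGapRight (hR : RegimeBounds lam A μ K)
    (hlam : IsBreakFractions lam) (hu : Tendsto u atTop (𝓝 (breakFrac lam j))) :
    Tendsto (fun T => meanGapRight lam μ j (u T)) atTop
      (𝓝 (μ j.castSucc (breakFrac lam j) - Function.rightLim (μ j.succ) (breakFrac lam j))) :=
  (tendsto_preBreak (lam_lt_breakFrac hlam j) (hR.trend_lipschitz j.castSucc) hu).sub_const _

lemma sub_tendsto_zero {a b : ℕ → ℝ} {l : ℝ} (ha : Tendsto a atTop (𝓝 l))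
    (hb : Tendsto b atTop (𝓝 l)) : Tendsto (fun T => a T - b T) atTop (𝓝 0) := by
  simpa using ha.sub hb

variable [IsProbabilityMeasure P]

/-- The sample local autocovariance at a window without breaks. -/
theorem MomentBounds.sampleLocalCov_of_no_break (h : MomentBounds P lam A μ V C)
    (hD : VarianceBounds P V D) (hlam : IsBreakFractions lam) (hKC : 2 * C ≤ K)
    (hR : RegimeBounds lam A μ K) (hev : ∀ T, Even (n₂ T))
    (hn₂ : Tendsto n₂ atTop atTop) (hn₂T : Tendsto (fun T : ℕ => (n₂ T : ℝ) / T) atTop (𝓝 0))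
    {δ : ℝ} (hδ : 0 < δ) (hu : ∀ T, u T ∈ Icc δ (1 - δ))
    (hno : ∀ᶠ T : ℕ in atTop, ∀ j : Fin m, breakDate lam T j ∉
      Icc (winLo (n₂ T) T (u T) (2 * κ)) (winHi (n₂ T) T (u T) (2 * κ))) :
    EqInProbability P (fun T => sampleLocalCov V (n₂ T) T (u T) (2 * κ))
      (fun T => localCov A (u T) (2 * κ)) :=
  h.eqInProbability_sampleLocalCov hD (h.exists_obsMean_bound hlam hR.nonneg hR.trend_bound) hn₂ κ
    u _ (tendsto_winCentre_of_no_break h hlam hKC hR hev hn₂ hn₂T κ hδ hu hno)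

/-- The sample local autocovariance at a window with a break. -/
theorem MomentBounds.sampleLocalCov_of_break (h : MomentBounds P lam A μ V C)
    (hD : VarianceBounds P V D) (hlam : IsBreakFractions lam) (hKC : 2 * C ≤ K)
    (hR : RegimeBounds lam A μ K) (hev : ∀ T, Even (n₂ T))
    (hn₂ : Tendsto n₂ atTop atTop) (hn₂T : Tendsto (fun T : ℕ => (n₂ T : ℝ) / T) atTop (𝓝 0))
    (hin : BreakInWindow lam n₂ u (2 * κ) j) :
    (∀ γ : ℝ,
      (LeftFraction lam n₂ u (2 * κ) j γ →
        EqInProbability P (fun T => sampleLocalCov V (n₂ T) T (u T) (2 * κ))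
          (fun T => γ * localCov A (breakFrac lam j) (2 * κ) +
            (1 - γ) * postBreak (fun v => localCov A v (2 * κ)) (breakFrac lam j) (u T) +
            γ * (1 - γ) * meanGapLeft lam μ j (u T) ^ 2)) ∧
      (RightFraction lam n₂ u (2 * κ) j γ →
        EqInProbability P (fun T => sampleLocalCov V (n₂ T) T (u T) (2 * κ))
          (fun T => γ * Function.rightLim (fun v => localCov A v (2 * κ)) (breakFrac lam j) +
            (1 - γ) * preBreak (fun v => localCov A v (2 * κ)) (breakFrac lam j) (u T) +
            γ * (1 - γ) * meanGapRight lam μ j (u T) ^ 2))) ∧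
    (LeftFraction lam n₂ u (2 * κ) j 0 ∨ RightFraction lam n₂ u (2 * κ) j 0 →
      EqInProbability P (fun T => sampleLocalCov V (n₂ T) T (u T) (2 * κ))
        (fun T => localCov A (u T) (2 * κ))) := by
  have hut := hin.tendsto hn₂T
  have hob := h.exists_obsMean_bound hlam hR.nonneg hR.trend_bound
  have hpost : Tendsto (fun T => postBreak (fun v => localCov A v (2 * κ)) (breakFrac lam j) (u T))
      atTop (𝓝 (Function.rightLim (fun v => localCov A v (2 * κ)) (breakFrac lam j))) :=
    tendsto_postBreak (breakFrac_lt_lam hlam j)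
      (fun x hx y hy => hR.cov_lipschitz j.succ x hx y hy _) hut
  have hpre : Tendsto (fun T => preBreak (fun v => localCov A v (2 * κ)) (breakFrac lam j) (u T))
      atTop (𝓝 (localCov A (breakFrac lam j) (2 * κ))) :=
    tendsto_preBreak (f := fun v => localCov A v (2 * κ)) (lam_lt_breakFrac hlam j)
      (fun x hx y hy => hR.cov_lipschitz j.castSucc x hx y hy _) hut
  -- The centring converges to a constant, so any deterministic sequence with that limit may replace
  -- it. The various forms at `u T` or at the break fraction are such sequences.
  have key : ∀ (γ : ℝ), LeftFraction lam n₂ u (2 * κ) j γ → ∀ b : ℕ → ℝ,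
      Tendsto b atTop (𝓝 (γ * localCov A (breakFrac lam j) (2 * κ) +
        (1 - γ) * Function.rightLim (fun v => localCov A v (2 * κ)) (breakFrac lam j) +
        γ * (1 - γ) * (μ j.castSucc (breakFrac lam j) -
          Function.rightLim (μ j.succ) (breakFrac lam j)) ^ 2)) →
      EqInProbability P (fun T => sampleLocalCov V (n₂ T) T (u T) (2 * κ)) b :=
    fun γ hγ b hb => h.eqInProbability_sampleLocalCov hD hob hn₂ κ u b
      (sub_tendsto_zero (tendsto_winCentre_of_break h hlam hKC hR hev hn₂ hn₂T κ hin hγ) hb)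
  refine ⟨fun γ => ⟨fun hγ => key γ hγ _ ?_, fun hγ => key (1 - γ) (.of_right hev hn₂ hγ) _ ?_⟩, ?_⟩
  · exact ((tendsto_const_nhds).add (hpost.const_mul _)).add
      (((hR.tendsto_meanGapLeft hlam hut).pow 2).const_mul _)
  · have := ((tendsto_const_nhds (x := γ * Function.rightLim (fun v => localCov A v (2 * κ))
      (breakFrac lam j))).add (hpre.const_mul (1 - γ))).add
      (((hR.tendsto_meanGapRight hlam hut).pow 2).const_mul (γ * (1 - γ)))
    refine this.trans (le_of_eq ?_)
    congr 1
    ring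
  -- At the left edge the weight is `γ = 0` and the point eventually lies beyond the break, so
  -- `postBreak` is the value at `u T`. At the right edge the weight is `γ = 1`, the point
  -- eventually lies at or before the break, and `preBreak` takes over.
  · rintro (h0 | h0)
    · refine key 0 h0 _ ?_
      simp only [zero_mul, zero_add, sub_zero, one_mul, add_zero]
      refine hpost.congr' ?_
      filter_upwards [h0.eventually_lt hev hn₂] with T hT
      rw [postBreak, if_pos hT]
    · have h1 : LeftFraction lam n₂ u (2 * κ) j 1 := by
        simpa using LeftFraction.of_right hev hn₂ h0
      refine key 1 h1 _ ?_
      simp only [sub_self, zero_mul, mul_zero, one_mul, add_zero]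
      refine hpre.congr' ?_
      filter_upwards [h1.eventually_le hev hn₂] with T hT
      rw [preBreak, if_pos hT]

end BreakLimit

/-! ### Averages over blocks of overlapping windows -/

section Blocks

/-- The average over the blocks `1, …, T / n`. -/
def blockAvg (n T : ℕ) (F : ℕ → ℝ) : ℝ := (n : ℝ) / T * ∑ r ∈ Finset.Icc 1 (T / n), F r

lemma blockAvg_mono {n T : ℕ} {F G : ℕ → ℝ} (h : ∀ r, F r ≤ G r) :
    blockAvg n T F ≤ blockAvg n T G :=
  mul_le_mul_of_nonneg_left (Finset.sum_le_sum fun r _ => h r) (by positivity)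

lemma blockAvg_add (n T : ℕ) (F G : ℕ → ℝ) :
    blockAvg n T (fun r => F r + G r) = blockAvg n T F + blockAvg n T G := by
  simp only [blockAvg, Finset.sum_add_distrib, mul_add]

lemma blockAvg_sub (n T : ℕ) (F G : ℕ → ℝ) :
    blockAvg n T (fun r => F r - G r) = blockAvg n T F - blockAvg n T G := by
  simp only [blockAvg, Finset.sum_sub_distrib, mul_sub]

lemma blockAvg_const_mul (n T : ℕ) (a : ℝ) (F : ℕ → ℝ) :
    blockAvg n T (fun r => a * F r) = a * blockAvg n T F := by
  simp only [blockAvg, ← Finset.mul_sum]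
  ring

lemma blockAvg_const_le {n T : ℕ} (hT : 1 ≤ T) {a : ℝ} (ha : 0 ≤ a) :
    blockAvg n T (fun _ => a) ≤ a := by
  have hT' : (0 : ℝ) < T := by exact_mod_cast hT
  have h : (n : ℝ) * (T / n : ℕ) ≤ T := by exact_mod_cast Nat.mul_div_le T n
  simp only [blockAvg, Finset.sum_const, Nat.card_Icc, add_tsub_cancel_right, nsmul_eq_mul]
  calc (n : ℝ) / T * ((T / n : ℕ) * a) = ((n : ℝ) * (T / n : ℕ)) * a / T := by ring
    _ ≤ T * a / T := by gcongr
    _ = a := by field_simp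

/-- The number of blocks `1, …, R` of length `n` whose window of length `N` contains `s`. -/
def coverCount (n N R : ℕ) (s : ℤ) : ℕ :=
  ((Finset.Icc 1 R).filter fun r : ℕ =>
    s ∈ Finset.Ioc ((r : ℤ) * n - (N : ℤ) / 2) ((r : ℤ) * n - (N : ℤ) / 2 + N)).card

/-- The window of block `r` contains `s` exactly if `r n` is one of the `N` consecutive integers
from `s - N/2` to `s + N/2 - 1`, and at most `N / n + 1` of those are multiples of `n`. -/
lemma coverCount_le {n N R : ℕ} (hn : 1 ≤ n) (hN : Even N) (s : ℤ) :
    (n : ℝ) * coverCount n N R s ≤ N + n := by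
  obtain ⟨M, hM⟩ := hN
  have hn' : (0 : ℤ) < n := by exact_mod_cast hn
  have hcard : coverCount n N R s ≤
      (Finset.Ioc ((s - M - 1) / (n : ℤ)) ((s + M - 1) / (n : ℤ))).card := by
    refine Finset.card_le_card_of_injOn (fun r : ℕ => (r : ℤ)) ?_ fun a _ b _ hab =>
      Nat.cast_injective (R := ℤ) hab
    intro r hr
    simp only [Finset.coe_filter, mem_ofPred_eq, Finset.mem_Ioc] at hr
    simp only [Finset.coe_Ioc, mem_Ioc]
    constructor
    · rw [Int.ediv_lt_iff_lt_mul hn']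
      omega
    · rw [Int.le_ediv_iff_mul_le hn']
      omega
  rw [Int.card_Ioc] at hcard
  have h1 := Int.mul_ediv_self_le (x := s + M - 1) (k := (n : ℤ)) hn'.ne'
  have h2 := Int.lt_mul_ediv_self_add (x := s - M - 1) (k := (n : ℤ)) hn'
  have h3 : (n : ℤ) * coverCount n N R s ≤ N + n := by
    have h4 : (coverCount n N R s : ℤ) ≤ max ((s + M - 1) / (n : ℤ) - (s - M - 1) / (n : ℤ)) 0 := by
      omega
    rcases max_cases ((s + M - 1) / (n : ℤ) - (s - M - 1) / (n : ℤ)) 0 with h5 | h5 <;>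
      rw [h5.1] at h4 <;> nlinarith
  exact_mod_cast h3

/-- Away from the ends of the sample, all multiples of `n` counted here have an index between `1`
and `T / n`, so none is lost. -/
lemma le_coverCount {n N T : ℕ} (hn : 1 ≤ n) (hN : Even N) {s : ℤ} (h1 : (N : ℤ) / 2 + 1 ≤ s)
    (h2 : s + (N : ℤ) / 2 ≤ T + 1) : (N : ℝ) - n ≤ n * coverCount n N (T / n) s := by
  obtain ⟨M, hM⟩ := hN
  have hn' : (0 : ℤ) < n := by exact_mod_cast hn
  have hN2 : (N : ℤ) / 2 = M := by omega
  rw [hN2] at h1 h2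
  have ha : 0 ≤ (s - M - 1) / (n : ℤ) := Int.ediv_nonneg (by omega) hn'.le
  have hb : (s + M - 1) / (n : ℤ) ≤ (T / n : ℕ) := by
    push_cast
    exact Int.ediv_le_ediv hn' (by omega)
  have hcard : (Finset.Ioc ((s - M - 1) / (n : ℤ)) ((s + M - 1) / (n : ℤ))).card ≤
      coverCount n N (T / n) s := by
    refine Finset.card_le_card_of_injOn (fun r : ℤ => r.toNat) ?_ ?_
    · intro r hr
      simp only [Finset.coe_Ioc, mem_Ioc] at hr
      have hr0 : ((r.toNat : ℕ) : ℤ) = r := by omega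
      have e1 := (Int.ediv_lt_iff_lt_mul hn').1 hr.1
      have e2 := (Int.le_ediv_iff_mul_le hn').1 hr.2
      simp only [Finset.coe_filter, mem_ofPred_eq, Finset.mem_Ioc, Finset.mem_Icc, hr0, hN2]
      omega
    · intro r hr r' hr' hrr
      simp only [Finset.coe_Ioc, mem_Ioc] at hr hr'
      dsimp only at hrr
      omega
  rw [Int.card_Ioc] at hcard
  have e1 := Int.lt_mul_ediv_self_add (x := s + M - 1) (k := (n : ℤ)) hn'
  have e2 := Int.mul_ediv_self_le (x := s - M - 1) (k := (n : ℤ)) hn'.ne'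
  have e3 : (N : ℤ) - n ≤ n * coverCount n N (T / n) s := by
    have : (s + M - 1) / (n : ℤ) - (s - M - 1) / (n : ℤ) ≤ coverCount n N (T / n) s := by omega
    nlinarith
  exact_mod_cast e3

lemma summable_coverCount_mul {f : ℤ → ℝ} (hf : Summable f) (n N R : ℕ) :
    Summable fun s => (coverCount n N R s : ℝ) * f s := by
  refine Summable.of_norm_bounded (hf.norm.mul_left (R : ℝ)) fun s => ?_
  rw [norm_mul, RCLike.norm_natCast]
  refine mul_le_mul_of_nonneg_right ?_ (norm_nonneg _)
  have : coverCount n N R s ≤ R := by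
    refine (Finset.card_filter_le _ _).trans ?_
    simp
  exact_mod_cast this

/-- Exchanging the sums gives a weighted sum over dates whose weights, covering number times `n /
N`, are close to one in the bulk. Infinite sums make shifts of the index free of boundary terms. -/
lemma blockAvg_winAvg_eq (f : ℤ → ℝ) (n N T : ℕ) :
    blockAvg n T (fun r => winAvg N ((r : ℤ) * n - (N : ℤ) / 2) f) =
      (T : ℝ)⁻¹ * ∑' s, (n : ℝ) * coverCount n N (T / n) s / N * f s := by
  have h1 : ∀ I : Finset ℤ, ∑ s ∈ I, f s = ∑' s, if s ∈ I then f s else 0 := by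
    intro I
    rw [tsum_eq_sum (s := I) fun b hb => if_neg hb]
    exact Finset.sum_congr rfl fun s hs => (if_pos hs).symm
  have h2 : ∀ I : Finset ℤ, Summable fun s => if s ∈ I then f s else 0 := fun I =>
    summable_of_ne_finset_zero (s := I) fun b hb => if_neg hb
  have h3 : ∑ r ∈ Finset.Icc 1 (T / n), ∑ s ∈ Finset.Ioc ((r : ℤ) * n - (N : ℤ) / 2)
      ((r : ℤ) * n - (N : ℤ) / 2 + N), f s = ∑' s, (coverCount n N (T / n) s : ℝ) * f s := by
    simp_rw [h1]
    rw [← Summable.tsum_finsetSum fun r _ => h2 _]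
    refine tsum_congr fun s => ?_
    rw [← Finset.sum_filter, Finset.sum_const, nsmul_eq_mul, coverCount]
  have h4 : ∀ s, (n : ℝ) * coverCount n N (T / n) s / N * f s =
      ((n : ℝ) / N) * ((coverCount n N (T / n) s : ℝ) * f s) := fun s => by ring
  simp_rw [h4]
  rw [tsum_mul_left, ← h3]
  simp only [blockAvg, winAvg, ← Finset.mul_sum]
  ring

/-- Overlapping windows cover each date about `N / n` times, at most. -/
lemma blockAvg_winAvg_le {f : ℤ → ℝ} (hf : Summable f) (hf0 : ∀ s, 0 ≤ f s) {n N T : ℕ}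
    (hn : 1 ≤ n) (hN : Even N) (hN1 : 1 ≤ N) :
    blockAvg n T (fun r => winAvg N ((r : ℤ) * n - (N : ℤ) / 2) f) ≤
      (1 + (n : ℝ) / N) * ((T : ℝ)⁻¹ * ∑' s, f s) := by
  have hN' : (0 : ℝ) < N := by exact_mod_cast hN1
  rw [blockAvg_winAvg_eq]
  have hle : ∑' s, (n : ℝ) * coverCount n N (T / n) s / N * f s ≤
      ∑' s, (1 + (n : ℝ) / N) * f s := by
    refine Summable.tsum_le_tsum (fun s => mul_le_mul_of_nonneg_right ?_ (hf0 s)) ?_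
      (hf.mul_left _)
    · rw [div_le_iff₀ hN', add_mul, div_mul_cancel₀ _ hN'.ne', one_mul]
      exact coverCount_le hn hN s
    · refine ((summable_coverCount_mul hf n N (T / n)).mul_left ((n : ℝ) / N)).congr fun s => ?_
      ring
  rw [tsum_mul_left] at hle
  calc _ ≤ (T : ℝ)⁻¹ * ((1 + (n : ℝ) / N) * ∑' s, f s) :=
        mul_le_mul_of_nonneg_left hle (by positivity)
    _ = _ := by ring

/-- Overlapping windows cover each date in the bulk of the sample about `N / n` times. -/
lemma le_blockAvg_winAvg {f g : ℤ → ℝ} (hf : Summable f) (hg : Summable g) {n N T : ℕ}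
    (hn : 1 ≤ n) (hN : Even N) (hN1 : 1 ≤ N) (hnN : n ≤ N)
    (hg0 : ∀ s, 0 ≤ g s) (hfg : ∀ s, ¬ ((N : ℤ) / 2 + 1 ≤ s ∧ s + (N : ℤ) / 2 ≤ T + 1) →
      |f s| ≤ g s) :
    (T : ℝ)⁻¹ * ∑' s, f s - (n : ℝ) / N * ((T : ℝ)⁻¹ * ∑' s, |f s|) - (T : ℝ)⁻¹ * ∑' s, g s ≤
      blockAvg n T (fun r => winAvg N ((r : ℤ) * n - (N : ℤ) / 2) f) := by
  have hN' : (0 : ℝ) < N := by exact_mod_cast hN1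
  rw [blockAvg_winAvg_eq]
  have hs1 : Summable fun s => f s - (n : ℝ) / N * |f s| - g s :=
    (hf.sub (hf.abs.mul_left _)).sub hg
  have hs2 : Summable fun s => (n : ℝ) * coverCount n N (T / n) s / N * f s := by
    refine ((summable_coverCount_mul hf n N (T / n)).mul_left ((n : ℝ) / N)).congr fun s => ?_
    ring
  have hle : ∑' s, (f s - (n : ℝ) / N * |f s| - g s) ≤
      ∑' s, (n : ℝ) * coverCount n N (T / n) s / N * f s := by
    refine Summable.tsum_le_tsum (fun s => ?_) hs1 hs2
    set w : ℝ := (n : ℝ) * coverCount n N (T / n) s / N with hw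
    have hw0 : 0 ≤ w := by positivity
    have hw1 : w ≤ 1 + (n : ℝ) / N := by
      rw [hw, div_le_iff₀ hN', add_mul, div_mul_cancel₀ _ hN'.ne', one_mul]
      exact coverCount_le hn hN s
    have hnN' : (n : ℝ) / N ≤ 1 := by
      rw [div_le_one hN']
      exact_mod_cast hnN
    have hr0 : (0 : ℝ) ≤ (n : ℝ) / N := by positivity
    -- In the bulk the weight differs from one by at most `n / N`; at the ends it lies between `0`
    -- and `2`, and the majorant `g` absorbs the loss.
    have hmul : ∀ d : ℝ, |w - 1| ≤ d → f s - d * |f s| ≤ w * f s := by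
      intro d hd
      have h1 : |(w - 1) * f s| ≤ d * |f s| := by
        rw [abs_mul]
        exact mul_le_mul_of_nonneg_right hd (abs_nonneg _)
      have := (abs_le.1 h1).1
      linarith
    by_cases hs : (N : ℤ) / 2 + 1 ≤ s ∧ s + (N : ℤ) / 2 ≤ T + 1
    · have hw2 : 1 - (n : ℝ) / N ≤ w := by
        rw [hw, le_div_iff₀ hN', sub_mul, div_mul_cancel₀ _ hN'.ne', one_mul]
        exact le_coverCount hn hN hs.1 hs.2
      have := hmul ((n : ℝ) / N) (abs_le.2 ⟨by linarith, by linarith⟩)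
      linarith [hg0 s]
    · have h1 := hmul 1 (abs_le.2 ⟨by linarith, by linarith⟩)
      have h2 := hfg s hs
      have h3 : 0 ≤ (n : ℝ) / N * |f s| := by positivity
      linarith
  rw [Summable.tsum_sub (hf.sub (hf.abs.mul_left _)) hg, Summable.tsum_sub hf (hf.abs.mul_left _),
    tsum_mul_left] at hle
  calc _ = (T : ℝ)⁻¹ * (∑' s, f s - (n : ℝ) / N * ∑' s, |f s| - ∑' s, g s) := by ring
    _ ≤ _ := mul_le_mul_of_nonneg_left hle (by positivity)

/-- Multiplying the block point `r n / T` by `T` restores an integer, so the floor is exact. -/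
lemma gammaDK_eq {Ω : Type*} (V : ℕ → ℕ → Ω → ℝ) (n N : ℕ) {T : ℕ} (hT : 1 ≤ T) (h : ℕ) (x : Ω) :
    gammaDK V n N T (2 * (h : ℤ)) x = blockAvg n T fun r =>
      winCov N ((r : ℤ) * n - (N : ℤ) / 2) h (fun t => obs V T t x) := by
  have hT' : (T : ℝ) ≠ 0 := by exact_mod_cast (by omega : T ≠ 0)
  rw [gammaDK, blockAvg]
  congr 1
  refine Finset.sum_congr rfl fun r _ => ?_
  rw [sampleLocalCov_eq]
  have e1 : ⌊(T : ℝ) * ((r : ℝ) * n / T)⌋ = (r : ℤ) * n := by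
    rw [mul_div_cancel₀ _ hT']
    exact_mod_cast Int.floor_natCast (R := ℝ) (r * n)
  have e2 : |2 * (h : ℤ)| / 2 = h := by
    rw [abs_of_nonneg (by positivity)]
    omega
  rw [e1, e2]

/-- A lower bound for the sample autocovariance of `y + a` over one window: `b` is any level. -/
lemma winCov_ge {N : ℕ} (hN : 1 ≤ N) (c M : ℤ) (a y : ℤ → ℝ) (b : ℝ) {θ : ℝ} (hθ : 0 < θ) :
    winAvg N c (fun r => y (r + M) * y (r - M)) -
      winAvg N c (fun r => y (r + M)) ^ 2 - winAvg N c (fun r => y (r - M)) ^ 2 -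
      θ / 2 * (winAvg N c (fun r => y (r + M) ^ 2) + winAvg N c (fun r => y (r - M) ^ 2)) -
      (2 + 1 / (2 * θ)) * (winAvg N c (fun r => (a (r + M) - b) ^ 2) +
        winAvg N c (fun r => (a (r - M) - b) ^ 2)) ≤
    winCov N c M (fun r => a r + y r) := by
  set v : ℤ → ℝ := fun r => a r + y r with hv
  set w : ℤ → ℝ := fun r => v r - b with hw
  set wp := winAvg N c fun r => w (r + M) with hwp
  set wm := winAvg N c fun r => w (r - M) with hwm
  set w0 := winAvg N c v - b with hw0
  have h1 : winCov N c M v =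
      winAvg N c (fun r => w (r + M) * w (r - M)) - w0 * (wp + wm) + w0 ^ 2 := by
    have : ∀ r, (v (r + M) - winAvg N c v) * (v (r - M) - winAvg N c v) =
        (w (r + M) * w (r - M) - w0 * (w (r + M) + w (r - M))) + w0 ^ 2 := fun r => by
      simp only [hw, hw0]
      ring
    rw [winCov]
    simp_rw [this]
    rw [winAvg_add, winAvg_sub, winAvg_const_mul, winAvg_const hN, winAvg_add]
  -- The sample mean enters through `w0² - w0 (wp + wm)`, which is bounded below by minimising over
  -- `w0`. Only the two shifted averages remain.
  have h2 : winAvg N c (fun r => w (r + M) * w (r - M)) - (wp ^ 2 + wm ^ 2) / 2 ≤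
      winCov N c M v := by
    rw [h1]
    nlinarith [sq_nonneg (w0 - (wp + wm) / 2), sq_nonneg (wp - wm)]
  have hsplit : ∀ s : ℤ, (winAvg N c fun r => w (r + s)) ^ 2 ≤
      2 * winAvg N c (fun r => y (r + s)) ^ 2 + 2 * winAvg N c (fun r => (a (r + s) - b) ^ 2) := by
    intro s
    have e1 : (winAvg N c fun r => w (r + s)) =
        winAvg N c (fun r => y (r + s)) + winAvg N c (fun r => a (r + s) - b) := by
      rw [← winAvg_add]
      refine winAvg_congr N c fun r _ => ?_
      simp only [hw, hv]
      ring
    have e2 := sq_winAvg_le hN c fun r => a (r + s) - b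
    rw [e1]
    nlinarith [sq_nonneg (winAvg N c (fun r => y (r + s)) - winAvg N c (fun r => a (r + s) - b))]
  have hp := hsplit M
  have hm := hsplit (-M)
  simp only [← sub_eq_add_neg] at hm
  have h3 : winAvg N c (fun r => y (r + M) * y (r - M)) -
      θ / 2 * (winAvg N c (fun r => y (r + M) ^ 2) + winAvg N c (fun r => y (r - M) ^ 2)) -
      (1 / (2 * θ) + 1 / 2) * (winAvg N c (fun r => (a (r + M) - b) ^ 2) +
        winAvg N c (fun r => (a (r - M) - b) ^ 2)) ≤
      winAvg N c (fun r => w (r + M) * w (r - M)) := by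
    rw [← winAvg_add, ← winAvg_add, ← winAvg_const_mul, ← winAvg_const_mul, ← winAvg_sub,
      ← winAvg_sub]
    refine winAvg_mono N c fun r _ => ?_
    simp only [hw, hv]
    -- Young's inequality leaves a small multiple `θ` of the noise energy and a large multiple `1/θ`
    -- of the trend error; the latter vanishes for each fixed `θ`.
    have hyoung : ∀ p q : ℝ, -(θ / 2 * p ^ 2 + 1 / (2 * θ) * q ^ 2) ≤ p * q := by
      intro p q
      have : θ / 2 * p ^ 2 + 1 / (2 * θ) * q ^ 2 + p * q = (θ * p + q) ^ 2 / (2 * θ) := by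
        field_simp
        ring
      have h0 : 0 ≤ (θ * p + q) ^ 2 / (2 * θ) := by positivity
      linarith
    have y1 := hyoung (y (r + M)) (a (r - M) - b)
    have y2 := hyoung (y (r - M)) (a (r + M) - b)
    nlinarith [sq_nonneg (a (r + M) - b + (a (r - M) - b))]
  have hE0 : 0 ≤ winAvg N c (fun r => (a (r + M) - b) ^ 2) +
      winAvg N c (fun r => (a (r - M) - b) ^ 2) := by
    rw [← winAvg_add]
    have := winAvg_mono N c (f := fun _ => (0 : ℝ))
      (g := fun r => (a (r + M) - b) ^ 2 + (a (r - M) - b) ^ 2) fun r _ => by positivity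
    rwa [winAvg_const hN] at this
  linarith

end Blocks

/-! ### A van der Corput inequality and lower bounds for block averages -/

section VanDerCorput

lemma sum_Ioc_add_sum_Ioc {a b c : ℤ} (hab : a ≤ b) (hbc : b ≤ c) (f : ℤ → ℝ) :
    ∑ r ∈ Finset.Ioc a b, f r + ∑ r ∈ Finset.Ioc b c, f r = ∑ r ∈ Finset.Ioc a c, f r := by
  rw [← Finset.sum_union (Finset.disjoint_left.2 fun r h1 h2 => ?_),
    Finset.Ioc_union_Ioc_eq_Ioc hab hbc]
  rw [Finset.mem_Ioc] at h1 h2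
  omega

/-- The effect of a small shift on a window average. -/
lemma sq_winAvg_sub_shift_le {N M i : ℕ} (hN : 1 ≤ N) (hi : i ≤ M) (hM : M ≤ N) (c : ℤ)
    (y : ℤ → ℝ) :
    (winAvg N c y - winAvg N c (fun r => y (r + i))) ^ 2 ≤
      2 * M / N * (winAvg N c (fun r => y r ^ 2) + winAvg N c (fun r => y (r + i) ^ 2)) := by
  have hN' : (0 : ℝ) < N := by exact_mod_cast hN
  have hi' : (i : ℝ) ≤ M := by exact_mod_cast hi
  set p := ∑ r ∈ Finset.Ioc c (c + i), y r with hp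
  set q := ∑ r ∈ Finset.Ioc (c + N) (c + N + i), y r with hq
  -- The two windows share all but `i` dates at either end.
  have e1 : winAvg N c y - winAvg N c (fun r => y (r + i)) = (N : ℝ)⁻¹ * (p - q) := by
    have h1 := sum_Ioc_add_sum_Ioc (a := c) (b := c + i) (c := c + i + N) (by omega) (by omega) y
    have h2 := sum_Ioc_add_sum_Ioc (a := c) (b := c + N) (c := c + N + i) (by omega) (by omega) y
    rw [show c + i + N = c + N + i by ring] at h1
    rw [winAvg, winAvg, sum_Ioc_shift c N i y, show c + i + N = c + N + i by ring, ← mul_sub]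
    congr 1
    linarith
  have hsub : ∀ (a b a' b' : ℤ), a' ≤ a → b ≤ b' → b - a = i →
      (∑ r ∈ Finset.Ioc a b, y r) ^ 2 ≤ M * ∑ r ∈ Finset.Ioc a' b', y r ^ 2 := by
    intro a b a' b' h1 h2 h3
    refine sq_sum_le_card_mul_sum_sq.trans ?_
    rw [Int.card_Ioc, h3, Int.toNat_natCast]
    refine mul_le_mul hi' ?_ (Finset.sum_nonneg fun r _ => sq_nonneg _) (by positivity)
    exact Finset.sum_le_sum_of_subset_of_nonneg (Finset.Ioc_subset_Ioc h1 h2)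
      fun r _ _ => sq_nonneg _
  have hp2 := hsub c (c + i) c (c + N) le_rfl (by omega) (by ring)
  have hq2 := hsub (c + N) (c + N + i) (c + i) (c + i + N) (by omega) (by omega) (by ring)
  rw [e1, mul_pow, winAvg, winAvg, sum_Ioc_shift c N i fun r => y r ^ 2]
  have h3 : (p - q) ^ 2 ≤ 2 * M * (∑ r ∈ Finset.Ioc c (c + N), y r ^ 2 +
      ∑ r ∈ Finset.Ioc (c + i) (c + i + N), y r ^ 2) := by
    nlinarith [sq_nonneg (p + q)]
  calc _ ≤ ((N : ℝ)⁻¹) ^ 2 * (2 * M * (∑ r ∈ Finset.Ioc c (c + N), y r ^ 2 +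
      ∑ r ∈ Finset.Ioc (c + i) (c + i + N), y r ^ 2)) :=
        mul_le_mul_of_nonneg_left h3 (by positivity)
    _ = _ := by ring

/-- The forward average over `M` dates. -/
def fwdAvg (M : ℕ) (y : ℤ → ℝ) (s : ℤ) : ℝ := (M : ℝ)⁻¹ * ∑ i ∈ Finset.range M, y (s + i)

lemma sq_average_le {M : ℕ} (hM : 1 ≤ M) (d : ℕ → ℝ) :
    ((M : ℝ)⁻¹ * ∑ i ∈ Finset.range M, d i) ^ 2 ≤ (M : ℝ)⁻¹ * ∑ i ∈ Finset.range M, d i ^ 2 := by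
  have hM' : (0 : ℝ) < M := by exact_mod_cast hM
  have := sq_sum_le_card_mul_sum_sq (s := Finset.range M) (f := d)
  rw [Finset.card_range] at this
  rw [mul_pow]
  calc _ ≤ ((M : ℝ)⁻¹) ^ 2 * (M * ∑ i ∈ Finset.range M, d i ^ 2) :=
        mul_le_mul_of_nonneg_left this (by positivity)
    _ = _ := by field_simp

/-- A van der Corput inequality for window averages. -/
lemma sq_winAvg_le_fwdAvg {N M : ℕ} (hM1 : 1 ≤ M) (hM : M ≤ N) (c : ℤ) (y : ℤ → ℝ) :
    winAvg N c y ^ 2 ≤ 2 * winAvg N c (fun r => fwdAvg M y r ^ 2) +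
      4 * M / N * (winAvg N c (fun r => y r ^ 2) +
        (M : ℝ)⁻¹ * ∑ i ∈ Finset.range M, winAvg N c (fun r => y (r + i) ^ 2)) := by
  have hN : 1 ≤ N := hM1.trans hM
  have hM' : (0 : ℝ) < M := by exact_mod_cast hM1
  set d : ℕ → ℝ := fun i => winAvg N c y - winAvg N c (fun r => y (r + i)) with hd
  have e1 : winAvg N c (fwdAvg M y) =
      (M : ℝ)⁻¹ * ∑ i ∈ Finset.range M, winAvg N c (fun r => y (r + i)) := by
    have : fwdAvg M y = fun s => (M : ℝ)⁻¹ * ∑ i ∈ Finset.range M, y (s + i) := rfl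
    rw [this, winAvg_const_mul]
    congr 1
    simp only [winAvg]
    rw [Finset.sum_comm, ← Finset.mul_sum]
  -- Averaging over the shifts `0, …, M - 1` replaces `y` by its forward averages, up to the shift
  -- errors `d i`. The energy of forward averages involves only lags below `M`, whatever the window
  -- length.
  have e2 : winAvg N c y = winAvg N c (fwdAvg M y) + (M : ℝ)⁻¹ * ∑ i ∈ Finset.range M, d i := by
    rw [e1, hd, Finset.sum_sub_distrib, Finset.sum_const, Finset.card_range, nsmul_eq_mul]
    field_simp
    ring
  have h1 : ((M : ℝ)⁻¹ * ∑ i ∈ Finset.range M, d i) ^ 2 ≤ 2 * M / N *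
      (winAvg N c (fun r => y r ^ 2) +
        (M : ℝ)⁻¹ * ∑ i ∈ Finset.range M, winAvg N c (fun r => y (r + i) ^ 2)) := by
    refine (sq_average_le hM1 d).trans ?_
    have : ∑ i ∈ Finset.range M, d i ^ 2 ≤ ∑ i ∈ Finset.range M, 2 * M / N *
        (winAvg N c (fun r => y r ^ 2) + winAvg N c (fun r => y (r + i) ^ 2)) :=
      Finset.sum_le_sum fun i hi =>
        sq_winAvg_sub_shift_le hN (Finset.mem_range.1 hi).le hM c y
    rw [← Finset.mul_sum, Finset.sum_add_distrib, Finset.sum_const, Finset.card_range,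
      nsmul_eq_mul] at this
    calc _ ≤ (M : ℝ)⁻¹ * _ := mul_le_mul_of_nonneg_left this (by positivity)
      _ = _ := by
        field_simp
  have h2 := sq_winAvg_le hN c (fwdAvg M y)
  have h3 : winAvg N c y ^ 2 ≤ 2 * winAvg N c (fwdAvg M y) ^ 2 +
      2 * ((M : ℝ)⁻¹ * ∑ i ∈ Finset.range M, d i) ^ 2 := by
    rw [e2]
    nlinarith [sq_nonneg (winAvg N c (fwdAvg M y) - (M : ℝ)⁻¹ * ∑ i ∈ Finset.range M, d i)]
  have h4 : 4 * (M : ℝ) / N = 2 * (2 * M / N) := by ring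
  rw [h4, mul_assoc]
  linarith

variable {y : ℤ → ℝ}

lemma tsum_shift (f : ℤ → ℝ) (i : ℤ) : ∑' s, f (s + i) = ∑' s, f s :=
  (Equiv.addRight i).tsum_eq f

lemma summable_shift {f : ℤ → ℝ} (hf : Summable f) (i : ℤ) : Summable fun s => f (s + i) :=
  (Equiv.addRight i).summable_iff.2 hf

lemma summable_mul_shift (hy : Summable fun t => y t ^ 2) (i j : ℤ) :
    Summable fun s => y (s + i) * y (s + j) := by
  refine Summable.of_norm_bounded ((summable_shift hy i).add (summable_shift hy j)) fun s => ?_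
  rw [Real.norm_eq_abs, abs_le]
  constructor <;> nlinarith [sq_nonneg (y (s + i) + y (s + j)), sq_nonneg (y (s + i) - y (s + j)),
    sq_nonneg (y (s + i)), sq_nonneg (y (s + j))]

lemma tsum_mul_shift (i j : ℤ) :
    ∑' s, y (s + i) * y (s + j) = ∑' t, y t * y (t + (j - i)) := by
  rw [← tsum_shift (fun t => y t * y (t + (j - i))) i]
  refine tsum_congr fun s => ?_
  rw [show s + i + (j - i) = s + j by ring]

lemma fwdAvg_sq (M : ℕ) (s : ℤ) : fwdAvg M y s ^ 2 =
    ((M : ℝ)⁻¹) ^ 2 * ∑ i ∈ Finset.range M, ∑ j ∈ Finset.range M, y (s + i) * y (s + j) := by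
  rw [fwdAvg, mul_pow, sq (∑ i ∈ Finset.range M, y (s + i)), Finset.sum_mul_sum]

lemma summable_sum_mul_shift (hy : Summable fun t => y t ^ 2) (M i : ℕ) :
    Summable fun s : ℤ => ∑ j ∈ Finset.range M, y (s + i) * y (s + j) :=
  summable_sum (f := fun (j : ℕ) (s : ℤ) => y (s + i) * y (s + j)) fun j _ =>
    summable_mul_shift hy i j

lemma summable_fwdAvg_sq (hy : Summable fun t => y t ^ 2) (M : ℕ) :
    Summable fun s => fwdAvg M y s ^ 2 := by
  simp_rw [fwdAvg_sq]
  exact Summable.mul_left _ (summable_sum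
    (f := fun (i : ℕ) (s : ℤ) => ∑ j ∈ Finset.range M, y (s + i) * y (s + j))
    fun i _ => summable_sum_mul_shift hy M i)

lemma tsum_fwdAvg_sq (hy : Summable fun t => y t ^ 2) (M : ℕ) :
    ∑' s, fwdAvg M y s ^ 2 = ((M : ℝ)⁻¹) ^ 2 *
      ∑ i ∈ Finset.range M, ∑ j ∈ Finset.range M, ∑' t, y t * y (t + ((j : ℤ) - i)) := by
  simp_rw [fwdAvg_sq]
  rw [tsum_mul_left, Summable.tsum_finsetSum
    (f := fun (i : ℕ) (s : ℤ) => ∑ j ∈ Finset.range M, y (s + i) * y (s + j))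
    fun i _ => summable_sum_mul_shift hy M i]
  congr 1
  refine Finset.sum_congr rfl fun i _ => ?_
  rw [Summable.tsum_finsetSum (f := fun (j : ℕ) (s : ℤ) => y (s + i) * y (s + j))
    fun j _ => summable_mul_shift hy i j]
  exact Finset.sum_congr rfl fun j _ => tsum_mul_shift _ _

variable {n N T M : ℕ}

lemma blockAvg_winAvg_le_two {f : ℤ → ℝ} (hf : Summable f) (hf0 : ∀ s, 0 ≤ f s)
    (hn : 1 ≤ n) (hN : Even N) (hN1 : 1 ≤ N) (hnN : n ≤ N) (σ : ℤ) :
    blockAvg n T (fun r => winAvg N ((r : ℤ) * n - (N : ℤ) / 2) (fun s => f (s + σ))) ≤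
      2 * ((T : ℝ)⁻¹ * ∑' s, f s) := by
  have hN' : (0 : ℝ) < N := by exact_mod_cast hN1
  have h1 := blockAvg_winAvg_le (T := T) (summable_shift hf σ) (fun s => hf0 _) hn hN hN1
  rw [tsum_shift] at h1
  refine h1.trans (mul_le_mul_of_nonneg_right ?_ (mul_nonneg (by positivity) (tsum_nonneg hf0)))
  have : (n : ℝ) / N ≤ 1 := by
    rw [div_le_one hN']
    exact_mod_cast hnN
  linarith

/-- The blocks' squared window averages. -/
lemma blockAvg_sq_winAvg_le (hy : Summable fun t => y t ^ 2) (hn : 1 ≤ n) (hN : Even N)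
    (hN1 : 1 ≤ N) (hnN : n ≤ N) (hM1 : 1 ≤ M) (hM : M ≤ N) (σ : ℤ) :
    blockAvg n T (fun r => winAvg N ((r : ℤ) * n - (N : ℤ) / 2) (fun s => y (s + σ)) ^ 2) ≤
      4 * ((T : ℝ)⁻¹ * ∑' s, fwdAvg M y s ^ 2) + 16 * M / N * ((T : ℝ)⁻¹ * ∑' s, y s ^ 2) := by
  have hM' : (0 : ℝ) < M := by exact_mod_cast hM1
  have h1 : ∀ r : ℕ, winAvg N ((r : ℤ) * n - (N : ℤ) / 2) (fun s => y (s + σ)) ^ 2 ≤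
      2 * winAvg N ((r : ℤ) * n - (N : ℤ) / 2) (fun s => fwdAvg M y (s + σ) ^ 2) +
      4 * M / N * (winAvg N ((r : ℤ) * n - (N : ℤ) / 2) (fun s => y (s + σ) ^ 2) +
        (M : ℝ)⁻¹ * ∑ i ∈ Finset.range M,
          winAvg N ((r : ℤ) * n - (N : ℤ) / 2) (fun s => y (s + (σ + i)) ^ 2)) := by
    intro r
    have := sq_winAvg_le_fwdAvg hM1 hM ((r : ℤ) * n - (N : ℤ) / 2) fun s => y (s + σ)
    have e1 : fwdAvg M (fun s => y (s + σ)) = fun s => fwdAvg M y (s + σ) := by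
      ext s
      simp only [fwdAvg]
      congr 1
      exact Finset.sum_congr rfl fun i _ => by rw [add_right_comm]
    rw [e1] at this
    have e2 : ∀ (s : ℤ) (i : ℕ), s + i + σ = s + (σ + i) := fun s i => by ring
    simp_rw [e2] at this
    exact this
  refine (blockAvg_mono h1).trans ?_
  rw [blockAvg_add, blockAvg_const_mul, blockAvg_const_mul, blockAvg_add, blockAvg_const_mul]
  have e3 : blockAvg n T (fun r => ∑ i ∈ Finset.range M,
      winAvg N ((r : ℤ) * n - (N : ℤ) / 2) (fun s => y (s + (σ + i)) ^ 2)) =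
      ∑ i ∈ Finset.range M, blockAvg n T (fun r =>
        winAvg N ((r : ℤ) * n - (N : ℤ) / 2) (fun s => y (s + (σ + i)) ^ 2)) := by
    simp only [blockAvg]
    rw [Finset.sum_comm, Finset.mul_sum]
  have b0 := blockAvg_winAvg_le_two (T := T) (summable_fwdAvg_sq hy M) (fun s => sq_nonneg _)
    hn hN hN1 hnN σ
  have b1 : ∀ τ, blockAvg n T (fun r => winAvg N ((r : ℤ) * n - (N : ℤ) / 2)
      (fun s => y (s + τ) ^ 2)) ≤ 2 * ((T : ℝ)⁻¹ * ∑' s, y s ^ 2) := fun τ =>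
    blockAvg_winAvg_le_two hy (fun s => sq_nonneg _) hn hN hN1 hnN τ
  have b2 : (M : ℝ)⁻¹ * ∑ i ∈ Finset.range M, blockAvg n T (fun r =>
        winAvg N ((r : ℤ) * n - (N : ℤ) / 2) (fun s => y (s + (σ + i)) ^ 2)) ≤
      2 * ((T : ℝ)⁻¹ * ∑' s, y s ^ 2) := by
    have := Finset.sum_le_sum (s := Finset.range M) fun i _ => b1 (σ + i)
    rw [Finset.sum_const, Finset.card_range, nsmul_eq_mul] at this
    rw [inv_mul_le_iff₀ hM']
    exact this
  rw [e3]
  have b3 := mul_le_mul_of_nonneg_left (add_le_add (b1 σ) b2)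
    (by positivity : (0 : ℝ) ≤ 4 * M / N)
  have e4 : 16 * (M : ℝ) / N * ((T : ℝ)⁻¹ * ∑' s, y s ^ 2) = 4 * M / N *
    (2 * ((T : ℝ)⁻¹ * ∑' s, y s ^ 2) + 2 * ((T : ℝ)⁻¹ * ∑' s, y s ^ 2)) := by ring
  rw [e4]
  linarith

/-- The blocks' averages of products at lag `2h`, up to the ends of the sample. -/
lemma le_blockAvg_winAvg_mul (hy : Summable fun t => y t ^ 2) (hn : 1 ≤ n) (hN : Even N)
    (hN1 : 1 ≤ N) (hnN : n ≤ N) (h : ℕ) :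
    (T : ℝ)⁻¹ * ∑' t, y t * y (t + 2 * h) - (n : ℝ) / N * ((T : ℝ)⁻¹ * ∑' s, y s ^ 2) -
      (T : ℝ)⁻¹ * ∑' t, (if (t ≤ (N : ℤ) / 2 + h ∨ (T : ℤ) + 2 - (N : ℤ) / 2 - h ≤ t)
        then y t ^ 2 else 0) ≤
    blockAvg n T (fun r => winAvg N ((r : ℤ) * n - (N : ℤ) / 2)
      (fun s => y (s + h) * y (s - h))) := by
  set Z : ℤ → ℝ := fun t => if (t ≤ (N : ℤ) / 2 + h ∨ (T : ℤ) + 2 - (N : ℤ) / 2 - h ≤ t)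
    then y t ^ 2 else 0 with hZ
  have hZ0 : ∀ t, 0 ≤ Z t := fun t => by
    simp only [hZ]
    split_ifs
    · exact sq_nonneg _
    · exact le_rfl
  have hZs : Summable Z := by
    refine Summable.of_nonneg_of_le hZ0 (fun t => ?_) hy
    simp only [hZ]
    split_ifs
    · exact le_rfl
    · exact sq_nonneg _
  have habs : ∀ s, |y (s + h) * y (s + -(h : ℤ))| ≤
      (1 / 2) * y (s + h) ^ 2 + (1 / 2) * y (s + -(h : ℤ)) ^ 2 := by
    intro s
    rw [abs_le]
    constructor <;> nlinarith [sq_nonneg (y (s + h) + y (s + -(h : ℤ))),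
      sq_nonneg (y (s + h) - y (s + -(h : ℤ)))]
  have hf := summable_mul_shift hy h (-(h : ℤ))
  have half : ∀ {f : ℤ → ℝ}, Summable f →
      (Summable fun s => (1 / 2) * f (s + h) + (1 / 2) * f (s + -(h : ℤ))) ∧
      ∑' s, ((1 / 2) * f (s + h) + (1 / 2) * f (s + -(h : ℤ))) = ∑' s, f s := by
    intro f hf
    have s1 := (summable_shift hf h).mul_left (1 / 2)
    have s2 := (summable_shift hf (-(h : ℤ))).mul_left (1 / 2)
    refine ⟨s1.add s2, ?_⟩
    rw [s1.tsum_add s2, tsum_mul_left, tsum_mul_left, tsum_shift f, tsum_shift f]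
    ring
  -- If `s` lies outside the bulk, then `s + h` and `s - h` both lie in the end zones widened by
  -- `h`, so `Z` there equals the full square and dominates the product.
  have key := le_blockAvg_winAvg (T := T) hf (half hZs).1 hn hN hN1 hnN
    (fun s => by
      have := hZ0 (s + h)
      have := hZ0 (s + -(h : ℤ))
      positivity) (fun s hs => by
      have e1 : Z (s + h) = y (s + h) ^ 2 := if_pos (by omega)
      have e2 : Z (s + -(h : ℤ)) = y (s + -(h : ℤ)) ^ 2 := if_pos (by omega)
      rw [e1, e2]
      exact habs s)
  rw [(half hZs).2] at key
  have e1 : ∑' s, y (s + h) * y (s + -(h : ℤ)) = ∑' t, y t * y (t + 2 * h) := by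
    have := tsum_mul_shift (y := y) (-(h : ℤ)) h
    rw [show (h : ℤ) - -h = 2 * h by ring] at this
    rw [← this]
    exact tsum_congr fun s => mul_comm _ _
  have e2 : ∑' s, |y (s + h) * y (s + -(h : ℤ))| ≤ ∑' s, y s ^ 2 := by
    rw [← (half hy).2]
    exact Summable.tsum_le_tsum habs hf.abs (half hy).1
  rw [e1] at key
  simp only [← sub_eq_add_neg] at key e2
  have e3 : (n : ℝ) / N * ((T : ℝ)⁻¹ * ∑' s, |y (s + h) * y (s - h)|) ≤
      (n : ℝ) / N * ((T : ℝ)⁻¹ * ∑' s, y s ^ 2) := by gcongr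
  linarith

/-- A lower bound for the block average of sample autocovariances of `a + y`. -/
lemma blockAvg_winCov_ge (hy : Summable fun t => y t ^ 2) (a : ℤ → ℝ) (hn : 1 ≤ n) (hN : Even N)
    (hN1 : 1 ≤ N) (hnN : n ≤ N) (hM1 : 1 ≤ M) (hM : M ≤ N) (h : ℕ) {θ : ℝ} (hθ : 0 < θ) {E : ℝ}
    (hE : ∀ σ : ℤ, |σ| = h → blockAvg n T (fun r => winAvg N ((r : ℤ) * n - (N : ℤ) / 2)
      (fun s => (a (s + σ) - a ((r : ℤ) * n)) ^ 2)) ≤ E) :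
    (T : ℝ)⁻¹ * ∑' t, y t * y (t + 2 * h) -
      ((n : ℝ) / N + 32 * M / N + 2 * θ) * ((T : ℝ)⁻¹ * ∑' s, y s ^ 2) -
      (T : ℝ)⁻¹ * ∑' t, (if (t ≤ (N : ℤ) / 2 + h ∨ (T : ℤ) + 2 - (N : ℤ) / 2 - h ≤ t)
        then y t ^ 2 else 0) -
      8 * ((T : ℝ)⁻¹ * ∑' s, fwdAvg M y s ^ 2) - (4 + 1 / θ) * E ≤
    blockAvg n T (fun r => winCov N ((r : ℤ) * n - (N : ℤ) / 2) h (fun s => a s + y s)) := by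
  -- The comparison level is the mean at the centre `r n` of each window.
  refine le_trans ?_ (blockAvg_mono fun r =>
    winCov_ge hN1 ((r : ℤ) * n - (N : ℤ) / 2) h a y (a ((r : ℤ) * n)) hθ)
  rw [blockAvg_sub, blockAvg_sub, blockAvg_sub, blockAvg_sub, blockAvg_const_mul,
    blockAvg_const_mul, blockAvg_add, blockAvg_add]
  have hh : |(h : ℤ)| = h := abs_of_nonneg (by positivity)
  have hh' : |(-(h : ℤ))| = h := by rw [abs_neg, hh]
  have c0 := le_blockAvg_winAvg_mul (T := T) hy hn hN hN1 hnN h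
  have c1 := blockAvg_sq_winAvg_le (T := T) hy hn hN hN1 hnN hM1 hM h
  have c2 := blockAvg_sq_winAvg_le (T := T) hy hn hN hN1 hnN hM1 hM (-(h : ℤ))
  have c3 := blockAvg_winAvg_le_two (T := T) hy (fun s => sq_nonneg _) hn hN hN1 hnN h
  have c4 := blockAvg_winAvg_le_two (T := T) hy (fun s => sq_nonneg _) hn hN hN1 hnN (-(h : ℤ))
  have c5 := hE h hh
  have c6 := hE (-(h : ℤ)) hh'
  simp only [← sub_eq_add_neg] at c2 c4 c6
  have c7 := mul_le_mul_of_nonneg_left (add_le_add c3 c4) (by positivity : 0 ≤ θ / 2)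
  have c8 := mul_le_mul_of_nonneg_left (add_le_add c5 c6)
    (by positivity : 0 ≤ 2 + 1 / (2 * θ))
  have e1 : (2 + 1 / (2 * θ)) * (E + E) = (4 + 1 / θ) * E := by
    field_simp
    ring
  rw [e1] at c8
  have e2 : ((n : ℝ) / N + 32 * M / N + 2 * θ) * ((T : ℝ)⁻¹ * ∑' s, y s ^ 2) =
      (n : ℝ) / N * ((T : ℝ)⁻¹ * ∑' s, y s ^ 2) +
      2 * (16 * M / N * ((T : ℝ)⁻¹ * ∑' s, y s ^ 2)) +
      θ / 2 * (2 * ((T : ℝ)⁻¹ * ∑' s, y s ^ 2) + 2 * ((T : ℝ)⁻¹ * ∑' s, y s ^ 2)) := by ring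
  rw [e2]
  linarith

end VanDerCorput

/-! ### Negligibility of the trend over the blocks -/

section Trend

variable {Ω : Type*} [MeasurableSpace Ω] {P : Measure Ω}
  {m : ℕ} {lam : Fin (m + 2) → ℝ} {A : ℝ → ℝ → ℂ} {μ : Fin (m + 1) → ℝ → ℝ} {V : ℕ → ℕ → Ω → ℝ}
  {C K D : ℝ} {n N : ℕ → ℕ}

/-- The dates within `ρ` of a break or of an end of the sample. -/
def nearBreaks (lam : Fin (m + 2) → ℝ) (T : ℕ) (ρ : ℕ) : Finset ℤ :=
  Finset.univ.biUnion fun i => Finset.Icc (⌊(T : ℝ) * lam i⌋ - ρ) (⌊(T : ℝ) * lam i⌋ + ρ)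

lemma card_nearBreaks_le (lam : Fin (m + 2) → ℝ) (T ρ : ℕ) :
    ((nearBreaks lam T ρ).card : ℝ) ≤ (m + 2) * (2 * ρ + 1) := by
  have h : (nearBreaks lam T ρ).card ≤ ∑ _i : Fin (m + 2), (2 * ρ + 1) := by
    refine Finset.card_biUnion_le.trans (Finset.sum_le_sum fun i _ => ?_)
    rw [Int.card_Icc]
    omega
  rw [Finset.sum_const, Finset.card_univ, Fintype.card_fin, smul_eq_mul] at h
  exact_mod_cast h

/-- Away from the breaks the means change slowly. -/
lemma MomentBounds.abs_obsMean_sub_le (h : MomentBounds P lam A μ V C)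
    (hlam : IsBreakFractions lam) (hR : RegimeBounds lam A μ K) {T : ℕ} (hT : 1 ≤ T) {ρ : ℕ}
    {t t' : ℤ} (htt : |t - t'| ≤ ρ) (ht : t ∉ nearBreaks lam T ρ) :
    |obsMean P V T t - obsMean P V T t'| ≤ K * (ρ / T) := by
  have hT' : (0 : ℝ) < T := by exact_mod_cast hT
  have hK := hR.nonneg
  simp only [nearBreaks, Finset.mem_biUnion, Finset.mem_univ, true_and, Finset.mem_Icc,
    not_exists, not_and, not_le] at ht
  rw [abs_le] at htt
  by_cases h1 : 1 ≤ t ∧ t ≤ T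
  · obtain ⟨j, hj⟩ := exists_dates hlam h1.1 h1.2
    have h2 := ht j.castSucc
    have h3 := ht j.succ
    have hj1 := hj.1
    have hj2 := hj.2
    have hj' : t' ∈ dates lam T j := by
      constructor <;> omega
    rw [obsMean, obsMean, h.mean T j t hT hj, h.mean T j t' hT hj']
    refine (hR.trend_lipschitz j _ (div_mem_regime hT hj) _ (div_mem_regime hT hj')).trans ?_
    rw [← sub_div, abs_div, abs_of_pos hT']
    have : |(t : ℝ) - t'| ≤ ρ := by exact_mod_cast abs_le.2 htt
    gcongr
  · have h2 := ht 0
    have h3 := ht (Fin.last (m + 1))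
    simp only [hlam.first, hlam.last, mul_zero, mul_one, Int.floor_zero, Int.floor_natCast]
      at h2 h3
    have h4 : ¬ (1 ≤ t' ∧ t' ≤ T) := by omega
    simp only [obsMean, obs_eq_zero h1, obs_eq_zero h4, Pi.zero_apply, integral_zero, sub_self,
      abs_zero]
    positivity

/-- Over the blocks, the trends are nearly constant on the windows. -/
lemma MomentBounds.blockAvg_trend_le (h : MomentBounds P lam A μ V C)
    (hlam : IsBreakFractions lam) (hR : RegimeBounds lam A μ K) {n N T : ℕ} (hT : 1 ≤ T)
    (hn : 1 ≤ n) (hN : Even N) (hN1 : 1 ≤ N) (hnN : n ≤ N) (q : ℕ) {σ : ℤ} (hσ : |σ| = q) :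
    blockAvg n T (fun r => winAvg N ((r : ℤ) * n - (N : ℤ) / 2)
      (fun s => (obsMean P V T (s + σ) - obsMean P V T ((r : ℤ) * n)) ^ 2)) ≤
    (K * ((N + q) / T)) ^ 2 + 8 * K ^ 2 * ((m + 2) * ((2 * (N + q) + 1) / T)) := by
  have hT' : (0 : ℝ) < T := by exact_mod_cast hT
  have hK := hR.nonneg
  have hob := h.exists_obsMean_bound hlam hR.nonneg hR.trend_bound
  set S := nearBreaks lam T (N + q) with hS
  -- Away from breaks the mean moves by `O(N / T)` over a window. Near them the crude bound `4K²` is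
  -- charged to this indicator, whose block average is `O((N + q) / T)` because there are finitely
  -- many breaks.
  set f : ℤ → ℝ := fun t => if t ∈ S then 1 else 0 with hf
  have hf0 : ∀ t, 0 ≤ f t := fun t => by
    simp only [hf]
    split_ifs <;> norm_num
  have hfs : Summable f := summable_of_ne_finset_zero (s := S) fun b hb => if_neg hb
  have hft : ∑' t, f t = S.card := by
    rw [tsum_eq_sum (s := S) fun b hb => if_neg hb, Finset.sum_congr rfl fun t ht => if_pos ht]
    simp
  have hpt : ∀ r : ℕ, winAvg N ((r : ℤ) * n - (N : ℤ) / 2)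
      (fun s => (obsMean P V T (s + σ) - obsMean P V T ((r : ℤ) * n)) ^ 2) ≤
      (K * ((N + q) / T)) ^ 2 + 4 * K ^ 2 *
        winAvg N ((r : ℤ) * n - (N : ℤ) / 2) (fun s => f (s + σ)) := by
    intro r
    rw [← winAvg_const hN1 ((r : ℤ) * n - (N : ℤ) / 2) ((K * ((N + q) / T)) ^ 2),
      ← winAvg_const_mul, ← winAvg_add]
    refine winAvg_mono _ _ fun s hs => ?_
    rw [Finset.mem_Ioc] at hs
    by_cases hb : s + σ ∈ S
    · simp only [hf, if_pos hb, mul_one]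
      have h1 : |obsMean P V T (s + σ) - obsMean P V T ((r : ℤ) * n)| ≤ 2 * K :=
        (abs_sub _ _).trans (by linarith [hob T (s + σ), hob T ((r : ℤ) * n)])
      have h2 := sq_le_sq' (abs_le.1 h1).1 (abs_le.1 h1).2
      nlinarith [sq_nonneg (K * ((N + q : ℝ) / T))]
    · simp only [hf, if_neg hb, mul_zero, add_zero]
      have hσ' := abs_le.1 hσ.le
      have h1 := h.abs_obsMean_sub_le hlam hR hT (ρ := N + q) (t := s + σ) (t' := (r : ℤ) * n)
        (by
          push_cast
          rw [abs_le]
          constructor <;> omega) hb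
      push_cast at h1
      exact sq_le_sq' (abs_le.1 h1).1 (abs_le.1 h1).2
  refine (blockAvg_mono hpt).trans ?_
  rw [blockAvg_add, blockAvg_const_mul]
  refine add_le_add (blockAvg_const_le hT (sq_nonneg _)) ?_
  have h1 := blockAvg_winAvg_le_two (T := T) hfs hf0 hn hN hN1 hnN σ
  rw [hft] at h1
  have h2 := card_nearBreaks_le lam T (N + q)
  push_cast at h2
  calc _ ≤ 4 * K ^ 2 * (2 * ((T : ℝ)⁻¹ * ((m + 2) * (2 * (N + q) + 1)))) := by
        refine mul_le_mul_of_nonneg_left (h1.trans ?_) (by positivity)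
        gcongr
    _ = _ := by
        field_simp
        ring

lemma tendsto_trendError (hNT : Tendsto (fun T : ℕ => (N T : ℝ) / T) atTop (𝓝 0)) (q : ℕ) :
    Tendsto (fun T : ℕ => (K * ((N T + q) / T)) ^ 2 +
      8 * K ^ 2 * ((m + 2) * ((2 * ((N T : ℝ) + q) + 1) / T))) atTop (𝓝 0) := by
  have h1 := ((tendsto_window_div hNT q).const_mul K).pow 2
  have h2 := ((((tendsto_window_div hNT q).const_mul 2).add
    (tendsto_const_div_atTop_nhds_zero_nat 1)).const_mul ((m : ℝ) + 2)).const_mul (8 * K ^ 2)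
  have h3 := h1.add h2
  simp only [mul_zero, add_zero, ne_eq, OfNat.ofNat_ne_zero, not_false_eq_true, zero_pow] at h3
  refine h3.congr fun T => ?_
  ring

end Trend

/-! ### Almost sure properties of the centred observations -/

section Noise

variable {Ω : Type*} [MeasurableSpace Ω] {P : Measure Ω}
  {m : ℕ} {lam : Fin (m + 2) → ℝ} {A : ℝ → ℝ → ℂ} {μ : Fin (m + 1) → ℝ → ℝ} {V : ℕ → ℕ → Ω → ℝ}
  {C D : ℝ}

/-- The properties of a path of the centred observations that hold almost surely. -/
structure NoiseBounds (y : ℕ → ℤ → ℝ) (C : ℝ) : Prop where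
  eq_zero : ∀ (T : ℕ) (t : ℤ), ¬ (1 ≤ t ∧ t ≤ T) → y T t = 0
  lag : ∀ q : ℤ, ∀ ε > 0, ∀ᶠ T : ℕ in atTop,
    |(T : ℝ)⁻¹ * ∑' t, y T t * y T (t + q)| ≤ C / (1 + (|q| : ℤ)) + ε
  ends : ∀ i : ℕ, ∀ᶠ T : ℕ in atTop,
    (T : ℝ)⁻¹ * (∑ t ∈ Finset.Ioc 0 ⌊(T : ℝ) * (1 / (i + 1))⌋, y T t ^ 2 +
      ∑ t ∈ Finset.Ioc ⌊(T : ℝ) * (1 - 1 / (i + 1))⌋ T, y T t ^ 2) ≤ (4 * C + 1) * (1 / (i + 1))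

lemma NoiseBounds.summable {y : ℕ → ℤ → ℝ} (h : NoiseBounds y C) (T : ℕ) :
    Summable fun t => y T t ^ 2 :=
  summable_of_ne_finset_zero (s := Finset.Icc 1 (T : ℤ)) fun t ht => by
    rw [Finset.mem_Icc] at ht
    rw [h.eq_zero T t ht, zero_pow two_ne_zero]

/-- The strong law at lag zero replaces squares by variances, each at most `2C`; rounding the
endpoints costs one further date, hence `O(1/T)`. -/
lemma MomentBounds.eventually_sum_sq_le (h : MomentBounds P lam A μ V C) {a b : ℝ} (hab : a ≤ b)
    {x : Ω} (hx : Tendsto (fun T : ℕ => (∑ t ∈ Finset.Ioc ⌊(T : ℝ) * a⌋ ⌊(T : ℝ) * b⌋,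
      (centered P V T t x * centered P V T (t + 0) x - autoCov P V T t (t + 0))) / T)
        atTop (𝓝 0)) {ε : ℝ} (hε : 0 < ε) :
    ∀ᶠ T : ℕ in atTop, (T : ℝ)⁻¹ * ∑ t ∈ Finset.Ioc ⌊(T : ℝ) * a⌋ ⌊(T : ℝ) * b⌋,
      centered P V T t x ^ 2 ≤ 2 * C * (b - a) + ε := by
  have hC := h.nonneg
  filter_upwards [hx.eventually (gt_mem_nhds (half_pos hε)),
    (tendsto_const_div_atTop_nhds_zero_nat (2 * C)).eventually (gt_mem_nhds (half_pos hε)),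
    eventually_ge_atTop 1] with T h1 h2 hT
  have hT' : (0 : ℝ) < T := by exact_mod_cast hT
  simp only [add_zero, Finset.sum_sub_distrib, ← sq] at h1
  have h3 : ∑ t ∈ Finset.Ioc ⌊(T : ℝ) * a⌋ ⌊(T : ℝ) * b⌋, autoCov P V T t t ≤
      (T * (b - a) + 1) * (2 * C) := by
    refine (Finset.sum_le_sum fun t _ => (abs_le.1 (h.abs_autoCov_le T t t)).2).trans ?_
    rw [Finset.sum_const, nsmul_eq_mul, Int.card_Ioc]
    refine mul_le_mul_of_nonneg_right ?_ (by positivity)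
    have hfl : ⌊(T : ℝ) * a⌋ ≤ ⌊(T : ℝ) * b⌋ := Int.floor_le_floor (by gcongr)
    have e : (((⌊(T : ℝ) * b⌋ - ⌊(T : ℝ) * a⌋).toNat : ℕ) : ℝ) =
        (⌊(T : ℝ) * b⌋ : ℝ) - ⌊(T : ℝ) * a⌋ := by
      exact_mod_cast Int.toNat_of_nonneg (sub_nonneg.2 hfl)
    rw [e]
    have e1 := Int.floor_le ((T : ℝ) * b)
    have e2 := Int.lt_floor_add_one ((T : ℝ) * a)
    linarith
  rw [sub_div, div_eq_inv_mul, div_eq_inv_mul] at h1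
  have h4 := mul_le_mul_of_nonneg_left h3 (inv_nonneg.2 hT'.le)
  have e3 : (T : ℝ)⁻¹ * ((T * (b - a) + 1) * (2 * C)) = 2 * C * (b - a) + 2 * C / T := by
    field_simp
  rw [e3] at h4
  linarith

/-- Almost every path of the centred observations has the properties above. -/
theorem MomentBounds.ae_noiseBounds [IsProbabilityMeasure P] (h : MomentBounds P lam A μ V C)
    (hD : VarianceBounds P V D) (hlam : IsBreakFractions lam) :
    ∀ᵐ x ∂P, NoiseBounds (fun T t => centered P V T t x) C := by
  have hC := h.nonneg
  have hη : ∀ i : ℕ, (0 : ℝ) < 1 / (i + 1) ∧ (1 : ℝ) / (i + 1) ≤ 1 := fun i =>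
    ⟨by positivity, by
      rw [div_le_one (by positivity)]
      have : (0 : ℝ) ≤ i := by positivity
      linarith⟩
  -- Lags and end widths `1/(i + 1)` are countable families, so one null set suffices for all of
  -- them.
  have h1 : ∀ᵐ x ∂P, ∀ q : ℤ, _ := ae_all_iff.2 fun q : ℤ =>
    h.ae_tendsto_quadratic hD hlam le_rfl zero_le_one q
  have h2 : ∀ᵐ x ∂P, ∀ i : ℕ, _ := ae_all_iff.2 fun i : ℕ =>
    h.ae_tendsto_quadratic hD hlam le_rfl (hη i).1.le 0
  have h3 : ∀ᵐ x ∂P, ∀ i : ℕ, _ := ae_all_iff.2 fun i : ℕ =>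
    h.ae_tendsto_quadratic hD hlam (sub_nonneg.2 (hη i).2) zero_le_one 0
  filter_upwards [h1, h2, h3] with x h1 h2 h3
  have h0 : ∀ (T : ℕ) (t : ℤ), ¬ (1 ≤ t ∧ t ≤ T) → centered P V T t x = 0 := fun T t ht => by
    rw [centered_eq_zero ht, Pi.zero_apply]
  refine ⟨h0, fun q ε hε => ?_, fun i => ?_⟩
  · have hq := (h1 q).abs
    rw [abs_zero] at hq
    filter_upwards [hq.eventually (gt_mem_nhds (half_pos hε)),
      (tendsto_const_div_atTop_nhds_zero_nat C).eventually (gt_mem_nhds (half_pos hε)),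
      eventually_ge_atTop 1] with T e1 e2 hT
    have hT' : (0 : ℝ) < T := by exact_mod_cast hT
    simp only [mul_zero, mul_one, Int.floor_zero, Int.floor_natCast, Finset.sum_sub_distrib] at e1
    have e3 : ∑' t, centered P V T t x * centered P V T (t + q) x =
        ∑ t ∈ Finset.Ioc 0 (T : ℤ), centered P V T t x * centered P V T (t + q) x :=
      tsum_eq_sum fun t ht => by
        rw [Finset.mem_Ioc] at ht
        rw [h0 T t (by omega), zero_mul]
    have e4 : |∑ t ∈ Finset.Ioc 0 (T : ℤ), autoCov P V T t (t + q)| ≤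
        T * (C / (1 + (|q| : ℤ)) + C / T) := by
      refine (Finset.abs_sum_le_sum_abs _ _).trans
        ((Finset.sum_le_sum (g := fun _ => C / (1 + (|q| : ℤ)) + C / T) fun t _ => ?_).trans
          (le_of_eq ?_))
      · have := h.cov_decay T t (t + q) hT
        rwa [show t - (t + q) = -q by ring, abs_neg] at this
      · rw [Finset.sum_const, nsmul_eq_mul, Int.card_Ioc]
        simp
    have e5 : |(∑ t ∈ Finset.Ioc 0 (T : ℤ), autoCov P V T t (t + q)) / T| ≤
        C / (1 + (|q| : ℤ)) + C / T := by
      rw [abs_div, abs_of_pos hT', div_le_iff₀ hT', mul_comm]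
      exact e4
    rw [e3, ← div_eq_inv_mul]
    rw [sub_div] at e1
    have e6 := abs_le.1 e5
    have e7 := abs_lt.1 e1
    rw [abs_le]
    constructor <;> linarith
  -- Each end contributes `2C` times its width plus half its width; together they give the factor
  -- `4C + 1`.
  · have hε : (0 : ℝ) < 1 / 2 * (1 / (i + 1)) := mul_pos (by norm_num) (hη i).1
    filter_upwards [h.eventually_sum_sq_le (hη i).1.le (h2 i) hε,
      h.eventually_sum_sq_le (by linarith [(hη i).1]) (h3 i) hε] with T e1 e2
    simp only [mul_zero, mul_one, Int.floor_zero, Int.floor_natCast] at e1 e2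
    rw [mul_add]
    linarith

end Noise

/-! ### Asymptotic nonnegativity at large lags -/

section LowerBound

/-- Each distance from `i` occurs at most once on either side. -/
lemma sum_comp_dist_le {f : ℕ → ℝ} (hf : ∀ q, 0 ≤ f q) {M i : ℕ} (hi : i < M) :
    ∑ j ∈ Finset.range M, f ((j : ℤ) - i).natAbs ≤ 2 * ∑ q ∈ Finset.range M, f q := by
  have hpart : ∀ p : ℕ → Prop, [DecidablePred p] →
      (∀ a b, p a → p b → ((a : ℤ) - i).natAbs = ((b : ℤ) - i).natAbs → a = b) →
      ∑ j ∈ (Finset.range M).filter p, f ((j : ℤ) - i).natAbs ≤ ∑ q ∈ Finset.range M, f q := by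
    intro p _ hp
    rw [← Finset.sum_image (f := f) (g := fun j : ℕ => ((j : ℤ) - i).natAbs)
      fun a ha b hb hab => hp a b (Finset.mem_filter.1 ha).2 (Finset.mem_filter.1 hb).2 hab]
    refine Finset.sum_le_sum_of_subset_of_nonneg (fun q hq => ?_) fun q _ _ => hf q
    obtain ⟨j, hj, rfl⟩ := Finset.mem_image.1 hq
    have := Finset.mem_range.1 (Finset.mem_filter.1 hj).1
    rw [Finset.mem_range]
    omega
  rw [← Finset.sum_filter_add_sum_filter_not (Finset.range M) (fun j => j ≤ i), two_mul]
  exact add_le_add (hpart _ fun a b ha hb hab => by omega)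
    (hpart _ fun a b ha hb hab => by omega)

/-- Bounds the energy of forward averages over `M` dates by a Cesàro mean of the harmonic terms,
which vanishes as `M → ∞`. -/
lemma average_lag_le {C ε : ℝ} (hC : 0 ≤ C) {M : ℕ} (hM : 1 ≤ M) :
    ((M : ℝ)⁻¹) ^ 2 * ∑ i ∈ Finset.range M, ∑ j ∈ Finset.range M,
      (C / (1 + (|(j : ℤ) - i| : ℤ)) + ε) ≤
    2 * C * ((M : ℝ)⁻¹ * ∑ q ∈ Finset.range M, 1 / ((q : ℝ) + 1)) + ε := by
  have hM' : (0 : ℝ) < M := by exact_mod_cast hM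
  set H := ∑ q ∈ Finset.range M, 1 / ((q : ℝ) + 1) with hH
  have h1 : ∀ i ∈ Finset.range M, ∑ j ∈ Finset.range M, (C / (1 + (|(j : ℤ) - i| : ℤ)) + ε) ≤
      2 * C * H + M * ε := by
    intro i hi
    rw [Finset.sum_add_distrib, Finset.sum_const, Finset.card_range, nsmul_eq_mul]
    have := sum_comp_dist_le (f := fun q : ℕ => C / (1 + (q : ℝ))) (fun q => by positivity)
      (Finset.mem_range.1 hi)
    have e1 : ∑ j ∈ Finset.range M, C / (1 + ((|(j : ℤ) - i| : ℤ) : ℝ)) =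
        ∑ j ∈ Finset.range M, C / (1 + ((((j : ℤ) - i).natAbs : ℕ) : ℝ)) :=
      Finset.sum_congr rfl fun j _ => by rw [Int.abs_eq_natAbs, Int.cast_natCast]
    have e2 : ∑ q ∈ Finset.range M, C / (1 + (q : ℝ)) = C * H := by
      rw [hH, Finset.mul_sum]
      exact Finset.sum_congr rfl fun q _ => by rw [mul_one_div, add_comm]
    rw [e2] at this
    rw [e1]
    linarith
  have h2 := Finset.sum_le_sum h1
  rw [Finset.sum_const, Finset.card_range, nsmul_eq_mul] at h2
  calc _ ≤ ((M : ℝ)⁻¹) ^ 2 * (M * (2 * C * H + M * ε)) :=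
        mul_le_mul_of_nonneg_left h2 (by positivity)
    _ = _ := by field_simp

lemma tendsto_average_harmonic :
    Tendsto (fun M : ℕ => (M : ℝ)⁻¹ * ∑ q ∈ Finset.range M, 1 / ((q : ℝ) + 1)) atTop (𝓝 0) :=
  tendsto_one_div_add_atTop_nhds_zero_nat.cesaro

variable {y : ℕ → ℤ → ℝ} {C : ℝ} {n N : ℕ → ℕ}

/-- The forward averages over many dates are small in mean square. -/
lemma NoiseBounds.eventually_fwdAvg_le (hy : NoiseBounds y C) (hC : 0 ≤ C) {M : ℕ} (hM : 1 ≤ M)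
    {ε : ℝ} (hε : 0 < ε) : ∀ᶠ T : ℕ in atTop, (T : ℝ)⁻¹ * ∑' s, fwdAvg M (y T) s ^ 2 ≤
      2 * C * ((M : ℝ)⁻¹ * ∑ q ∈ Finset.range M, 1 / ((q : ℝ) + 1)) + ε := by
  -- For fixed `M` only finitely many lags occur, so the strong laws for them hold simultaneously
  -- from some `T` on.
  have hall : ∀ᶠ T : ℕ in atTop, ∀ p ∈ Finset.range M ×ˢ Finset.range M,
      |(T : ℝ)⁻¹ * ∑' t, y T t * y T (t + ((p.2 : ℤ) - p.1))| ≤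
        C / (1 + (|(p.2 : ℤ) - p.1| : ℤ)) + ε :=
    (Filter.eventually_all_finset _).2 fun p _ => hy.lag _ ε hε
  filter_upwards [hall] with T hT
  refine le_trans (le_of_eq ?_) ((mul_le_mul_of_nonneg_left (Finset.sum_le_sum fun i hi =>
    Finset.sum_le_sum fun j hj => (le_abs_self _).trans
      (hT (i, j) (Finset.mk_mem_product hi hj))) (by positivity : 0 ≤ ((M : ℝ)⁻¹) ^ 2)).trans
      (average_lag_le hC hM))
  rw [tsum_fwdAvg_sq (hy.summable T), mul_left_comm]
  simp only [Finset.mul_sum]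

/-- The ends of the sample are negligible. -/
lemma NoiseBounds.eventually_ends_le (hy : NoiseBounds y C)
    (hNT : Tendsto (fun T : ℕ => (N T : ℝ) / T) atTop (𝓝 0)) (h i : ℕ) :
    ∀ᶠ T : ℕ in atTop, (T : ℝ)⁻¹ * ∑' t, (if (t ≤ (N T : ℤ) / 2 + h ∨
      (T : ℤ) + 2 - (N T : ℤ) / 2 - h ≤ t) then y T t ^ 2 else 0) ≤
        (4 * C + 1) * (1 / (i + 1)) := by
  have hη : (0 : ℝ) < 1 / (i + 1) := by positivity
  -- Once `N + h` is below `T / (i + 1)`, the end zones lie in the two segments controlled by the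
  -- strong law.
  filter_upwards [hy.ends i, eventually_window_lt hNT h hη] with T h1 h2
  refine le_trans (mul_le_mul_of_nonneg_left ?_ (by positivity)) h1
  set S₁ := Finset.Ioc 0 ⌊(T : ℝ) * (1 / (i + 1))⌋ with hS₁
  set S₂ := Finset.Ioc ⌊(T : ℝ) * (1 - 1 / (i + 1))⌋ (T : ℤ) with hS₂
  have hsum : ∀ S : Finset ℤ, ∑ t ∈ S, y T t ^ 2 = ∑' t, if t ∈ S then y T t ^ 2 else 0 := by
    intro S
    rw [tsum_eq_sum (s := S) fun b hb => if_neg hb]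
    exact Finset.sum_congr rfl fun s hs => (if_pos hs).symm
  have hs : ∀ S : Finset ℤ, Summable fun t => if t ∈ S then y T t ^ 2 else 0 := fun S =>
    summable_of_ne_finset_zero (s := S) fun b hb => if_neg hb
  have hnn : ∀ (p : Prop) [Decidable p] (t : ℤ), 0 ≤ if p then y T t ^ 2 else 0 := by
    intro p _ t
    split_ifs
    · exact sq_nonneg _
    · exact le_rfl
  rw [hsum S₁, hsum S₂, ← (hs S₁).tsum_add (hs S₂)]
  refine Summable.tsum_le_tsum (fun t => ?_) ?_ ((hs S₁).add (hs S₂))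
  · by_cases ht : 1 ≤ t ∧ t ≤ T
    swap
    · rw [hy.eq_zero T t ht]
      simp
    split_ifs with c1 c2 c3 c3 c2 c3 c3
    all_goals first
      | nlinarith [sq_nonneg (y T t)]
      | skip
    exfalso
    have hN2 : (N T : ℤ) / 2 ≤ N T := by omega
    rw [hS₁, Finset.mem_Ioc, not_and, not_le] at c2
    rw [hS₂, Finset.mem_Ioc, and_comm, not_and, not_lt] at c3
    have c2' := c2 (by omega)
    have c3' := c3 ht.2
    rw [Int.floor_lt] at c2'
    rw [Int.le_floor] at c3'
    rcases c1 with c1 | c1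
    · have : (t : ℝ) ≤ N T + h := by
        have : t ≤ N T + h := by omega
        exact_mod_cast this
      linarith
    · have : (T : ℝ) ≤ t + N T + h := by
        have : (T : ℤ) ≤ t + N T + h := by omega
        exact_mod_cast this
      linarith
  · refine Summable.of_nonneg_of_le (fun t => hnn _ t) (fun t => ?_) (hy.summable T)
    split_ifs
    · exact le_rfl
    · exact sq_nonneg _

/-- The block average of sample autocovariances is asymptotically nonnegative at large lags. -/
lemma NoiseBounds.eventually_blockAvg_ge (hy : NoiseBounds y C) (hC : 0 ≤ C) {a : ℕ → ℤ → ℝ}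
    {E : ℕ → ℕ → ℝ} (hE0 : ∀ h, Tendsto (E h) atTop (𝓝 0)) (hev : ∀ T, Even (N T))
    (hn : Tendsto n atTop atTop) (hN : Tendsto N atTop atTop)
    (hNT : Tendsto (fun T : ℕ => (N T : ℝ) / T) atTop (𝓝 0))
    (hnN : Tendsto (fun T : ℕ => (n T : ℝ) / N T) atTop (𝓝 0))
    (hE : ∀ h : ℕ, ∀ᶠ T : ℕ in atTop, ∀ σ : ℤ, |σ| = h → blockAvg (n T) T (fun r =>
      winAvg (N T) ((r : ℤ) * n T - (N T : ℤ) / 2)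
        (fun s => (a T (s + σ) - a T ((r : ℤ) * n T)) ^ 2)) ≤ E h T)
    {ε : ℝ} (hε : 0 < ε) : ∀ᶠ h : ℕ in atTop, ∀ᶠ T : ℕ in atTop,
      -ε ≤ blockAvg (n T) T (fun r => winCov (N T) ((r : ℤ) * n T - (N T : ℤ) / 2) h
        (fun s => a T s + y T s)) := by
  set B : ℝ := C + 1 with hB
  have hB0 : 0 < B := by linarith
  have hε8 : 0 < ε / 8 := by positivity
  -- the width of the ends, the smoothing length and the weight of the trend
  obtain ⟨i, hi⟩ : ∃ i : ℕ, (4 * C + 1) * (1 / ((i : ℝ) + 1)) < ε / 8 := by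
    have := (tendsto_one_div_add_atTop_nhds_zero_nat (𝕜 := ℝ)).const_mul (4 * C + 1)
    rw [mul_zero] at this
    exact (this.eventually (gt_mem_nhds hε8)).exists
  obtain ⟨M, hM1, hM⟩ : ∃ M : ℕ, 1 ≤ M ∧
      8 * (2 * C * ((M : ℝ)⁻¹ * ∑ q ∈ Finset.range M, 1 / ((q : ℝ) + 1))) < ε / 8 := by
    have := (tendsto_average_harmonic.const_mul (2 * C)).const_mul 8
    rw [mul_zero, mul_zero] at this
    exact ((eventually_ge_atTop 1).and (this.eventually (gt_mem_nhds hε8))).exists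
  set θ : ℝ := ε / (16 * B) with hθ
  have hθ0 : 0 < θ := by positivity
  have hθB : 2 * θ * B = ε / 8 := by
    rw [hθ]
    field_simp
    norm_num
  -- A large lag is needed only here, to make the limiting lagged average small. The end width, `M`
  -- and `θ` are fixed before `h`, and `T` is taken large last.
  have hlag : Tendsto (fun h : ℕ => C / (1 + 2 * (h : ℝ))) atTop (𝓝 0) := by
    refine tendsto_const_nhds.div_atTop (tendsto_atTop_add_const_left _ _ ?_)
    exact tendsto_natCast_atTop_atTop.const_mul_atTop two_pos
  filter_upwards [hlag.eventually (gt_mem_nhds hε8)] with h hh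
  have hw : Tendsto (fun T : ℕ => ((n T : ℝ) / N T + 32 * M / N T) * B) atTop (𝓝 0) := by
    simpa using (hnN.add (tendsto_const_div_window hN (32 * M))).mul_const B
  have hEθ : Tendsto (fun T : ℕ => (4 + 1 / θ) * E h T) atTop (𝓝 0) := by
    simpa using (hE0 h).const_mul (4 + 1 / θ)
  -- The error budget has eight parts of `ε / 8`: two for the lagged average, two for the forward
  -- averages, and one each for the window weights, the `θ` term, the ends and the trend. The bound
  -- at lag zero keeps the noise energy below `B = C + 1`.
  filter_upwards [hE h, hy.lag 0 1 one_pos, hy.lag (2 * h) (ε / 8) hε8,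
    hy.eventually_fwdAvg_le hC hM1 (show 0 < ε / 64 by positivity),
    hy.eventually_ends_le hNT h i, hw.eventually (gt_mem_nhds hε8),
    hEθ.eventually (gt_mem_nhds hε8), hn.eventually_ge_atTop 1, hN.eventually_ge_atTop M,
    hnN.eventually (gt_mem_nhds one_pos)] with T k1 k2 k3 k4 k5 k6 k7 k8 k9 k10
  have hN1 : 1 ≤ N T := hM1.trans k9
  have hN' : (0 : ℝ) < N T := by exact_mod_cast hN1
  have hnN' : n T ≤ N T := by
    rw [div_lt_one hN'] at k10
    exact_mod_cast k10.le
  have key := blockAvg_winCov_ge (T := T) (hy.summable T) (a T) k8 (hev T) hN1 hnN' hM1 k9 h hθ0 k1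
  refine le_trans ?_ key
  have k2' : (T : ℝ)⁻¹ * ∑' s, y T s ^ 2 ≤ B := by
    have := (abs_le.1 k2).2
    simp only [add_zero, abs_zero, Int.cast_zero, div_one, ← sq] at this
    exact this
  have k3' := (abs_le.1 k3).1
  have e1 : ((|2 * (h : ℤ)| : ℤ) : ℝ) = 2 * h := by
    rw [abs_of_nonneg (by positivity)]
    push_cast
    ring
  rw [e1] at k3'
  have k6' : ((n T : ℝ) / N T + 32 * M / N T + 2 * θ) * ((T : ℝ)⁻¹ * ∑' s, y T s ^ 2) ≤
      ((n T : ℝ) / N T + 32 * M / N T + 2 * θ) * B :=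
    mul_le_mul_of_nonneg_left k2' (by positivity)
  rw [add_mul _ (2 * θ) B, hθB] at k6'
  linarith

end LowerBound

/-! ### The double-kernel estimator -/

section Gamma

variable {Ω : Type*} [MeasurableSpace Ω] {P : Measure Ω} [IsProbabilityMeasure P]
  {m : ℕ} {lam : Fin (m + 2) → ℝ} {A : ℝ → ℝ → ℂ} {μ : Fin (m + 1) → ℝ → ℝ} {V : ℕ → ℕ → Ω → ℝ}
  {C K D : ℝ} {n N : ℕ → ℕ}

/-- A vanishing lower bound for the double-kernel autocovariance estimator. -/
theorem MomentBounds.gammaDKGeAlmostSurely (h : MomentBounds P lam A μ V C)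
    (hD : VarianceBounds P V D) (hlam : IsBreakFractions lam) (hR : RegimeBounds lam A μ K)
    (hev : ∀ T, Even (N T)) (hn : Tendsto n atTop atTop) (hN : Tendsto N atTop atTop)
    (hNT : Tendsto (fun T : ℕ => (N T : ℝ) / T) atTop (𝓝 0))
    (hnN : Tendsto (fun T : ℕ => (n T : ℝ) / N T) atTop (𝓝 0)) {d : ℕ → ℝ}
    (hd : Tendsto d atTop (𝓝 0)) : GammaDKGeAlmostSurely P V n N d := by
  filter_upwards [h.ae_noiseBounds hD hlam] with x hx ε hε
  have hE : ∀ q : ℕ, ∀ᶠ T : ℕ in atTop, ∀ σ : ℤ, |σ| = q → blockAvg (n T) T (fun r =>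
      winAvg (N T) ((r : ℤ) * n T - (N T : ℤ) / 2) (fun s =>
        (obsMean P V T (s + σ) - obsMean P V T ((r : ℤ) * n T)) ^ 2)) ≤
      (K * ((N T + q) / T)) ^ 2 + 8 * K ^ 2 * ((m + 2) * ((2 * ((N T : ℝ) + q) + 1) / T)) := by
    intro q
    filter_upwards [eventually_ge_atTop 1, hn.eventually_ge_atTop 1, hN.eventually_ge_atTop 1,
      hnN.eventually (gt_mem_nhds one_pos)] with T hT hn1 hN1 hnN1 σ hσ
    have hN' : (0 : ℝ) < N T := by exact_mod_cast hN1
    rw [div_lt_one hN'] at hnN1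
    exact h.blockAvg_trend_le hlam hR hT hn1 (hev T) hN1 (by exact_mod_cast hnN1.le) q hσ
  have key := hx.eventually_blockAvg_ge h.nonneg (a := fun T => obsMean P V T)
    (fun q => tendsto_trendError (K := K) (m := m) hNT q) hev hn hN hNT hnN hE (half_pos hε)
  -- Half of `ε` pays for the estimator's lower bound and half for `d T`, which tends to zero.
  filter_upwards [key] with q hq
  filter_upwards [hq, hd.eventually (gt_mem_nhds (half_pos hε)), eventually_ge_atTop 1]
    with T h1 h2 hT
  rw [gammaDK_eq V (n T) (N T) hT q x]
  have e : (fun t => obs V T t x) = fun s => obsMean P V T s + centered P V T s x := by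
    ext t
    exact obs_eq_add T t x
  rw [e]
  linarith

/-- A mean gap weighted by the block fraction vanishes, and is positive if its limit is not
zero. -/
lemma weighted_gap_limit {γ g : ℝ} (hγ : γ ∈ Ioo (0 : ℝ) 1) {gap : ℕ → ℝ}
    (hgap : Tendsto gap atTop (𝓝 g)) (hn : Tendsto n atTop atTop)
    (hnT : Tendsto (fun T : ℕ => (n T : ℝ) / T) atTop (𝓝 0)) {d : ℕ → ℝ}
    (hd : ∀ T, d T = (n T : ℝ) / T * (γ * (1 - γ) * gap T ^ 2)) :
    Tendsto d atTop (𝓝 0) ∧ (g ≠ 0 → ∀ᶠ T : ℕ in atTop, 0 < d T) := by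
  constructor
  · have := hnT.mul ((hgap.pow 2).const_mul (γ * (1 - γ)))
    rw [zero_mul] at this
    exact this.congr fun T => (hd T).symm
  · intro hg
    filter_upwards [hgap.eventually_ne hg, hn.eventually_ge_atTop 1, eventually_ge_atTop 1]
      with T h1 h2 hT
    have hT' : (0 : ℝ) < T := by exact_mod_cast hT
    have hn' : (0 : ℝ) < n T := by exact_mod_cast h2
    have h3 : 0 < 1 - γ := sub_pos.2 hγ.2
    have h4 := hγ.1
    rw [hd]
    positivity

end Gamma

end SLS

end

/-! ### The main theorem -/

theorem mainTheorem3 {Ω : Type*} [MeasurableSpace Ω] (P : Measure Ω) [IsProbabilityMeasure P]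
    (m : ℕ) (lam : Fin (m + 2) → ℝ) (hlam : SLS.IsBreakFractions lam)
    (A : ℝ → ℝ → ℂ) (μ : Fin (m + 1) → ℝ → ℝ) (V : ℕ → ℕ → Ω → ℝ)
    (hV : SLS.IsSLS P lam A μ V) (hA : SLS.SmoothTransfer lam A)
    (hdep : SLS.WeakDependence P lam A V)
    (n n₂ : ℕ → ℕ) (hn₂_even : ∀ T, Even (n₂ T))
    (hn : Tendsto n atTop atTop) (hn₂ : Tendsto n₂ atTop atTop)
    (hnT : Tendsto (fun T : ℕ => (n T : ℝ) / T) atTop (𝓝 0))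
    (hn₂T : Tendsto (fun T : ℕ => (n₂ T : ℝ) / T) atTop (𝓝 0))
    (hnn₂ : Tendsto (fun T : ℕ => (n T : ℝ) / n₂ T) atTop (𝓝 0)) :
    -- (i) no break in the local window
    (∀ (k : ℤ) (u : ℕ → ℝ) (δ : ℝ), Even k → 0 < δ → (∀ T, u T ∈ Icc δ (1 - δ)) →
      (∀ᶠ T : ℕ in atTop, ∀ j : Fin m, SLS.breakDate lam T j ∉
        Icc (SLS.winLo (n₂ T) T (u T) k) (SLS.winHi (n₂ T) T (u T) k)) →
      SLS.EqInProbability P (fun T => SLS.sampleLocalCov V (n₂ T) T (u T) k)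
        (fun T => SLS.localCov A (u T) k)) ∧
    -- (ii) break `j` lies in the local window
    (∀ (k : ℤ) (u : ℕ → ℝ) (j : Fin m), Even k → (∀ T, u T ∈ Ioo (0 : ℝ) 1) →
      SLS.BreakInWindow lam n₂ u k j →
      -- (ii-a) interior fraction, measured from the left edge or from the right edge
      (∀ γ ∈ Ioo (0 : ℝ) 1,
        (SLS.LeftFraction lam n₂ u k j γ →
          SLS.GeInProbability P (fun T => SLS.sampleLocalCov V (n₂ T) T (u T) k)
            (fun T => γ * SLS.localCov A (SLS.breakFrac lam j) k +
              (1 - γ) * SLS.postBreak (fun v => SLS.localCov A v k) (SLS.breakFrac lam j) (u T) +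
              γ * (1 - γ) * SLS.meanGapLeft lam μ j (u T) ^ 2)) ∧
        (SLS.RightFraction lam n₂ u k j γ →
          SLS.GeInProbability P (fun T => SLS.sampleLocalCov V (n₂ T) T (u T) k)
            (fun T => γ * Function.rightLim (fun v => SLS.localCov A v k) (SLS.breakFrac lam j) +
              (1 - γ) * SLS.preBreak (fun v => SLS.localCov A v k) (SLS.breakFrac lam j) (u T) +
              γ * (1 - γ) * SLS.meanGapRight lam μ j (u T) ^ 2))) ∧
      -- (ii-b) the break is at an edge of the window
      (SLS.LeftFraction lam n₂ u k j 0 ∨ SLS.RightFraction lam n₂ u k j 0 →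
        SLS.EqInProbability P (fun T => SLS.sampleLocalCov V (n₂ T) T (u T) k)
          (fun T => SLS.localCov A (u T) k))) ∧
    -- a block `r T` whose window contains break `j` as in (ii-a)
    (∀ (k₀ : ℤ) (r : ℕ → ℕ) (j : Fin m), Even k₀ →
      (∀ᶠ T : ℕ in atTop, r T ∈ Finset.Icc 1 (T / n T)) →
      SLS.BreakInWindow lam n₂ (fun T => (r T : ℝ) * n T / T) k₀ j →
      ∀ γ ∈ Ioo (0 : ℝ) 1, ∀ d : ℕ → ℝ,
        ((SLS.LeftFraction lam n₂ (fun T => (r T : ℝ) * n T / T) k₀ j γ ∧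
            ∀ T, d T = (n T : ℝ) / T *
              (γ * (1 - γ) * SLS.meanGapLeft lam μ j ((r T : ℝ) * n T / T) ^ 2)) ∨
          (SLS.RightFraction lam n₂ (fun T => (r T : ℝ) * n T / T) k₀ j γ ∧
            ∀ T, d T = (n T : ℝ) / T *
              (γ * (1 - γ) * SLS.meanGapRight lam μ j ((r T : ℝ) * n T / T) ^ 2))) →
        SLS.GammaDKGeAlmostSurely P V n n₂ d ∧
        Tendsto d atTop (𝓝 0) ∧
        (μ j.castSucc (SLS.breakFrac lam j) ≠
            Function.rightLim (μ j.succ) (SLS.breakFrac lam j) →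
          ∀ᶠ T : ℕ in atTop, 0 < d T)) := by
  obtain ⟨C, hM⟩ := hV.exists_momentBounds hlam hA
  obtain ⟨D, hD⟩ := hM.exists_varianceBounds hdep
  obtain ⟨K, hKC, hR⟩ := hM.exists_regimeBounds hlam hV
  refine ⟨fun k u δ hk hδ hu hno => ?_, fun k u j hk _ hin => ?_,
    fun k₀ r j hk _ hin γ hγ d hd => ?_⟩
  · obtain ⟨κ, rfl⟩ := hk.two_dvd
    exact hM.sampleLocalCov_of_no_break hD hlam hKC hR hn₂_even hn₂ hn₂T hδ hu hno
  · obtain ⟨κ, rfl⟩ := hk.two_dvd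
    have key := hM.sampleLocalCov_of_break hD hlam hKC hR hn₂_even hn₂ hn₂T hin
    -- The lower bounds are weakenings of equalities up to `o_P(1)`.
    exact ⟨fun γ _ => ⟨fun h => ((key.1 γ).1 h).ge, fun h => ((key.1 γ).2 h).ge⟩, key.2⟩
  · obtain ⟨κ, rfl⟩ := hk.two_dvd
    have hu := hin.tendsto hn₂T
    -- The two versions of the mean gap have the same limit, the jump of the trend across the break,
    -- so both cases end in the same statement.
    have hgap : Tendsto d atTop (𝓝 0) ∧ (μ j.castSucc (SLS.breakFrac lam j) -
        Function.rightLim (μ j.succ) (SLS.breakFrac lam j) ≠ 0 → ∀ᶠ T : ℕ in atTop, 0 < d T) := by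
      rcases hd with ⟨-, hd⟩ | ⟨-, hd⟩
      · exact SLS.weighted_gap_limit hγ (hR.tendsto_meanGapLeft hlam hu) hn hnT hd
      · exact SLS.weighted_gap_limit hγ (hR.tendsto_meanGapRight hlam hu) hn hnT hd
    exact ⟨hM.gammaDKGeAlmostSurely hD hlam hR hn₂_even hn hn₂ hn₂T hnn₂ hgap.1, hgap.1,
      fun hne => hgap.2 (sub_ne_zero.2 hne)⟩
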